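/- Let $K$ be a field, $Q$ a finite quiver and $KQ$ its path algebra (the product $pq$ means first $p$, then $q$), graded by path length, with $Q_u$ the set of paths of length $u$ and $KQ_u$ its span. Let $n\ge 2$ and $m$ be integers, and let $\Lambda=KQ/I$ be a graded factor of $KQ$ with relations of degree $\ge n$, i.e. $I$ is a two-sided ideal generated by homogeneous elements of degree $\ge n$; put $I_n=I\cap KQ_n$, identify $\Lambda_0=KQ_0$, and let $J^{gr}(\Lambda)=\bigoplus_{i>0}\Lambda_i$. Unadorned $\otimes$ is over $KQ_0$. Let $I_n^\perp\subseteq KQ_n^{op}$ be the orthogonal of $I_n$ under the canonical duality $KQ_n^{op}\otimes KQ_n\to KQ_0$, for which the opposite paths $p^o$ ($p\in Q_n$) are dual to the paths, and let $\Lambda^!=KQ^{op}/\langle I_n^\perp\rangle$. For a $\mathbb Z$-graded algebra $A$, $Gr_A$ is the category of $\mathbb Z$-graded right $A$-modules and degree-preserving $A$-linear maps. A graded module is generated (resp. cogenerated) in degrees belonging to $\mathcal X\subseteq\mathbb Z$ if the support of every nonzero graded factor (resp. graded submodule) of it meets $\mathcal X$. Put $\mathcal U=n\mathbb Z\cup(n\mathbb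 Z+1)$, $\mathcal S=m+\mathcal U$ and $(\mathcal S:\mathcal U)=\{z\in\mathbb Z: z+\mathcal U\subseteq\mathcal S\}$ (this is $m+n\mathbb Z$ if $n>2$, and $\mathbb Z$ if $n=2$). Let $\Lambda^!_{\mathcal U}=\bigoplus_{u\in\mathcal U}\Lambda^!_u$, with the product of homogeneous elements $a,b$ equal to their product $ab$ in $\Lambda^!$ if $\deg a+\deg b\in\mathcal U$, and $0$ otherwise. For $X\in Gr_{\Lambda^!_{\mathcal U}}$ and $0\le u\in\mathcal U$, the comultiplication is the $KQ_0$-linear map $$\Delta:X_i\to X_{i+u}\otimes KQ_u,\qquad \Delta(x)=\sum_{p\in Q_u}x\,\overline{p}^{\,o}\otimes p,$$ where $\overline{p}^{\,o}$ is the image of $p^o$ in $\Lambda^!_u$. A linear $n$-complex of projective graded $\Lambda$-modules is a sequence $d^k:P^k\to P^{k+1}$ ($k\in\mathbb Z$) in $Gr_\Lambda$ with $d^{k+n-1}\circ\cdots\circ d^k=0$ for all $k$, and with each $P^k$ projective in $Gr_\Lambda$ and generated in degree $-k$. Let $\delta_m(2k)=m+kn$ and $\delta_m(2k+1)=m+kn+1$.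 The complex $G_m(P)=(\tilde P^\cdot,\tilde d^\cdot)$ has $\tilde P^j=P^{-\delta_m(-j)}$, $\tilde d^{2j-1}=d^{-m+jn-1}$ and $\tilde d^{2j}=d^{-m+(j+1)n-2}\circ\cdots\circ d^{-m+jn}$. A complex in the category $C(Gr_\Lambda)$ of cochain complexes of graded $\Lambda$-modules is $G_m$-liftable if it is isomorphic to $G_m(P)$ for some such $P$. **Theorem.** There is an equivalence between the following categories. 1. The full subcategory $\mathcal L^o(\mathcal S,\mathcal U)$ of $Gr_{\Lambda^!_{\mathcal U}}$ whose objects are those $X$ that are cogenerated in degrees belonging to $-(\mathcal S:\mathcal U)$ and such that, for every $k\in\mathbb Z$, there is a $KQ_0$-linear map $\varphi:X_{-m-(k+1)n}\to X_{-m-kn-1}\otimes KQ_{n-1}$ for which the composite $$X_{-m-(k+1)n}\xrightarrow{\ \varphi\ }X_{-m-kn-1}\otimes KQ_{n-1}\xrightarrow{\ \Delta\otimes 1\ }X_{-m-kn}\otimes KQ_1\otimes KQ_{n-1}\cong X_{-m-kn}\otimes KQ_n$$ equals $\Delta:X_{-m-(k+1)n}\to X_{-m-kn}\otimes KQ_n$.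 2. The full subcategory $\mathcal Y^o(\mathcal S,\mathcal U)$ of $C(Gr_\Lambda)$ whose objects are the $G_m$-liftable complexes $(\tilde P^\cdot,\tilde d^\cdot)$ satisfying condition (a) below if $n=2$, and conditions (a) and (b) if $n>2$: (a) $\tilde P^j$ is a projective graded $\Lambda$-module generated in degree $\delta_m(-j)$, for every $j\in\mathbb Z$; (b) $\operatorname{Ker}\tilde d^{2k-1}\subseteq\tilde P^{2k-1}\cdot J^{gr}(\Lambda)$, for every $k\in\mathbb Z$. -/

import Mathlib

open CategoryTheory DirectSum
open scoped TensorProduct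

universe u

noncomputable section

namespace NKoszul

/-! ### The path algebra of a finite quiver -/

/-- All paths of a quiver, trivial ones included. -/
abbrev QPath (V : Type u) [Quiver.{u} V] : Type u :=
  Σ i : V, Σ j : V, Quiver.Path i j

namespace QPath

variable {V : Type u} [Quiver.{u} V]

/-- The origin of a path. -/
abbrev src (p : QPath V) : V := p.1

/-- The terminus of a path. -/
abbrev tgt (p : QPath V) : V := p.2.1

/-- The length of a path. -/
abbrev len (p : QPath V) : ℕ := p.2.2.length

/-- The trivial path at a vertex. -/
abbrev triv (i : V) : QPath V := ⟨i, i, Quiver.Path.nil⟩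

/-- The concatenation `pq` (first `p`, then `q`) of two composable paths. -/
def concat (p q : QPath V) (h : p.tgt = q.src) : QPath V :=
  ⟨p.1, q.2.1, p.2.2.comp (q.2.2.cast h.symm rfl)⟩

lemma concat_mk {i j k : V} (a : Quiver.Path i j) (b : Quiver.Path j k) :
    concat ⟨i, j, a⟩ ⟨j, k, b⟩ rfl = ⟨i, k, a.comp b⟩ := rfl

lemma len_concat (p q : QPath V) (h : p.tgt = q.src) :
    (concat p q h).len = p.len + q.len := by
  obtain ⟨i, j, a⟩ := p
  obtain ⟨j', k, b⟩ := q
  obtain rfl : j = j' := h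
  exact Quiver.Path.length_comp a b

lemma concat_assoc (p q r : QPath V) (h : p.tgt = q.src) (h' : q.tgt = r.src) :
    concat (concat p q h) r h' = concat p (concat q r h') h := by
  obtain ⟨i, j, a⟩ := p
  obtain ⟨j', k, b⟩ := q
  obtain ⟨k', l, c⟩ := r
  obtain rfl : j = j' := h
  obtain rfl : k = k' := h'
  simp only [concat_mk, Quiver.Path.comp_assoc]

lemma triv_concat (i : V) (p : QPath V) (h : i = p.src) : concat (triv i) p h = p := by
  obtain ⟨j, k, b⟩ := p
  obtain rfl : i = j := h
  simp [concat_mk]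

lemma concat_triv (i : V) (p : QPath V) (h : p.tgt = i) : concat p (triv i) h = p := by
  obtain ⟨j, k, b⟩ := p
  obtain rfl : k = i := h
  rfl

end QPath

/-- The underlying vector space of the path algebra `KQ`: it has the paths as a basis. -/
def PathAlg (K V : Type u) [Field K] [Quiver.{u} V] : Type u := QPath V →₀ K

namespace PathAlg

variable {K V : Type u} [Field K] [Quiver.{u} V]

instance : AddCommGroup (PathAlg K V) := inferInstanceAs (AddCommGroup (QPath V →₀ K))

instance : Module K (PathAlg K V) := inferInstanceAs (Module K (QPath V →₀ K))

/-- The scalar multiple `c p` of a path `p`. -/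
def path (p : QPath V) (c : K) : PathAlg K V := Finsupp.single p c

/-- The coefficient of a path in an element of the path algebra. -/
def coeff (x : PathAlg K V) (p : QPath V) : K := (show QPath V →₀ K from x) p

open scoped Classical in
/-- The product of two basis elements: concatenation if possible, and zero otherwise. -/
def pathMul (p q : QPath V) : PathAlg K V :=
  if h : p.tgt = q.src then path (p.concat q h) 1 else 0

/-- The linear map with prescribed values on the basis of paths. -/
def lift {M : Type*} [AddCommMonoid M] [Module K M] (v : QPath V → M) : PathAlg K V →ₗ[K] M :=
  Finsupp.linearCombination K v

lemma lift_path {M : Type*} [AddCommMonoid M] [Module K M] (v : QPath V → M) (p : QPath V) :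
    lift v (path p (1 : K)) = v p :=
  (Finsupp.linearCombination_single K 1 p).trans (one_smul _ _)

/-- The multiplication of the path algebra, as a bilinear map. -/
def mulHom : PathAlg K V →ₗ[K] PathAlg K V →ₗ[K] PathAlg K V :=
  lift fun p => lift fun q => pathMul p q

instance : Mul (PathAlg K V) := ⟨fun x y => mulHom x y⟩

lemma mul_def (x y : PathAlg K V) : x * y = mulHom x y := rfl

lemma path_eq_smul (p : QPath V) (c : K) : path p c = c • path p (1 : K) :=
  (Finsupp.smul_single_one p c).symm

lemma path_add (p : QPath V) (c d : K) : path p (c + d) = path p c + path p d :=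
  Finsupp.single_add p c d

lemma path_mul_path (p q : QPath V) :
    (path p 1 : PathAlg K V) * path q 1 = pathMul p q := by
  rw [mul_def, mulHom, lift_path, lift_path]

@[elab_as_elim]
lemma induction {P : PathAlg K V → Prop} (x : PathAlg K V) (zero : P 0)
    (add : ∀ x y, P x → P y → P (x + y)) (smul : ∀ (c : K) x, P x → P (c • x))
    (path : ∀ p, P (path p 1)) : P x := by
  refine Finsupp.induction_linear (motive := P) x zero add fun p c => ?_
  have := smul c _ (path p)
  rwa [← path_eq_smul] at this

lemma hom_ext {M : Type*} [AddCommMonoid M] [Module K M] {f g : PathAlg K V →ₗ[K] M}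
    (h : ∀ p, f (path p 1) = g (path p 1)) : f = g :=
  Finsupp.lhom_ext' fun p => LinearMap.ext_ring (h p)

instance : NonUnitalNonAssocRing (PathAlg K V) where
  left_distrib x y z := by simp [mul_def]
  right_distrib x y z := by simp [mul_def]
  zero_mul x := by simp [mul_def]
  mul_zero x := by simp [mul_def]

instance : IsScalarTower K (PathAlg K V) (PathAlg K V) :=
  ⟨fun c x y => by simp [mul_def, smul_eq_mul]⟩

instance : SMulCommClass K (PathAlg K V) (PathAlg K V) :=
  ⟨fun c x y => by simp [mul_def, smul_eq_mul]⟩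

lemma pathMul_of_eq {p q : QPath V} (h : p.tgt = q.src) :
    (pathMul p q : PathAlg K V) = path (p.concat q h) 1 := dif_pos h

lemma pathMul_of_ne {p q : QPath V} (h : p.tgt ≠ q.src) :
    (pathMul p q : PathAlg K V) = 0 := dif_neg h

lemma path_mul_assoc (p q r : QPath V) :
    ((path p 1 : PathAlg K V) * path q 1) * path r 1 = path p 1 * (path q 1 * path r 1) := by
  rw [path_mul_path, path_mul_path]
  by_cases h : p.tgt = q.src
  · by_cases h' : q.tgt = r.src
    · rw [pathMul_of_eq h, pathMul_of_eq h', path_mul_path, path_mul_path,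
        pathMul_of_eq (p := p.concat q h) h', pathMul_of_eq (q := q.concat r h') h,
        QPath.concat_assoc]
    · rw [pathMul_of_eq h, pathMul_of_ne h', path_mul_path,
        pathMul_of_ne (p := p.concat q h) h', mul_zero]
  · by_cases h' : q.tgt = r.src
    · rw [pathMul_of_ne h, pathMul_of_eq h', path_mul_path,
        pathMul_of_ne (q := q.concat r h') h, zero_mul]
    · rw [pathMul_of_ne h, pathMul_of_ne h', mul_zero, zero_mul]

/-- `KQₖ`: the span of the paths of length `k`. -/
def pathDeg (K V : Type u) [Field K] [Quiver.{u} V] (k : ℤ) : Submodule K (PathAlg K V) :=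
  Submodule.span K ((fun p => path p (1 : K)) '' {p | (p.len : ℤ) = k})

lemma path_mem (p : QPath V) : path p (1 : K) ∈ pathDeg K V p.len :=
  Submodule.subset_span ⟨p, rfl, rfl⟩

lemma path_mem' (p : QPath V) {k : ℤ} (h : (p.len : ℤ) = k) : path p (1 : K) ∈ pathDeg K V k :=
  h ▸ path_mem p

lemma pathMul_mem (p q : QPath V) :
    (pathMul p q : PathAlg K V) ∈ pathDeg K V (p.len + q.len) := by
  by_cases h : p.tgt = q.src
  · rw [pathMul_of_eq h]
    exact path_mem' _ (by rw [QPath.len_concat]; push_cast; rfl)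
  · rw [pathMul_of_ne h]
    exact zero_mem _

variable [Fintype V]

/-- The element `∑ rᵢ eᵢ` of the path algebra, for a family of scalars `r` indexed by the
vertices. -/
def vertexSum (r : V → K) : PathAlg K V := ∑ i, path (QPath.triv i) (r i)

lemma vertexSum_mul_path (r : V → K) (p : QPath V) :
    vertexSum r * path p 1 = r p.src • (path p 1 : PathAlg K V) := by
  classical
  rw [vertexSum, Finset.sum_mul, Finset.sum_eq_single p.src]
  · rw [path_eq_smul, smul_mul_assoc, path_mul_path, pathMul_of_eq rfl, QPath.triv_concat]
  · intro i _ hi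
    rw [path_eq_smul, smul_mul_assoc, path_mul_path, pathMul_of_ne hi, smul_zero]
  · simp

lemma path_mul_vertexSum (r : V → K) (p : QPath V) :
    path p 1 * vertexSum r = r p.tgt • (path p 1 : PathAlg K V) := by
  classical
  rw [vertexSum, Finset.mul_sum, Finset.sum_eq_single p.tgt]
  · rw [path_eq_smul _ (r _), mul_smul_comm, path_mul_path, pathMul_of_eq rfl, QPath.concat_triv]
  · intro i _ hi
    rw [path_eq_smul _ (r _), mul_smul_comm, path_mul_path, pathMul_of_ne (Ne.symm hi), smul_zero]
  · simp

/-- The identity is the sum of the trivial paths. -/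
instance : One (PathAlg K V) := ⟨vertexSum 1⟩

lemma one_def : (1 : PathAlg K V) = vertexSum 1 := rfl

instance : Ring (PathAlg K V) where
  mul_assoc x y z := by
    induction x using induction with
    | zero => simp
    | add a b ha hb => simp only [add_mul, ha, hb]
    | smul c a ha => simp only [smul_mul_assoc, ha]
    | path p =>
      induction y using induction with
      | zero => simp
      | add a b ha hb => simp only [add_mul, mul_add, ha, hb]
      | smul c a ha => simp only [smul_mul_assoc, mul_smul_comm, ha]
      | path q =>
        induction z using induction with
        | zero => simp
        | add a b ha hb => simp only [mul_add, ha, hb]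
        | smul c a ha => simp only [mul_smul_comm, ha]
        | path r => exact path_mul_assoc p q r
  one_mul x := by
    induction x using induction with
    | zero => simp
    | add a b ha hb => simp only [mul_add, ha, hb]
    | smul c a ha => simp only [mul_smul_comm, ha]
    | path p => simp [one_def, vertexSum_mul_path]
  mul_one x := by
    induction x using induction with
    | zero => simp
    | add a b ha hb => simp only [add_mul, ha, hb]
    | smul c a ha => simp only [smul_mul_assoc, ha]
    | path p => simp [one_def, path_mul_vertexSum]

instance : Algebra K (PathAlg K V) := Algebra.ofModule smul_mul_assoc mul_smul_comm

/-- The embedding of `KQ₀`, the algebra of families of scalars indexed by the vertices, into the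
path algebra. -/
def vertexHom : (V → K) →ₐ[K] PathAlg K V :=
  AlgHom.ofLinearMap
    { toFun := vertexSum
      map_add' := fun r s => by simp [vertexSum, path_add, Finset.sum_add_distrib]
      map_smul' := fun c r => by
        simp only [vertexSum, Finset.smul_sum, RingHom.id_apply, Pi.smul_apply]
        exact Finset.sum_congr rfl fun i _ => by
          rw [path_eq_smul, path_eq_smul _ (r i), smul_smul, smul_eq_mul] }
    rfl
    (fun r s => by
      change vertexSum (r * s) = vertexSum r * vertexSum s
      conv_rhs => rw [vertexSum.eq_1 s, Finset.mul_sum]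
      rw [vertexSum]
      refine Finset.sum_congr rfl fun i _ => ?_
      rw [path_eq_smul, path_eq_smul _ (s i), mul_smul_comm, vertexSum_mul_path, smul_smul,
        Pi.mul_apply, mul_comm])

lemma vertexHom_apply (r : V → K) : (vertexHom r : PathAlg K V) = vertexSum r := rfl


lemma vertexSum_mem (r : V → K) : (vertexSum r : PathAlg K V) ∈ pathDeg K V 0 :=
  sum_mem fun i _ => by
    rw [path_eq_smul]
    exact Submodule.smul_mem _ _ (path_mem' _ rfl)

lemma one_mem_pathDeg : (1 : PathAlg K V) ∈ pathDeg K V 0 := vertexSum_mem 1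

lemma mul_mem_pathDeg {i j : ℤ} {x y : PathAlg K V} (hx : x ∈ pathDeg K V i)
    (hy : y ∈ pathDeg K V j) : x * y ∈ pathDeg K V (i + j) := by
  induction hx using Submodule.span_induction with
  | zero => simp
  | add a b _ _ ha hb => rw [add_mul]; exact add_mem ha hb
  | smul c a _ ha => rw [smul_mul_assoc]; exact Submodule.smul_mem _ _ ha
  | mem a ha =>
    obtain ⟨p, hp, rfl⟩ := ha
    induction hy using Submodule.span_induction with
    | zero => simp
    | add a b _ _ ha hb => rw [mul_add]; exact add_mem ha hb
    | smul c a _ ha => rw [mul_smul_comm]; exact Submodule.smul_mem _ _ ha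
    | mem b hb =>
      obtain ⟨q, hq, rfl⟩ := hb
      have hp' : (p.len : ℤ) = i := hp
      have hq' : (q.len : ℤ) = j := hq
      change path p 1 * path q 1 ∈ _
      rw [path_mul_path, ← hp', ← hq']
      exact pathMul_mem p q

lemma mul_mem_pathDeg' {i j k : ℤ} (h : i + j = k) {x y : PathAlg K V} (hx : x ∈ pathDeg K V i)
    (hy : y ∈ pathDeg K V j) : x * y ∈ pathDeg K V k :=
  h ▸ mul_mem_pathDeg hx hy

/-- The canonical duality `KQₙᵒᵖ ⊗ KQₙ → KQ₀`: a pair `(pᵒ, q)` of paths goes to the idempotent of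
the terminus of `p` if `p = q`, and to zero otherwise. -/
def pairing (x y : PathAlg K V) : V → K :=
  open scoped Classical in
  Finsupp.sum (show QPath V →₀ K from x) fun p c => Pi.single p.tgt (c * coeff y p)

end PathAlg

open PathAlg

/-! ### Graded factors of a path algebra and the `n`-homogeneous dual -/

section Dual

variable {K V L : Type u} [Field K] [Quiver.{u} V] [Fintype V] [Ring L] [Algebra K L]

/-- `π : KQ → Λ` presents the graded algebra `Λ = ⨁ Λₖ` as a graded factor of the path algebra. -/
structure IsGradedFactor (𝓛 : ℤ → Submodule K L) (π : PathAlg K V →ₐ[K] L) : Prop where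
  surjective : Function.Surjective π
  map_mem : ∀ (k : ℤ) (x : PathAlg K V), x ∈ pathDeg K V k → π x ∈ 𝓛 k

/-- The ideal of relations `I = Ker π` is generated by its homogeneous elements of degree at
least `n`. -/
def HasRelationsOfDegreeGE (n : ℕ) (π : PathAlg K V →ₐ[K] L) : Prop :=
  TwoSidedIdeal.ker π =
    TwoSidedIdeal.span {x | π x = 0 ∧ ∃ k : ℤ, (n : ℤ) ≤ k ∧ x ∈ pathDeg K V k}

/-- The orthogonal `Iₙ^⊥` of `Iₙ = Ker π ∩ KQₙ`. Its elements are written in `KQₙ`; reading each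
path `p` as the opposite path `pᵒ` makes it a subset of `KQₙᵒᵖ`. -/
def perp (n : ℕ) (π : PathAlg K V →ₐ[K] L) : Set (PathAlg K V) :=
  {x | x ∈ pathDeg K V n ∧ ∀ y ∈ pathDeg K V n, π y = 0 → pairing x y = 0}

/-- The relation `Iₙ^⊥ = 0` on `KQᵒᵖ`. -/
def DualRel (n : ℕ) (π : PathAlg K V →ₐ[K] L) (a b : (PathAlg K V)ᵐᵒᵖ) : Prop :=
  a.unop ∈ perp n π ∧ b = 0

/-- The `n`-homogeneous dual algebra `Λ^! = KQᵒᵖ / ⟨Iₙ^⊥⟩`. -/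
abbrev DualAlg (n : ℕ) (π : PathAlg K V →ₐ[K] L) : Type u := RingQuot (DualRel n π)

/-- The image `x̄ᵒ` in `Λ^!` of `xᵒ ∈ KQᵒᵖ`. -/
def toDual (n : ℕ) (π : PathAlg K V →ₐ[K] L) : PathAlg K V →ₗ[K] DualAlg n π :=
  (RingQuot.mkAlgHom K (DualRel n π)).toLinearMap ∘ₗ (MulOpposite.opLinearEquiv K).toLinearMap

/-- The homogeneous components of `Λ^!`. -/
def dualDeg (n : ℕ) (π : PathAlg K V →ₐ[K] L) (k : ℤ) : Submodule K (DualAlg n π) :=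
  (pathDeg K V k).map (toDual n π)

variable (n : ℕ) (π : PathAlg K V →ₐ[K] L)

lemma toDual_mul (x y : PathAlg K V) : toDual n π (x * y) = toDual n π y * toDual n π x := by
  simp [toDual]

lemma toDual_one : toDual n π 1 = 1 := by
  simp [toDual]

lemma toDual_perp {x : PathAlg K V} (hx : x ∈ perp n π) : toDual n π x = 0 := by
  have := RingQuot.mkAlgHom_rel K (s := DualRel n π) (x := MulOpposite.op x) (y := 0) ⟨hx, rfl⟩
  rw [map_zero] at this
  exact this

lemma toDual_mem {k : ℤ} {x : PathAlg K V} (hx : x ∈ pathDeg K V k) :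
    toDual n π x ∈ dualDeg n π k := ⟨x, hx, rfl⟩

instance : SetLike.GradedMonoid (dualDeg n π) where
  one_mem := ⟨1, vertexSum_mem 1, toDual_one n π⟩
  mul_mem := by
    rintro i j _ _ ⟨x, hx, rfl⟩ ⟨y, hy, rfl⟩
    exact ⟨y * x, add_comm i j ▸ mul_mem_pathDeg hy hx, toDual_mul n π y x⟩

/-- Auxiliary: the linear map `KQ → ⨁ Λ^!ₖ` that decomposes the image of an element. -/
def decompAux : PathAlg K V →ₗ[K] ⨁ k, dualDeg n π k :=
  PathAlg.lift fun p => DirectSum.of (fun k => dualDeg n π k) p.len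
    ⟨toDual n π (path p 1), toDual_mem n π (path_mem p)⟩

lemma decompAux_of_mem {k : ℤ} {x : PathAlg K V} (hx : x ∈ pathDeg K V k) :
    decompAux n π x = DirectSum.of (fun k => dualDeg n π k) k
      ⟨toDual n π x, toDual_mem n π hx⟩ := by
  induction hx using Submodule.span_induction with
  | zero =>
    rw [map_zero]
    symm
    convert map_zero (DirectSum.of (fun k => dualDeg n π k) k)
    simp
  | add a b ha hb iha ihb =>
    rw [map_add, iha, ihb, ← map_add]
    congr 1
    ext
    simp
  | smul c a ha iha =>
    rw [map_smul, iha, ← DirectSum.lof_eq_of K, ← map_smul, DirectSum.lof_eq_of]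
    congr 1
    ext
    simp
  | mem a ha =>
    obtain ⟨p, hp, rfl⟩ := ha
    obtain rfl : (p.len : ℤ) = k := hp
    exact PathAlg.lift_path _ p

lemma decompAux_one : decompAux n π 1 = 1 := by
  rw [decompAux_of_mem n π one_mem_pathDeg]
  change _ = DirectSum.of (fun k => dualDeg n π k) 0 _
  congr 1
  ext
  exact toDual_one n π

lemma decompAux_mul (x y : PathAlg K V) :
    decompAux n π (x * y) = decompAux n π y * decompAux n π x := by
  induction x using PathAlg.induction with
  | zero => simp
  | add a b ha hb => simp only [add_mul, mul_add, map_add, ha, hb]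
  | smul c a ha => 
    rw [smul_mul_assoc, map_smul, map_smul, ha]
    exact (Algebra.mul_smul_comm _ _ _).symm
  | path p =>
    induction y using PathAlg.induction with
    | zero => simp
    | add a b ha hb => simp only [add_mul, mul_add, map_add, ha, hb]
    | smul c a ha => 
      rw [mul_smul_comm, map_smul, map_smul, ha]
      exact (Algebra.smul_mul_assoc _ _ _).symm
    | path q =>
      have h : path p (1 : K) * path q 1 ∈ pathDeg K V (q.len + p.len) := by
        rw [add_comm]
        exact mul_mem_pathDeg (path_mem p) (path_mem q)
      rw [decompAux_of_mem n π h, decompAux_of_mem n π (path_mem p),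
        decompAux_of_mem n π (path_mem q), DirectSum.of_mul_of]
      congr 1
      ext
      exact toDual_mul n π _ _

/-- Auxiliary: the algebra map `Λ^! → ⨁ Λ^!ₖ`. -/
def decompHom : DualAlg n π →ₐ[K] ⨁ k, dualDeg n π k :=
  RingQuot.liftAlgHom K ⟨AlgHom.ofLinearMap
    (decompAux n π ∘ₗ (MulOpposite.opLinearEquiv K).symm.toLinearMap)
    (decompAux_one n π) (fun a b => decompAux_mul n π b.unop a.unop), by
      rintro a b ⟨ha, rfl⟩
      rw [map_zero]
      change decompAux n π a.unop = 0
      rw [decompAux_of_mem n π ha.1]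
      convert map_zero (DirectSum.of (fun k => dualDeg n π k) n)
      exact toDual_perp n π ha⟩

lemma decompHom_toDual (x : PathAlg K V) : decompHom n π (toDual n π x) = decompAux n π x :=
  RingQuot.liftAlgHom_mkAlgHom_apply K _ _ _

/-- `Λ^!` is a graded algebra. -/
instance : GradedAlgebra (dualDeg n π) :=
  GradedAlgebra.ofAlgHom _ (decompHom n π)
    (by
      refine RingQuot.ringQuot_ext' K _ _ ?_
      refine AlgHom.toLinearMap_injective ?_
      refine LinearMap.ext fun a => ?_
      change DirectSum.coeAlgHom (dualDeg n π) (decompHom n π (toDual n π a.unop)) =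
        toDual n π a.unop
      rw [decompHom_toDual]
      induction a.unop using PathAlg.induction with
      | zero => simp
      | add a b ha hb => simp only [map_add, ha, hb]
      | smul c a ha => simp only [map_smul, ha]
      | path p => rw [decompAux_of_mem n π (path_mem p), DirectSum.coeAlgHom_of])
    (by
      rintro i ⟨_, x, hx, rfl⟩
      change decompHom n π (toDual n π x) = _
      rw [decompHom_toDual, decompAux_of_mem n π hx])

end Dual

/-! ### The algebra `A_U` supported in a set of degrees -/

/-- The set `U = nℤ ∪ (nℤ + 1)`. -/
def suppSet (n : ℕ) : Set ℤ := {k | (n : ℤ) ∣ k ∨ (n : ℤ) ∣ k - 1}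

lemma zero_mem_suppSet (n : ℕ) : (0 : ℤ) ∈ suppSet n := Or.inl (dvd_zero _)

lemma add_mem_suppSet {n : ℕ} {i j : ℤ} (h : (n : ℤ) ∣ i) : i + j ∈ suppSet n ↔ j ∈ suppSet n := by
  unfold suppSet
  simp only [Set.mem_ofPred_eq]
  rw [dvd_add_right h, add_sub_assoc, dvd_add_right h]

lemma suppSet_assoc {n : ℕ} {i j k : ℤ} (hi : i ∈ suppSet n) (hj : j ∈ suppSet n)
    (hk : k ∈ suppSet n) (h : i + j ∈ suppSet n) (h' : i + j + k ∈ suppSet n) :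
    j + k ∈ suppSet n := by
  rcases hj with hj | hj
  · exact (add_mem_suppSet hj).2 hk
  rcases hk with hk' | hk'
  · rw [add_comm]
    exact (add_mem_suppSet hk').2 (Or.inr hj)
  rcases hi with hi' | hi'
  · rwa [add_assoc, add_mem_suppSet hi'] at h'
  have hik : (n : ℤ) ∣ k - i := by
    have := dvd_sub hk' hi'
    rwa [sub_sub_sub_cancel_right] at this
  have := (add_mem_suppSet (j := i + j) hik).2 h
  rwa [show k - i + (i + j) = j + k by ring] at this

lemma suppSet_assoc' {n : ℕ} {i j k : ℤ} (hi : i ∈ suppSet n) (hj : j ∈ suppSet n)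
    (hk : k ∈ suppSet n) (h : j + k ∈ suppSet n) (h' : i + j + k ∈ suppSet n) :
    i + j ∈ suppSet n := by
  rw [add_comm]
  refine suppSet_assoc hk hj hi ?_ ?_
  · rwa [add_comm]
  · rwa [show k + j + i = i + j + k by ring]

section Trunc

variable {K A : Type u} [Field K] [Ring A] [Algebra K A] (n : ℕ)
  (𝒜 : ℤ → Submodule K A)

/-- The underlying vector space `⨁_{k ∈ U} A_k` of the algebra `A_U`. -/
def TruncAlg : Type u := ↥(⨆ k ∈ suppSet n, 𝒜 k)

instance : AddCommGroup (TruncAlg n 𝒜) :=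
  inferInstanceAs (AddCommGroup ↥(⨆ k ∈ suppSet n, 𝒜 k))

instance : Module K (TruncAlg n 𝒜) := inferInstanceAs (Module K ↥(⨆ k ∈ suppSet n, 𝒜 k))

namespace TruncAlg

/-- The inclusion of `A_U` into `A` (linear, in general not multiplicative). -/
def val : TruncAlg n 𝒜 →ₗ[K] A := (⨆ k ∈ suppSet n, 𝒜 k).subtype

lemma val_injective : Function.Injective (val n 𝒜) := Subtype.val_injective

/-- The homogeneous components of `A_U`. -/
def deg (k : ℤ) : Submodule K (TruncAlg n 𝒜) := (𝒜 k).comap (val n 𝒜)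

variable [GradedAlgebra 𝒜]

open scoped Classical in
/-- Auxiliary: the projection `A → A` onto the components with degree in `U`. -/
def projAux : A →ₗ[K] A :=
  DirectSum.toModule K ℤ A (fun k => if k ∈ suppSet n then (𝒜 k).subtype else 0) ∘ₗ
    (DirectSum.decomposeLinearEquiv 𝒜).toLinearMap

lemma projAux_of_mem {k : ℤ} (hk : k ∈ suppSet n) {a : A} (ha : a ∈ 𝒜 k) :
    projAux n 𝒜 a = a := by
  lift a to 𝒜 k using ha
  simp [projAux, hk]

lemma projAux_of_notMem {k : ℤ} (hk : k ∉ suppSet n) {a : A} (ha : a ∈ 𝒜 k) :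
    projAux n 𝒜 a = 0 := by
  lift a to 𝒜 k using ha
  simp [projAux, hk]

lemma projAux_mem (a : A) : projAux n 𝒜 a ∈ ⨆ k ∈ suppSet n, 𝒜 k := by
  induction a using DirectSum.Decomposition.inductionOn 𝒜 with
  | zero => simp
  | add a b ha hb => rw [map_add]; exact add_mem ha hb
  | @homogeneous k a =>
    by_cases hk : k ∈ suppSet n
    · rw [projAux_of_mem n 𝒜 hk a.2]
      exact Submodule.mem_iSup_of_mem k (Submodule.mem_iSup_of_mem hk a.2)
    · rw [projAux_of_notMem n 𝒜 hk a.2]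
      exact zero_mem _

/-- The projection `A → A_U`, which kills the components with degree outside `U`. -/
def proj : A →ₗ[K] TruncAlg n 𝒜 := (projAux n 𝒜).codRestrict _ (projAux_mem n 𝒜)

variable {n 𝒜}

lemma val_proj_of_mem {k : ℤ} (hk : k ∈ suppSet n) {a : A} (ha : a ∈ 𝒜 k) :
    val n 𝒜 (proj n 𝒜 a) = a := projAux_of_mem n 𝒜 hk ha

lemma proj_of_notMem {k : ℤ} (hk : k ∉ suppSet n) {a : A} (ha : a ∈ 𝒜 k) :
    proj n 𝒜 a = 0 := val_injective n 𝒜 (projAux_of_notMem n 𝒜 hk ha)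

@[elab_as_elim]
lemma induction {P : TruncAlg n 𝒜 → Prop} (x : TruncAlg n 𝒜) (zero : P 0)
    (add : ∀ x y, P x → P y → P (x + y))
    (hom : ∀ k ∈ suppSet n, ∀ a ∈ 𝒜 k, P (proj n 𝒜 a)) : P x := by
  obtain ⟨x, hx⟩ := x
  have key : ∀ (y : A) (hy : y ∈ ⨆ k ∈ suppSet n, 𝒜 k), P ⟨y, hy⟩ := by
    intro y hy
    refine Submodule.iSup_induction' _ (motive := fun y hy => P ⟨y, hy⟩) ?_ zero ?_ hy
    · intro k y hy
      by_cases hk : k ∈ suppSet n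
      · have hy' : y ∈ 𝒜 k := by simpa [hk] using hy
        have h : (⟨y, Submodule.mem_iSup_of_mem k hy⟩ : TruncAlg n 𝒜) = proj n 𝒜 y :=
          val_injective n 𝒜 (val_proj_of_mem hk hy').symm
        have := hom k hk y hy'
        rw [← h] at this
        exact this
      · have : y = 0 := by simpa [hk] using hy
        subst this
        exact zero
    · intro y z hy hz h1 h2
      exact add _ _ h1 h2
  exact key x hx

lemma proj_val (x : TruncAlg n 𝒜) : proj n 𝒜 (val n 𝒜 x) = x := by
  induction x using induction with
  | zero => simp
  | add x y hx hy => rw [map_add, map_add, hx, hy]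
  | hom k hk a ha => rw [val_proj_of_mem hk ha]

/-- The product of `A_U`: the product of `A`, in which the components with degree outside `U` are
replaced by zero. -/
instance : Mul (TruncAlg n 𝒜) := ⟨fun x y => proj n 𝒜 (val n 𝒜 x * val n 𝒜 y)⟩

lemma mul_def (x y : TruncAlg n 𝒜) : x * y = proj n 𝒜 (val n 𝒜 x * val n 𝒜 y) := rfl

instance : One (TruncAlg n 𝒜) := ⟨proj n 𝒜 1⟩

lemma one_def : (1 : TruncAlg n 𝒜) = proj n 𝒜 1 := rfl

lemma val_one : val n 𝒜 1 = 1 :=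
  val_proj_of_mem (zero_mem_suppSet n) (SetLike.GradedOne.one_mem (A := 𝒜))

lemma proj_mul_proj {i j : ℤ} (hi : i ∈ suppSet n) (hj : j ∈ suppSet n) {a b : A}
    (ha : a ∈ 𝒜 i) (hb : b ∈ 𝒜 j) : proj n 𝒜 a * proj n 𝒜 b = proj n 𝒜 (a * b) := by
  rw [mul_def, val_proj_of_mem hi ha, val_proj_of_mem hj hb]

instance : NonUnitalNonAssocRing (TruncAlg n 𝒜) where
  left_distrib x y z := by simp [mul_def, mul_add]
  right_distrib x y z := by simp [mul_def, add_mul]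
  zero_mul x := by simp [mul_def]
  mul_zero x := by simp [mul_def]

lemma hom_assoc {i j k : ℤ} (hi : i ∈ suppSet n) (hj : j ∈ suppSet n) (hk : k ∈ suppSet n)
    {a b c : A} (ha : a ∈ 𝒜 i) (hb : b ∈ 𝒜 j) (hc : c ∈ 𝒜 k) :
    proj n 𝒜 a * proj n 𝒜 b * proj n 𝒜 c = proj n 𝒜 a * (proj n 𝒜 b * proj n 𝒜 c) := by
  have hab : a * b ∈ 𝒜 (i + j) := SetLike.GradedMul.mul_mem ha hb
  have hbc : b * c ∈ 𝒜 (j + k) := SetLike.GradedMul.mul_mem hb hc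
  have habc : a * b * c ∈ 𝒜 (i + j + k) := SetLike.GradedMul.mul_mem hab hc
  rw [proj_mul_proj hi hj ha hb, proj_mul_proj hj hk hb hc]
  by_cases h1 : i + j ∈ suppSet n
  · rw [proj_mul_proj h1 hk hab hc]
    by_cases h2 : j + k ∈ suppSet n
    · rw [proj_mul_proj hi h2 ha hbc, mul_assoc]
    · rw [proj_of_notMem h2 hbc, mul_zero]
      exact proj_of_notMem (fun h3 => h2 (suppSet_assoc hi hj hk h1 h3)) habc
  · rw [proj_of_notMem h1 hab, zero_mul]
    by_cases h2 : j + k ∈ suppSet n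
    · rw [proj_mul_proj hi h2 ha hbc, ← mul_assoc]
      exact (proj_of_notMem (fun h3 => h1 (suppSet_assoc' hi hj hk h2 h3)) habc).symm
    · rw [proj_of_notMem h2 hbc, mul_zero]

instance : Ring (TruncAlg n 𝒜) where
  mul_assoc x y z := by
    induction x using induction with
    | zero => simp
    | add a b ha hb => simp only [add_mul, ha, hb]
    | hom i hi a ha =>
      induction y using induction with
      | zero => simp
      | add a b ha hb => simp only [add_mul, mul_add, ha, hb]
      | hom j hj b hb =>
        induction z using induction with
        | zero => simp
        | add a b ha hb => simp only [mul_add, ha, hb]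
        | hom k hk c hc => exact hom_assoc hi hj hk ha hb hc
  one_mul x := by rw [mul_def, val_one, one_mul, proj_val]
  mul_one x := by rw [mul_def, val_one, mul_one, proj_val]

instance : Algebra K (TruncAlg n 𝒜) :=
  Algebra.ofModule (fun c x y => by simp [mul_def]) (fun c x y => by simp [mul_def])

lemma proj_mem {k : ℤ} {a : A} (ha : a ∈ 𝒜 k) : proj n 𝒜 a ∈ deg n 𝒜 k := by
  by_cases hk : k ∈ suppSet n
  · change val n 𝒜 (proj n 𝒜 a) ∈ 𝒜 k
    rwa [val_proj_of_mem hk ha]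
  · rw [proj_of_notMem hk ha]
    exact zero_mem _

end TruncAlg

end Trunc

/-! ### The category of graded right modules -/

/-- A graded right module over a graded algebra `B = ⨁ B_k`. Right `B`-modules are modules over
the opposite ring, `x b` being `op b • x`. -/
structure GrMod {K B : Type u} [Field K] [Ring B] [Algebra K B] (𝓑 : ℤ → Submodule K B) where
  carrier : Type u
  [addCommGroup : AddCommGroup carrier]
  [module : Module Bᵐᵒᵖ carrier]
  deg : ℤ → AddSubgroup carrier
  [decomposition : DirectSum.Decomposition deg]
  smul_mem : ∀ {i j : ℤ} {x : carrier} {b : B}, x ∈ deg i → b ∈ 𝓑 j →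
    MulOpposite.op b • x ∈ deg (i + j)

namespace GrMod

attribute [instance] GrMod.addCommGroup GrMod.module GrMod.decomposition

variable {K B : Type u} [Field K] [Ring B] [Algebra K B] {𝓑 : ℤ → Submodule K B}

/-- A morphism of graded modules: a linear map that preserves degrees. -/
@[ext]
structure Hom (M N : GrMod 𝓑) where
  toLin : M.carrier →ₗ[Bᵐᵒᵖ] N.carrier
  map_mem : ∀ {i : ℤ} {x : M.carrier}, x ∈ M.deg i → toLin x ∈ N.deg i

/-- The category `Gr_B`. -/
instance : Category (GrMod 𝓑) where
  Hom := Hom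
  id M := ⟨LinearMap.id, fun h => h⟩
  comp f g := ⟨g.toLin ∘ₗ f.toLin, fun h => g.map_mem (f.map_mem h)⟩

@[ext]
lemma hom_ext {M N : GrMod 𝓑} {f g : M ⟶ N} (h : f.toLin = g.toLin) : f = g := Hom.ext h

@[simp] lemma id_toLin (M : GrMod 𝓑) : (𝟙 M : M ⟶ M).toLin = LinearMap.id := rfl

@[simp] lemma comp_toLin {M N P : GrMod 𝓑} (f : M ⟶ N) (g : N ⟶ P) :
    (f ≫ g).toLin = g.toLin ∘ₗ f.toLin := rfl

variable {M N : GrMod 𝓑}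

instance : Zero (M ⟶ N) := ⟨⟨0, fun _ => zero_mem _⟩⟩
instance : Add (M ⟶ N) :=
  ⟨fun f g => ⟨f.toLin + g.toLin, fun h => add_mem (f.map_mem h) (g.map_mem h)⟩⟩
instance : Neg (M ⟶ N) := ⟨fun f => ⟨-f.toLin, fun h => neg_mem (f.map_mem h)⟩⟩
instance : Sub (M ⟶ N) :=
  ⟨fun f g => ⟨f.toLin - g.toLin, fun h => sub_mem (f.map_mem h) (g.map_mem h)⟩⟩
instance : SMul ℕ (M ⟶ N) := ⟨fun c f => ⟨c • f.toLin, fun h => nsmul_mem (f.map_mem h) c⟩⟩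
instance : SMul ℤ (M ⟶ N) := ⟨fun c f => ⟨c • f.toLin, fun h => zsmul_mem (f.map_mem h) c⟩⟩

@[simp] lemma zero_toLin : (0 : M ⟶ N).toLin = 0 := rfl
@[simp] lemma add_toLin (f g : M ⟶ N) : (f + g).toLin = f.toLin + g.toLin := rfl

instance : AddCommGroup (M ⟶ N) :=
  Function.Injective.addCommGroup (fun f : M ⟶ N => f.toLin) (fun _ _ => hom_ext) rfl
    (fun _ _ => rfl) (fun _ => rfl) (fun _ _ => rfl) (fun _ _ => rfl) (fun _ _ => rfl)

instance : Preadditive (GrMod 𝓑) where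
  add_comp _ _ _ f g h := by ext x; simp
  comp_add _ _ _ f g h := by ext x; simp

/-- `M` is generated in degrees belonging to `𝒳`: the support of every nonzero factor of `M`
meets `𝒳`. Here `(M / N)_i ≠ 0` means that `M_i` is not contained in `N`. -/
def GeneratedIn (M : GrMod 𝓑) (𝒳 : Set ℤ) : Prop :=
  ∀ N : Submodule Bᵐᵒᵖ M.carrier, N.IsHomogeneous M.deg → N ≠ ⊤ →
    ∃ i ∈ 𝒳, ¬ (M.deg i ≤ N.toAddSubgroup)

/-- `M` is cogenerated in degrees belonging to `𝒳`: the support of every nonzero graded submodule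
of `M` meets `𝒳`. -/
def CogeneratedIn (M : GrMod 𝓑) (𝒳 : Set ℤ) : Prop :=
  ∀ N : Submodule Bᵐᵒᵖ M.carrier, N.IsHomogeneous M.deg → N ≠ ⊥ →
    ∃ i ∈ 𝒳, M.deg i ⊓ N.toAddSubgroup ≠ ⊥

variable (𝓑) in
/-- The graded Jacobson radical `⨁_{i > 0} B_i` of a positively graded algebra whose component of
degree zero is a product of copies of the ground field. -/
def gradedRadical : Submodule K B := ⨆ i : {i : ℤ // 0 < i}, 𝓑 i

/-- The submodule `M · J` of `M`, where `J` is the graded Jacobson radical. -/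
def mulRadical (M : GrMod 𝓑) : AddSubgroup M.carrier :=
  AddSubgroup.closure
    {y | ∃ x : M.carrier, ∃ b ∈ gradedRadical 𝓑, y = MulOpposite.op b • x}

end GrMod

/-! ### Linear `n`-complexes and their contraction to complexes -/

section Complexes

variable {K B : Type u} [Field K] [Ring B] [Algebra K B] {𝓑 : ℤ → Submodule K B}

/-- The composite of `r` consecutive maps `X i ⟶ X (i + 1) ⟶ ⋯ ⟶ X j` of a sequence, `j = i + r`. -/
def iterD {C : Type*} [Category C] {X : ℤ → C} (d : ∀ i, X i ⟶ X (i + 1)) :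
    ∀ (r : ℕ) (i j : ℤ), i + r = j → (X i ⟶ X j)
  | 0, _, _, h => eqToHom (congrArg X (by simpa using h))
  | r + 1, i, j, h => d i ≫ iterD d r (i + 1) j (by rw [← h]; push_cast; ring)

lemma iterD_comp {C : Type*} [Category C] {X : ℤ → C} (d : ∀ i, X i ⟶ X (i + 1))
    (r s : ℕ) (i j k : ℤ) (h : i + r = j) (h' : j + s = k) :
    iterD d r i j h ≫ iterD d s j k h' =
      iterD d (r + s) i k (by rw [← h', ← h]; push_cast; ring) := by
  induction r generalizing i with
  | zero =>
    obtain rfl : i = j := by simpa using h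
    simp [iterD]
  | succ r ih =>
    have : ∀ (t : ℕ) (ht : i + (t : ℤ) = k), r + s + 1 = t →
        iterD d (r + s + 1) i k (by rw [← h', ← h]; push_cast; ring) = iterD d t i k ht := by
      rintro t ht rfl; rfl
    rw [← this (r + 1 + s) _ (by ring)]
    simp only [iterD, Category.assoc]
    rw [ih]

variable (𝓑) in
/-- A linear `n`-complex of projective graded modules: `Pᵏ` is projective and generated in degree
`-k`, and the composites of `n` consecutive differentials vanish. -/
structure LinearNComplex (n : ℕ) where
  X : ℤ → GrMod 𝓑
  d : ∀ k, X k ⟶ X (k + 1)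
  d_iter : ∀ k, iterD d n k (k + n) rfl = 0
  projective : ∀ k, Projective (X k)
  generated : ∀ k, (X k).GeneratedIn {-k}

/-- The map `δₘ`, with `δₘ(2k) = m + kn` and `δₘ(2k + 1) = m + kn + 1`. -/
def delta (n : ℕ) (m j : ℤ) : ℤ := m + (j / 2) * n + j % 2

/-- The number of differentials of an `n`-complex composed in the `j`-th differential of its
contraction: `1` if `j` is odd and `n - 1` if `j` is even. -/
def step (n : ℕ) (j : ℤ) : ℕ := if Even j then n - 1 else 1

lemma neg_delta_add_step {n : ℕ} (hn : 2 ≤ n) (m j : ℤ) :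
    -delta n m (-j) + step n j = -delta n m (-(j + 1)) := by
  unfold delta step
  rcases Int.even_or_odd j with h | h
  · obtain ⟨c, rfl⟩ := h
    have h1 : -(c + c) / 2 = -c := by omega
    have h2 : -(c + c) % 2 = 0 := by omega
    have h3 : -(c + c + 1) / 2 = -c - 1 := by omega
    have h4 : -(c + c + 1) % 2 = 1 := by omega
    rw [if_pos ⟨c, rfl⟩, h1, h2, h3, h4, Nat.cast_sub (by omega)]
    push_cast
    ring
  · rw [if_neg (Int.not_even_iff_odd.2 h)]
    obtain ⟨c, rfl⟩ := h
    have h1 : -(2 * c + 1) / 2 = -c - 1 := by omega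
    have h2 : -(2 * c + 1) % 2 = 1 := by omega
    have h3 : -(2 * c + 1 + 1) / 2 = -c - 1 := by omega
    have h4 : -(2 * c + 1 + 1) % 2 = 0 := by omega
    rw [h1, h2, h3, h4]
    push_cast
    ring

lemma step_add_step {n : ℕ} (hn : 2 ≤ n) (j : ℤ) : step n j + step n (j + 1) = n := by
  unfold step
  rcases Int.even_or_odd j with h | h
  · rw [if_pos h, if_neg (by simpa [Int.even_add_one] using h)]
    omega
  · have h' : ¬ Even j := Int.not_even_iff_odd.2 h
    rw [if_neg h', if_pos (by simpa [Int.even_add_one] using h')]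
    omega

/-- The contraction `G_m(P)`: the complex with components `P^{-δₘ(-j)}` whose differentials are
the composites of consecutive differentials of `P`. -/
def LinearNComplex.contract {n : ℕ} (hn : 2 ≤ n) (m : ℤ) (P : LinearNComplex 𝓑 n) :
    CochainComplex (GrMod 𝓑) ℤ :=
  CochainComplex.of (fun j => P.X (-delta n m (-j)))
    (fun j => iterD P.d (step n j) _ _ (neg_delta_add_step hn m j))
    (fun j => by
      rw [iterD_comp]
      have : ∀ (r : ℕ) (i k : ℤ) (h : i + (r : ℤ) = k), r = n → iterD P.d r i k h = 0 := by
        rintro r i k rfl rfl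
        exact P.d_iter i
      exact this _ _ _ _ (step_add_step hn j))

/-- The `G_m`-liftable complexes: the objects of the essential image of `G_m`. -/
def GLiftable {n : ℕ} (hn : 2 ≤ n) (m : ℤ) (C : CochainComplex (GrMod 𝓑) ℤ) : Prop :=
  ∃ P : LinearNComplex 𝓑 n, Nonempty (P.contract hn m ≅ C)

variable (𝓑) in
/-- The objects of the category `Y°(S, U)`. -/
def Yo {n : ℕ} (hn : 2 ≤ n) (m : ℤ) : ObjectProperty (CochainComplex (GrMod 𝓑) ℤ) := fun C =>
  GLiftable hn m C ∧
  (∀ j, Projective (C.X j) ∧ (C.X j).GeneratedIn {delta n m (-j)}) ∧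
  (2 < n → ∀ (k : ℤ) (x : (C.X (2 * k - 1)).carrier), (C.d (2 * k - 1) (2 * k)).toLin x = 0 →
    x ∈ (C.X (2 * k - 1)).mulRadical)

end Complexes

/-! ### Tensor products over `KQ₀` and comultiplications

The commutative algebra `KQ₀ = Λ₀` is the algebra `V → K` of families of scalars indexed by the
vertices, and modules over it are modules over `V → K`. -/

section Tensor

variable {K V : Type u} [Field K] [Quiver.{u} V] [Fintype V]

open PathAlg

/-- `KQᵤ` as a left `KQ₀`-module. -/
instance pathDegModule (k : ℤ) : Module (V → K) (pathDeg K V k) where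
  smul r x := ⟨vertexHom r * x.1, mul_mem_pathDeg' (zero_add k) (vertexSum_mem r) x.2⟩
  one_smul x := Subtype.ext (by change vertexHom 1 * x.1 = x.1; simp)
  mul_smul r s x := Subtype.ext (by
    change vertexHom (r * s) * x.1 = vertexHom r * (vertexHom s * x.1)
    rw [map_mul, mul_assoc])
  smul_zero r := Subtype.ext (mul_zero _)
  smul_add r x y := Subtype.ext (mul_add _ _ _)
  add_smul r s x := Subtype.ext (by
    change vertexHom (r + s) * x.1 = vertexHom r * x.1 + vertexHom s * x.1
    rw [map_add, add_mul])
  zero_smul x := Subtype.ext (by change vertexHom 0 * x.1 = 0; simp)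

lemma pathDeg_smul_val {k : ℤ} (r : V → K) (x : pathDeg K V k) :
    (r • x).1 = vertexHom r * x.1 := rfl

/-- The right action of `KQ₀` on `KQᵤ`; it commutes with the left action. -/
def rightMul (k : ℤ) (r : V → K) : pathDeg K V k →ₗ[V → K] pathDeg K V k where
  toFun x := ⟨x.1 * vertexHom r, mul_mem_pathDeg' (add_zero k) x.2 (vertexSum_mem r)⟩
  map_add' _ _ := Subtype.ext (add_mul _ _ _)
  map_smul' _ _ := Subtype.ext (mul_assoc _ _ _)

variable (K V) in
/-- The tensor product `M ⊗ KQᵤ` over `KQ₀`, of a `KQ₀`-module `M` and the left module `KQᵤ`. -/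
def TensPath (M : Type u) [AddCommGroup M] [Module (V → K) M] (k : ℤ) : Type u :=
  M ⊗[V → K] (pathDeg K V k)

variable {M N : Type u} [AddCommGroup M] [Module (V → K) M] [AddCommGroup N] [Module (V → K) N]

instance (k : ℤ) : AddCommGroup (TensPath K V M k) :=
  inferInstanceAs (AddCommGroup (M ⊗[V → K] (pathDeg K V k)))

/-- The element `x ⊗ y` of `M ⊗ KQᵤ`. -/
def TensPath.tmul {k : ℤ} (x : M) (y : pathDeg K V k) : TensPath K V M k := x ⊗ₜ[V → K] y

/-- `M ⊗ KQᵤ` is a `KQ₀`-module through the right action on `KQᵤ`: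
`(x ⊗ y) r = x ⊗ (y r)`. -/
instance tensPathModule (k : ℤ) : Module (V → K) (TensPath K V M k) where
  smul r t := (rightMul k r).lTensor M t
  one_smul t := by
    change (rightMul k 1).lTensor M t = t
    rw [show rightMul k (1 : V → K) = LinearMap.id from
      LinearMap.ext fun x => Subtype.ext (by simp [rightMul]), LinearMap.lTensor_id]
    rfl
  mul_smul r s t := by
    change (rightMul k (r * s)).lTensor M t = (rightMul k r).lTensor M ((rightMul k s).lTensor M t)
    rw [show rightMul k (r * s) = rightMul k r ∘ₗ rightMul k s from
      LinearMap.ext fun x => Subtype.ext (by simp [rightMul, mul_comm r s, mul_assoc]),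
      LinearMap.lTensor_comp]
    rfl
  smul_zero r := map_zero ((rightMul k r).lTensor M)
  smul_add r := map_add ((rightMul k r).lTensor M)
  add_smul r s t := by
    change (rightMul k (r + s)).lTensor M t = (rightMul k r).lTensor M t + (rightMul k s).lTensor M t
    rw [show rightMul k (r + s) = rightMul k r + rightMul k s from
      LinearMap.ext fun x => Subtype.ext (by simp [rightMul, mul_add]), LinearMap.lTensor_add]
    rfl
  zero_smul t := by
    change (rightMul k 0).lTensor M t = 0
    rw [show rightMul k (0 : V → K) = 0 from
      LinearMap.ext fun x => Subtype.ext (by simp [rightMul]), LinearMap.lTensor_zero]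
    rfl

lemma TensPath.smul_tmul {k : ℤ} (r : V → K) (x : M) (y : pathDeg K V k) :
    r • TensPath.tmul x y = TensPath.tmul x (rightMul k r y) :=
  LinearMap.lTensor_tmul ..

lemma TensPath.tmul_smul_left {k : ℤ} (r : V → K) (x : M) (y : pathDeg K V k) :
    TensPath.tmul (r • x) y = TensPath.tmul x (r • y) :=
  TensorProduct.smul_tmul r x y

/-- The map `f ⊗ 1 : M ⊗ KQᵤ → N ⊗ KQᵤ`. -/
def TensPath.map (f : M →ₗ[V → K] N) (k : ℤ) : TensPath K V M k →ₗ[V → K] TensPath K V N k where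
  toFun t := f.rTensor (pathDeg K V k) t
  map_add' := map_add (f.rTensor (pathDeg K V k))
  map_smul' r t := by
    change f.rTensor _ ((rightMul k r).lTensor M t) = (rightMul k r).lTensor N (f.rTensor _ t)
    exact LinearMap.congr_fun ((LinearMap.rTensor_comp_lTensor _ _ _).trans
      (LinearMap.lTensor_comp_rTensor _ _ _).symm) t

/-- Auxiliary: for fixed `q ∈ KQ_w`, the map `M ⊗ KQᵥ → M ⊗ KQᵤ`, `x ⊗ p ↦ x ⊗ pq`. -/
def TensPath.concatAux {k l j : ℤ} (h : k + l = j) (q : pathDeg K V l) :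
    TensPath K V M k →+ TensPath K V M j :=
  (LinearMap.lTensor M
    ({ toFun := fun p => ⟨p.1 * q.1, mul_mem_pathDeg' h p.2 q.2⟩
       map_add' := fun _ _ => Subtype.ext (add_mul _ _ _)
       map_smul' := fun _ _ => Subtype.ext (mul_assoc _ _ _) } :
      pathDeg K V k →ₗ[V → K] pathDeg K V j)).toAddMonoidHom

lemma TensPath.concatAux_tmul {k l j : ℤ} (h : k + l = j) (q : pathDeg K V l) (x : M)
    (p : pathDeg K V k) :
    TensPath.concatAux h q (TensPath.tmul x p) =
      TensPath.tmul x ⟨p.1 * q.1, mul_mem_pathDeg' h p.2 q.2⟩ :=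
  LinearMap.lTensor_tmul ..

@[elab_as_elim]
lemma TensPath.induction {k : ℤ} {P : TensPath K V M k → Prop} (t : TensPath K V M k) (zero : P 0)
    (tmul : ∀ (x : M) (y : pathDeg K V k), P (TensPath.tmul x y))
    (add : ∀ s t, P s → P t → P (s + t)) : P t :=
  TensorProduct.induction_on (motive := P) t zero tmul add

lemma TensPath.tmul_add {k : ℤ} (x : M) (y z : pathDeg K V k) :
    TensPath.tmul x (y + z) = TensPath.tmul x y + TensPath.tmul x z := TensorProduct.tmul_add ..

lemma TensPath.add_tmul {k : ℤ} (x y : M) (z : pathDeg K V k) :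
    TensPath.tmul (x + y) z = TensPath.tmul x z + TensPath.tmul y z := TensorProduct.add_tmul ..

lemma TensPath.zero_tmul {k : ℤ} (z : pathDeg K V k) :
    TensPath.tmul (0 : M) z = 0 := TensorProduct.zero_tmul ..

lemma TensPath.tmul_zero {k : ℤ} (x : M) :
    TensPath.tmul x (0 : pathDeg K V k) = 0 := TensorProduct.tmul_zero ..

/-- Auxiliary: the map underlying `TensPath.concat`, as a biadditive map. -/
def TensPath.concatBil {k l j : ℤ} (h : k + l = j) :
    TensPath K V M k →+ pathDeg K V l →+ TensPath K V M j :=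
  AddMonoidHom.mk' (fun t => AddMonoidHom.mk' (fun q => TensPath.concatAux h q t) (fun q q' => by
    induction t using TensPath.induction with
    | zero => simp
    | tmul x p =>
      rw [TensPath.concatAux_tmul, TensPath.concatAux_tmul, TensPath.concatAux_tmul,
        ← TensPath.tmul_add]
      congr 1
      exact Subtype.ext (mul_add _ _ _)
    | add s t hs ht => rw [map_add, map_add, map_add, hs, ht]; abel))
    (fun s t => AddMonoidHom.ext fun q => map_add (TensPath.concatAux h q) s t)

/-- Auxiliary: the additive map underlying `TensPath.concat`. -/
def TensPath.concatAdd {k l j : ℤ} (h : k + l = j) :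
    TensPath K V (TensPath K V M k) l →+ TensPath K V M j :=
  TensorProduct.liftAddHom (TensPath.concatBil h) (fun r t q => by
    change TensPath.concatAux h q (r • t) = TensPath.concatAux h (r • q) t
    induction t using TensPath.induction with
    | zero => simp
    | tmul x p =>
      rw [TensPath.smul_tmul, TensPath.concatAux_tmul, TensPath.concatAux_tmul]
      congr 1
      exact Subtype.ext (mul_assoc _ _ _)
    | add s t hs ht => rw [smul_add, map_add, map_add, hs, ht])

lemma TensPath.concatAdd_tmul {k l j : ℤ} (h : k + l = j) (t : TensPath K V M k)
    (q : pathDeg K V l) :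
    TensPath.concatAdd h (TensPath.tmul t q) = TensPath.concatAux h q t :=
  TensorProduct.liftAddHom_tmul ..

/-- The canonical isomorphism `M ⊗ KQᵥ ⊗ KQ_w ≅ M ⊗ KQᵤ`, `u = v + w`, in the direction
`x ⊗ p ⊗ q ↦ x ⊗ pq`. -/
def TensPath.concat {k l j : ℤ} (h : k + l = j) :
    TensPath K V (TensPath K V M k) l →ₗ[V → K] TensPath K V M j where
  toFun := TensPath.concatAdd h
  map_add' := map_add _
  map_smul' r t := by
    induction t using TensPath.induction with
    | zero => rw [smul_zero, map_zero, smul_zero]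
    | add s t hs ht => rw [smul_add, map_add, map_add, hs, ht, smul_add]
    | tmul t q =>
      rw [TensPath.smul_tmul, TensPath.concatAdd_tmul, TensPath.concatAdd_tmul, RingHom.id_apply]
      induction t using TensPath.induction with
      | zero => simp
      | tmul x p =>
        rw [TensPath.concatAux_tmul, TensPath.concatAux_tmul, TensPath.smul_tmul]
        congr 1
        exact Subtype.ext (mul_assoc _ _ _).symm
      | add s t hs ht => rw [map_add, map_add, hs, ht, smul_add]

lemma TensPath.concat_tmul {k l j : ℤ} (h : k + l = j) (x : M) (p : pathDeg K V k)
    (q : pathDeg K V l) :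
    (TensPath.concat h : TensPath K V (TensPath K V M k) l →ₗ[V → K] _)
        (TensPath.tmul (TensPath.tmul x p) q) =
      TensPath.tmul x ⟨p.1 * q.1, mul_mem_pathDeg' h p.2 q.2⟩ :=
  (TensPath.concatAdd_tmul h _ q).trans (TensPath.concatAux_tmul h q x p)

end Tensor

lemma finite_paths (V : Type u) [Quiver.{u} V] [Finite V] [∀ i j : V, Finite (i ⟶ j)] (k : ℤ) :
    Finite {p : QPath V // (p.len : ℤ) = k} := by
  have key : ∀ (l : ℕ) (i j : V), Finite {p : Quiver.Path i j // p.length = l} := by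
    intro l
    induction l with
    | zero =>
      intro i j
      refine @Finite.of_subsingleton _ ⟨?_⟩
      rintro ⟨p, hp⟩ ⟨q, hq⟩
      obtain rfl := p.eq_of_length_zero hp
      rw [Subtype.mk.injEq, p.eq_nil_of_length_zero hp, q.eq_nil_of_length_zero hq]
    | succ l ih =>
      intro i j
      refine Finite.of_surjective
        (fun t : Σ c : V, {p : Quiver.Path i c // p.length = l} × (c ⟶ j) =>
          (⟨t.2.1.1.cons t.2.2, by simp [t.2.1.2]⟩ : {p : Quiver.Path i j // p.length = l + 1})) ?_
      rintro ⟨p, hp⟩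
      cases p with
      | nil => simp at hp
      | @cons c _ p e => exact ⟨⟨c, ⟨p, by simpa using hp⟩, e⟩, rfl⟩
  by_cases hk : 0 ≤ k
  · lift k to ℕ using hk
    refine Finite.of_surjective
      (fun t : Σ i j : V, {p : Quiver.Path i j // p.length = k} =>
        (⟨⟨t.1, t.2.1, t.2.2.1⟩, by exact_mod_cast t.2.2.2⟩ :
          {p : QPath V // (p.len : ℤ) = k})) ?_
    rintro ⟨⟨i, j, p⟩, hp⟩
    exact ⟨⟨i, j, p, by exact_mod_cast hp⟩, rfl⟩
  · refine @Finite.of_subsingleton _ ⟨?_⟩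
    rintro ⟨p, hp⟩
    omega

section Comul

variable {K V L : Type u} [Field K] [Quiver.{u} V] [Fintype V] [Ring L] [Algebra K L]
  {n : ℕ} {π : PathAlg K V →ₐ[K] L}

open PathAlg

variable (n π) in
/-- The category `Gr_{Λ^!_U}`. -/
abbrev GrDualU : Type (u + 1) := GrMod (TruncAlg.deg n (dualDeg n π))

variable (n π) in
/-- The image of `xᵒ ∈ KQᵒᵖ` in `Λ^!_U` (components with degree outside `U` go to zero). -/
def bar : PathAlg K V →ₗ[K] TruncAlg n (dualDeg n π) := TruncAlg.proj n _ ∘ₗ toDual n π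

lemma bar_mem {k : ℤ} {x : PathAlg K V} (hx : x ∈ pathDeg K V k) :
    bar n π x ∈ TruncAlg.deg n (dualDeg n π) k := TruncAlg.proj_mem (toDual_mem n π hx)

lemma bar_mul {j k : ℤ} (hj : j ∈ suppSet n) (hk : k ∈ suppSet n) {x y : PathAlg K V}
    (hx : x ∈ pathDeg K V j) (hy : y ∈ pathDeg K V k) :
    bar n π (x * y) = bar n π y * bar n π x := by
  simp only [bar, LinearMap.comp_apply]
  rw [toDual_mul, TruncAlg.proj_mul_proj hk hj (toDual_mem n π hy) (toDual_mem n π hx)]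

/-- The right action `x · p̄ᵒ` on a graded `Λ^!_U`-module of the class of an element of `KQᵒᵖ`. -/
def GrMod.act (X : GrDualU n π) {i j k : ℤ} (h : i + k = j) (p : pathDeg K V k) (x : X.deg i) :
    X.deg j :=
  ⟨MulOpposite.op (bar n π p.1) • x.1, h ▸ X.smul_mem x.2 (bar_mem p.2)⟩

/-- The components of a graded `Λ^!_U`-module are modules over `KQ₀`. -/
instance compModule (X : GrDualU n π) (i : ℤ) : Module (V → K) (X.deg i) where
  smul r x := X.act (add_zero i) ⟨vertexHom r, vertexSum_mem r⟩ x
  one_smul x := Subtype.ext (by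
    change MulOpposite.op (bar n π (vertexHom 1)) • x.1 = x.1
    rw [map_one]
    change MulOpposite.op (TruncAlg.proj n _ (toDual n π 1)) • x.1 = x.1
    rw [toDual_one, ← TruncAlg.one_def, MulOpposite.op_one, one_smul])
  mul_smul r s x := Subtype.ext (by
    change MulOpposite.op (bar n π (vertexHom (r * s))) • x.1 =
      MulOpposite.op (bar n π (vertexHom r)) • MulOpposite.op (bar n π (vertexHom s)) • x.1
    rw [smul_smul, ← MulOpposite.op_mul, map_mul]
    exact congrArg (fun b => MulOpposite.op b • x.1)
      (bar_mul (zero_mem_suppSet n) (zero_mem_suppSet n) (vertexSum_mem r) (vertexSum_mem s)))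
  smul_zero r := Subtype.ext (smul_zero _)
  smul_add r x y := Subtype.ext (smul_add _ _ _)
  add_smul r s x := Subtype.ext (by
    change MulOpposite.op (bar n π (vertexHom (r + s))) • x.1 =
      MulOpposite.op (bar n π (vertexHom r)) • x.1 + MulOpposite.op (bar n π (vertexHom s)) • x.1
    rw [map_add, map_add, MulOpposite.op_add, add_smul])
  zero_smul x := Subtype.ext (by
    change MulOpposite.op (bar n π (vertexHom 0)) • x.1 = 0
    rw [map_zero, map_zero, MulOpposite.op_zero, zero_smul])

variable [∀ i j : V, Finite (i ⟶ j)]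

/-- The comultiplication `Δ : X_i → X_j ⊗ KQᵤ`, `x ↦ ∑_{p ∈ Qᵤ} x p̄ᵒ ⊗ p`, where `j = i + u` and
`u ∈ U`. -/
def comul (X : GrDualU n π) {i j k : ℤ} (hk : k ∈ suppSet n) (h : i + k = j) :
    X.deg i →ₗ[V → K] TensPath K V (X.deg j) k :=
  haveI := finite_paths V k
  letI := Fintype.ofFinite {p : QPath V // (p.len : ℤ) = k}
  { toFun := fun x => ∑ p : {p : QPath V // (p.len : ℤ) = k},
      TensPath.tmul (X.act h ⟨path p.1 1, path_mem' p.1 p.2⟩ x) ⟨path p.1 1, path_mem' p.1 p.2⟩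
    map_add' := fun x y => by
      rw [← Finset.sum_add_distrib]
      refine Finset.sum_congr rfl fun p _ => ?_
      rw [← TensPath.add_tmul]
      congr 1
      exact Subtype.ext (smul_add _ _ _)
    map_smul' := fun r x => by
      rw [RingHom.id_apply, Finset.smul_sum]
      refine Finset.sum_congr rfl fun p _ => ?_
      have h1 : rightMul k r ⟨path p.1 1, path_mem' p.1 p.2⟩ =
          (fun _ => r p.1.tgt : V → K) • (⟨path p.1 1, path_mem' p.1 p.2⟩ : pathDeg K V k) :=
        Subtype.ext (by
          change path p.1 1 * vertexSum r = vertexSum (fun _ => r p.1.tgt) * path p.1 1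
          rw [path_mul_vertexSum, vertexSum_mul_path])
      rw [TensPath.smul_tmul, h1, ← TensPath.tmul_smul_left]
      congr 1
      refine Subtype.ext ?_
      have hp : path p.1 (1 : K) ∈ pathDeg K V k := path_mem' p.1 p.2
      change MulOpposite.op (bar n π (path p.1 1)) • MulOpposite.op (bar n π (vertexSum r)) • x.1 =
        MulOpposite.op (bar n π (vertexSum fun _ => r p.1.tgt)) •
          MulOpposite.op (bar n π (path p.1 1)) • x.1
      rw [smul_smul, smul_smul, ← MulOpposite.op_mul, ← MulOpposite.op_mul,
        ← bar_mul hk (zero_mem_suppSet n) hp (vertexSum_mem r),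
        ← bar_mul (zero_mem_suppSet n) hk (vertexSum_mem _) hp,
        path_mul_vertexSum, vertexSum_mul_path] }

lemma one_mem_suppSet (n : ℕ) : (1 : ℤ) ∈ suppSet n := Or.inr (by simp)

lemma self_mem_suppSet (n : ℕ) : (n : ℤ) ∈ suppSet n := Or.inl dvd_rfl

/-- For a given `k`, the square of `KQ₀`-modules with upper edge
`Δ : X_{-m-(k+1)n} → X_{-m-kn} ⊗ KQₙ`, lower edge
`Δ ⊗ 1 : X_{-m-kn-1} ⊗ KQ_{n-1} → X_{-m-kn} ⊗ KQ₁ ⊗ KQ_{n-1}` and right edge the canonical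
isomorphism `X_{-m-kn} ⊗ KQₙ ≅ X_{-m-kn} ⊗ KQ₁ ⊗ KQ_{n-1}` can be completed to a commutative one by
a homomorphism `φ : X_{-m-(k+1)n} → X_{-m-kn-1} ⊗ KQ_{n-1}`. -/
def CanComplete (X : GrDualU n π) (m k : ℤ) : Prop :=
  ∃ φ : X.deg (-m - (k + 1) * n) →ₗ[V → K]
      TensPath K V (X.deg (-m - k * n - 1)) (n - 1),
    TensPath.concat (add_sub_cancel (1 : ℤ) (n : ℤ)) ∘ₗ
        TensPath.map (comul X (one_mem_suppSet n) (sub_add_cancel (-m - k * n) 1)) (n - 1) ∘ₗ φ =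
      comul X (self_mem_suppSet n) (show -m - (k + 1) * n + n = -m - k * (n : ℤ) by ring)

/-- The set `(S : U) = {z | z + U ⊆ S}`. -/
def colon (S U : Set ℤ) : Set ℤ := {z | ∀ t ∈ U, z + t ∈ S}

/-- The set `S = m + U`. -/
def shiftSet (n : ℕ) (m : ℤ) : Set ℤ := (fun t => m + t) '' suppSet n

variable (n π) in
/-- The objects of the category `L°(S, U)`. -/
def Lo (m : ℤ) : ObjectProperty (GrDualU n π) := fun X =>
  X.CogeneratedIn {i | -i ∈ colon (shiftSet n m) (suppSet n)} ∧ ∀ k : ℤ, CanComplete X m k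

end Comul

end NKoszul

end

/-!
Both categories are equivalent to a third one, `LinRep n π m`. Its objects are the graded right
`Λ^!`-modules `Y`, written as left modules over the path algebra on which `I_n^⊥` acts as zero,
such that for `n > 2` no nonzero element of a degree in `-m - 1 + nℤ` is killed by all arrows. A
morphism `Y → Z` consists of maps `Y_i → Z_i` for the degrees `i ∈ -S` only, commuting with all
paths that lead from one of these degrees to another.

*Complexes.* For a graded left `KQ`-module `Y`, the modules `Y_k ⊗ Λ`, generated in degree `-k`,
are connected by the maps `y ↦ ∑ a y ⊗ a`, where `a` runs through the arrows. A composite of `r` of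
them is `y ↦ ∑ p y ⊗ p`, where `p` runs through the paths of length `r`
(`PathRep.iterD_tmul_one`). For `r = n` it vanishes exactly if `I_n^⊥` kills `Y`
(`PathRep.iterD_eq_zero`, `PathRep.smul_eq_zero_of_iterD`); for `r < n`, since `Λ` has no relations
of degree less than `n`, it determines the action of the paths of length `r`
(`PathRep.mapHom_comp_iterD_iff`). Since `KQ₀` is semisimple, a projective graded `Λ`-module
generated in one degree is of the form `N ⊗ Λ` (`GrMod.mulMap_bijective`), so every linear
`n`-complex arises in this way (`LinearNComplex.exists_pathRep`). The contraction retains the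
components `Y_i ⊗ Λ` with `i ∈ -S`, and its differentials are composites of `1` or `n - 1` of the
original ones. Condition (b) on the kernels says precisely that the arrows detect the nonzero
elements of the degrees in `-m - 1 + nℤ` (`PathRep.kerInRadical_iff`). Hence the functor `toYo` is
an equivalence.

*Modules over `Λ^!_U`.* The functor `toLo` takes `Y` to its truncation, the sum of the `Y_i` with
`i ∈ -S`. It is cogenerated in the degrees in `-(S : U)`: for `n > 2` the degrees of `-S` outside
this set are those in `-m - 1 + nℤ`, which are covered by the condition on the arrows. The required
maps `φ` are the comultiplications of `Y` along the paths of length `n - 1`, which the truncation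
forgets. If `i, j ∈ -S`, then `j - i` belongs to `U` or to `nℤ - 1`, and in the latter case
`j + 1 ∈ -S`, so that commutation with the paths from `i` to `j` can be checked after the action of
the arrows (`LinRep.comm_of_suppSet`). Hence `toLo` is fully faithful.

Conversely, let `X` be a module over `Λ^!_U` that is cogenerated in the degrees in `-(S : U)`. Its
homogeneous components embed into the additive maps `Λ^! → X` by `x ↦ (b ↦ x b)`, in which only the
components in the cogenerating degrees are kept (`GrMod.Cofree.of`). The `KQ`-submodule generated by
the image is a linear representation, `GrMod.linRep`. The existence of `φ` says that the product of
an element of `X` and a path of length `n - 1` lies in the image again (`GrMod.exists_smul_of_eq`),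
so that in the degrees of `-S` nothing is added to `X` (`GrMod.exists_eq_of`), and `X` is the
truncation of its linear representation.
-/

noncomputable section

namespace NKoszul

open PathAlg

/-! ### Sums over the paths of a given length -/

section Paths

variable {K V : Type u} [Field K] [Quiver.{u} V]

namespace QPath

/-- Two factorizations of a path whose second factors have the same length agree. -/
lemma factorization_unique {i c d j : V} {p : Quiver.Path i c} {q : Quiver.Path c j}
    {p' : Quiver.Path i d} {q' : Quiver.Path d j} (hq : q.length = q'.length)
    (h : p.comp q = p'.comp q') :
    (⟨c, p, q⟩ : Σ c, Quiver.Path i c × Quiver.Path c j) = ⟨d, p', q'⟩ := by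
  induction q with
  | nil =>
    cases q' with
    | nil =>
      obtain rfl : p = p' := h
      rfl
    | cons q' e' => cases hq
  | cons q e ih =>
    cases q' with
    | nil => cases hq
    | cons q' e' =>
      simp only [Quiver.Path.comp_cons, Quiver.Path.cons.injEq] at h
      obtain ⟨rfl, h, he⟩ := h
      obtain rfl := eq_of_heq he
      have := ih (Nat.succ.inj hq) (eq_of_heq h)
      simp only [Sigma.mk.injEq] at this
      obtain ⟨rfl, h⟩ := this
      obtain ⟨rfl, rfl⟩ := Prod.mk.inj (eq_of_heq h)
      rfl

/-- Concatenation of paths is injective when the lengths of the factors are prescribed. -/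
lemma concat_injective {a a' q q' : QPath V} (h : a.tgt = q.src) (h' : a'.tgt = q'.src)
    (hl : a.len = a'.len) (he : a.concat q h = a'.concat q' h') : a = a' ∧ q = q' := by
  obtain ⟨i, c, a⟩ := a
  obtain ⟨c', j, q⟩ := q
  obtain rfl : c = c' := h
  obtain ⟨i', d, a'⟩ := a'
  obtain ⟨d', j', q'⟩ := q'
  obtain rfl : d = d' := h'
  have hlen := congrArg QPath.len he
  rw [QPath.len_concat, QPath.len_concat, hl] at hlen
  have hq : q.length = q'.length := Nat.add_left_cancel hlen
  rw [QPath.concat_mk, QPath.concat_mk] at he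
  obtain rfl : i = i' := congrArg Sigma.fst he
  obtain ⟨rfl, he⟩ := Sigma.mk.inj_iff.1 (eq_of_heq (Sigma.mk.inj_iff.1 he).2)
  have := QPath.factorization_unique hq (eq_of_heq he)
  obtain ⟨rfl, h2⟩ := Sigma.mk.inj_iff.1 this
  obtain ⟨rfl, rfl⟩ := Prod.mk.inj (eq_of_heq h2)
  exact ⟨rfl, rfl⟩

end QPath

namespace PathAlg

lemma coeff_add (x y : PathAlg K V) (p : QPath V) : coeff (x + y) p = coeff x p + coeff y p := rfl

lemma coeff_smul (c : K) (x : PathAlg K V) (p : QPath V) : coeff (c • x) p = c * coeff x p := rfl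

lemma coeff_zero (p : QPath V) : coeff (0 : PathAlg K V) p = 0 := rfl

open scoped Classical in
lemma coeff_path (p q : QPath V) (c : K) :
    coeff (path p c) q = if p = q then c else 0 := Finsupp.single_apply

/-- The coefficient of a path, as a linear functional. -/
def coeffHom (p : QPath V) : PathAlg K V →ₗ[K] K where
  toFun x := coeff x p
  map_add' _ _ := rfl
  map_smul' _ _ := rfl

lemma coeffHom_apply (p : QPath V) (x : PathAlg K V) : coeffHom p x = coeff x p := rfl

lemma coeff_ext {x y : PathAlg K V} (h : ∀ p, coeff x p = coeff y p) : x = y := Finsupp.ext h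

lemma coeff_of_mem {k : ℤ} {x : PathAlg K V} (hx : x ∈ pathDeg K V k) {p : QPath V}
    (hp : (p.len : ℤ) ≠ k) : coeff x p = 0 := by
  induction hx using Submodule.span_induction with
  | zero => rfl
  | add a b _ _ ha hb => rw [coeff_add, ha, hb, add_zero]
  | smul c a _ ha => rw [coeff_smul, ha, mul_zero]
  | mem a ha =>
    obtain ⟨q, hq, rfl⟩ := ha
    classical
    rw [coeff_path, if_neg]
    rintro rfl
    exact hp hq

lemma pathDeg_eq_zero {k : ℤ} (hk : k < 0) {x : PathAlg K V} (hx : x ∈ pathDeg K V k) : x = 0 :=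
  coeff_ext fun p => coeff_of_mem hx (by omega)

variable [Fintype V]

/-- The trivial path at a vertex, as an element of the path algebra. -/
abbrev idem (i : V) : PathAlg K V := path (QPath.triv i) 1

lemma vertexHom_single [DecidableEq V] (i : V) (c : K) :
    vertexHom (Pi.single i c) = c • (idem i : PathAlg K V) := by
  rw [vertexHom_apply, vertexSum, Finset.sum_eq_single i]
  · rw [Pi.single_eq_same, path_eq_smul]
  · intro j _ hj
    rw [Pi.single_eq_of_ne hj, path_eq_smul, zero_smul]
  · simp

lemma vertexHom_mul_path (r : V → K) (p : QPath V) :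
    vertexHom r * path p 1 = r p.src • (path p 1 : PathAlg K V) := vertexSum_mul_path r p

lemma path_mul_vertexHom (r : V → K) (p : QPath V) :
    path p 1 * vertexHom r = r p.tgt • (path p 1 : PathAlg K V) := path_mul_vertexSum r p

lemma exists_vertexHom {x : PathAlg K V} (hx : x ∈ pathDeg K V 0) :
    ∃ r : V → K, vertexHom r = x := by
  classical
  induction hx using Submodule.span_induction with
  | zero => exact ⟨0, map_zero _⟩
  | add a b _ _ ha hb =>
    obtain ⟨r, rfl⟩ := ha
    obtain ⟨s, rfl⟩ := hb
    exact ⟨r + s, map_add _ _ _⟩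
  | smul c a _ ha =>
    obtain ⟨r, rfl⟩ := ha
    exact ⟨c • r, map_smul _ _ _⟩
  | mem a ha =>
    obtain ⟨⟨i, j, p⟩, hp, rfl⟩ := ha
    have hp' : p.length = 0 := by exact_mod_cast hp
    obtain rfl := p.eq_of_length_zero hp'
    obtain rfl := p.eq_nil_of_length_zero hp'
    exact ⟨Pi.single i 1, by rw [vertexHom_single, one_smul]⟩

lemma vertexHom_const (c : K) : vertexHom (fun _ : V => c) = algebraMap K (PathAlg K V) c := by
  rw [← vertexHom.commutes c]
  rfl

lemma coeff_vertexHom_mul (r : V → K) (x : PathAlg K V) (p : QPath V) :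
    coeff (vertexHom r * x) p = r p.src * coeff x p := by
  classical
  induction x using PathAlg.induction with
  | zero => rw [mul_zero, coeff_zero, mul_zero]
  | add a b ha hb => rw [mul_add, coeff_add, coeff_add, ha, hb, mul_add]
  | smul c a ha => rw [mul_smul_comm, coeff_smul, coeff_smul, ha]; ring
  | path q =>
    rw [vertexHom_mul_path, coeff_smul, coeff_path]
    split_ifs with h
    · rw [h]
    · simp

lemma coeff_mul_vertexHom (r : V → K) (x : PathAlg K V) (p : QPath V) :
    coeff (x * vertexHom r) p = r p.tgt * coeff x p := by
  classical
  induction x using PathAlg.induction with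
  | zero => rw [zero_mul, coeff_zero, mul_zero]
  | add a b ha hb => rw [add_mul, coeff_add, coeff_add, ha, hb, mul_add]
  | smul c a ha => rw [smul_mul_assoc, coeff_smul, coeff_smul, ha]; ring
  | path q =>
    rw [path_mul_vertexHom, coeff_smul, coeff_path]
    split_ifs with h
    · rw [h]
    · simp

variable (K V) in
/-- The products of a path of length `k` and a path of length `l` span `KQ_{k+l}`. -/
lemma pathDeg_add_le {k l j : ℤ} (hk : 0 ≤ k) (hl : 0 ≤ l) (h : k + l = j) :
    pathDeg K V j ≤ Submodule.span K
      {x | ∃ a ∈ pathDeg K V k, ∃ b ∈ pathDeg K V l, x = a * b} := by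
  refine Submodule.span_le.2 ?_
  rintro _ ⟨⟨i, j', p⟩, hp, rfl⟩
  have hp' : (p.length : ℤ) = j := hp
  obtain ⟨c, a, b, rfl, ha⟩ := p.exists_eq_comp_of_le_length (n := k.toNat) (by omega)
  refine Submodule.subset_span ⟨path ⟨i, c, a⟩ 1, path_mem' _ ?_, path ⟨c, j', b⟩ 1,
    path_mem' _ ?_, ?_⟩
  · change (a.length : ℤ) = k
    omega
  · change (b.length : ℤ) = l
    rw [Quiver.Path.length_comp] at hp'
    omega
  · rw [path_mul_path, pathMul_of_eq rfl]
    rfl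

variable [∀ i j : V, Finite (i ⟶ j)]

variable (V) in
/-- The set `Q_k` of the paths of length `k`. -/
def paths (k : ℤ) : Finset (QPath V) :=
  Set.Finite.toFinset (s := {p : QPath V | (p.len : ℤ) = k}) (finite_paths V k)

lemma mem_paths {k : ℤ} {p : QPath V} : p ∈ paths V k ↔ (p.len : ℤ) = k :=
  Set.Finite.mem_toFinset _

lemma sum_coeff_smul_path {k : ℤ} {x : PathAlg K V} (hx : x ∈ pathDeg K V k) :
    ∑ p ∈ paths V k, coeff x p • (path p 1 : PathAlg K V) = x := by
  classical
  refine coeff_ext fun q => ?_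
  rw [← coeffHom_apply, map_sum]
  simp only [coeffHom_apply, coeff_smul, coeff_path, mul_ite, mul_one, mul_zero]
  rw [Finset.sum_ite_eq']
  split_ifs with h
  · rfl
  · exact (coeff_of_mem hx fun h' => h (mem_paths.2 h')).symm

/-- A sum over the composable pairs formed by a path of length `k` and a path of length `l` is a
sum over the paths of length `k + l`. -/
lemma sum_paths_concat {A : Type*} [AddCommMonoid A] {k l j : ℤ} (hk : 0 ≤ k) (hl : 0 ≤ l)
    (h : k + l = j) (f : QPath V → QPath V → A) (g : QPath V → A)
    (h1 : ∀ p q (hpq : p.tgt = q.src), f p q = g (p.concat q hpq))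
    (h0 : ∀ p q, p.tgt ≠ q.src → f p q = 0) :
    ∑ p ∈ paths V k, ∑ q ∈ paths V l, f p q = ∑ p ∈ paths V j, g p := by
  classical
  rw [← Finset.sum_product', ← Finset.sum_filter_of_ne (p := fun x => x.1.tgt = x.2.src)
    (fun x _ hx => by_contra fun hc => hx (h0 _ _ hc))]
  refine Finset.sum_bij (fun x hx => x.1.concat x.2 (Finset.mem_filter.1 hx).2) ?_ ?_ ?_ ?_
  · rintro ⟨p, q⟩ hx
    have hx' := Finset.mem_product.1 (Finset.mem_filter.1 hx).1
    have e1 := mem_paths.1 hx'.1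
    have e2 := mem_paths.1 hx'.2
    rw [mem_paths, QPath.len_concat, ← h, ← e1, ← e2]
    push_cast
    rfl
  · rintro ⟨p, q⟩ hx ⟨p', q'⟩ hy hxy
    obtain ⟨hx1, hx2⟩ := Finset.mem_filter.1 hx
    obtain ⟨hy1, hy2⟩ := Finset.mem_filter.1 hy
    have hp := mem_paths.1 (Finset.mem_product.1 hx1).1
    have hp' := mem_paths.1 (Finset.mem_product.1 hy1).1
    exact Prod.ext_iff.2 (QPath.concat_injective hx2 hy2 (by exact_mod_cast hp.trans hp'.symm) hxy)
  · rintro ⟨i, j', p⟩ hp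
    have hp' : (p.length : ℤ) = j := mem_paths.1 hp
    obtain ⟨c, a, b, rfl, ha⟩ := p.exists_eq_comp_of_le_length (n := k.toNat) (by omega)
    rw [Quiver.Path.length_comp] at hp'
    refine ⟨(⟨i, c, a⟩, ⟨c, j', b⟩), Finset.mem_filter.2 ⟨Finset.mem_product.2
      ⟨mem_paths.2 ?_, mem_paths.2 ?_⟩, rfl⟩, rfl⟩
    · change (a.length : ℤ) = k
      omega
    · change (b.length : ℤ) = l
      omega
  · rintro ⟨p, q⟩ hx
    exact h1 _ _ _

/-- The homogeneous component of degree `k` of an element of the path algebra. -/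
def component (k : ℤ) : PathAlg K V →ₗ[K] PathAlg K V where
  toFun x := ∑ p ∈ paths V k, coeff x p • (path p 1 : PathAlg K V)
  map_add' x y := by simp only [coeff_add, add_smul, Finset.sum_add_distrib]
  map_smul' c x := by simp only [coeff_smul, mul_smul, Finset.smul_sum, RingHom.id_apply]

lemma component_mem (k : ℤ) (x : PathAlg K V) : component k x ∈ pathDeg K V k :=
  sum_mem fun _ hp => Submodule.smul_mem _ _ (path_mem' _ (mem_paths.1 hp))

lemma component_of_mem {k : ℤ} {x : PathAlg K V} (hx : x ∈ pathDeg K V k) : component k x = x :=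
  sum_coeff_smul_path hx

lemma component_of_ne {k l : ℤ} (h : l ≠ k) {x : PathAlg K V} (hx : x ∈ pathDeg K V l) :
    component k x = 0 :=
  Finset.sum_eq_zero fun p hp => by
    rw [coeff_of_mem hx (by rw [mem_paths.1 hp]; exact h.symm), zero_smul]

lemma coeff_sum_smul_path {k : ℤ} (f : QPath V → K) {p : QPath V} (hp : p ∈ paths V k) :
    coeff (∑ q ∈ paths V k, f q • (path q 1 : PathAlg K V)) p = f p := by
  classical
  rw [← coeffHom_apply, map_sum]
  simp only [coeffHom_apply, coeff_smul, coeff_path, mul_ite, mul_one, mul_zero]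
  rw [Finset.sum_ite_eq', if_pos hp]

lemma coeff_component {k : ℤ} (x : PathAlg K V) {p : QPath V} (hp : (p.len : ℤ) = k) :
    coeff (component k x) p = coeff x p := coeff_sum_smul_path _ (mem_paths.2 hp)

open scoped Classical in
lemma pairing_eq_sum {k : ℤ} {x : PathAlg K V} (hx : x ∈ pathDeg K V k)
    (y : PathAlg K V) :
    pairing x y = ∑ p ∈ paths V k, Pi.single p.tgt (coeff x p * coeff y p) := by
  have h : (show QPath V →₀ K from x).support ⊆ paths V k := fun p hp => by
    by_contra hc
    exact Finsupp.mem_support_iff.1 hp (coeff_of_mem hx fun h' => hc (mem_paths.2 h'))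
  exact Finsupp.sum_of_support_subset _ h _ fun p _ => by rw [zero_mul, Pi.single_zero]

end PathAlg

end Paths

/-! ### Linear functionals on a graded factor of the path algebra -/

section Functionals

variable {K V L : Type u} [Field K] [Quiver.{u} V] [Fintype V] [Ring L] [Algebra K L]
  {𝓛 : ℤ → Submodule K L} {π : PathAlg K V →ₐ[K] L} {n : ℕ}

/-- A functional on `KQ` that vanishes on the relations factors through `Λ`. -/
lemma IsGradedFactor.exists_functional (hπ : IsGradedFactor 𝓛 π) (f : PathAlg K V →ₗ[K] K)
    (hf : ∀ x, π x = 0 → f x = 0) : ∃ g : L →ₗ[K] K, ∀ x, g (π x) = f x := by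
  obtain ⟨s, hs⟩ := π.toLinearMap.exists_rightInverse_of_surjective
    (LinearMap.range_eq_top.2 hπ.surjective)
  refine ⟨f ∘ₗ s, fun x => ?_⟩
  have h := hf (s (π x) - x) (by
    rw [map_sub, sub_eq_zero]
    exact LinearMap.congr_fun hs (π x))
  rwa [map_sub, sub_eq_zero] at h

/-- The relations involve no path of length less than `n`. -/
lemma HasRelationsOfDegreeGE.coeff_eq_zero (hrel : HasRelationsOfDegreeGE n π) {x : PathAlg K V}
    (hx : π x = 0) {p : QPath V} (hp : p.len < n) : coeff x p = 0 := by
  classical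
  set S : Submodule K (PathAlg K V) :=
    Submodule.span K ((fun p => path p (1 : K)) '' {p | n ≤ p.len}) with hS
  have hmul : ∀ p q : QPath V, n ≤ p.len ∨ n ≤ q.len → (pathMul p q : PathAlg K V) ∈ S := by
    intro p q h
    by_cases hpq : p.tgt = q.src
    · rw [pathMul_of_eq hpq]
      refine Submodule.subset_span ⟨_, ?_, rfl⟩
      change n ≤ (p.concat q hpq).len
      rw [QPath.len_concat]
      omega
    · rw [pathMul_of_ne hpq]
      exact zero_mem _
  have hl : ∀ a b, b ∈ S → a * b ∈ S := by
    intro a b hb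
    induction a using PathAlg.induction with
    | zero => rw [zero_mul]; exact zero_mem _
    | add a a' ha ha' => rw [add_mul]; exact add_mem ha ha'
    | smul c a ha => rw [smul_mul_assoc]; exact Submodule.smul_mem _ _ ha
    | path p =>
      induction hb using Submodule.span_induction with
      | zero => rw [mul_zero]; exact zero_mem _
      | add a a' _ _ ha ha' => rw [mul_add]; exact add_mem ha ha'
      | smul c a _ ha => rw [mul_smul_comm]; exact Submodule.smul_mem _ _ ha
      | mem b hb =>
        obtain ⟨q, hq, rfl⟩ := hb
        change path p 1 * path q 1 ∈ S
        rw [path_mul_path]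
        exact hmul _ _ (Or.inr hq)
  have hr : ∀ a b, a ∈ S → a * b ∈ S := by
    intro a b ha
    induction b using PathAlg.induction with
    | zero => rw [mul_zero]; exact zero_mem _
    | add a a' ha ha' => rw [mul_add]; exact add_mem ha ha'
    | smul c a ha => rw [mul_smul_comm]; exact Submodule.smul_mem _ _ ha
    | path q =>
      induction ha using Submodule.span_induction with
      | zero => rw [zero_mul]; exact zero_mem _
      | add a a' _ _ ha ha' => rw [add_mul]; exact add_mem ha ha'
      | smul c a _ ha => rw [smul_mul_assoc]; exact Submodule.smul_mem _ _ ha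
      | mem b hb =>
        obtain ⟨p, hp, rfl⟩ := hb
        change path p 1 * path q 1 ∈ S
        rw [path_mul_path]
        exact hmul _ _ (Or.inl hp)
  have key : TwoSidedIdeal.ker π ≤ TwoSidedIdeal.mk' (S : Set (PathAlg K V)) (zero_mem _)
      (fun h h' => add_mem h h') (fun h => neg_mem h) (fun h => hl _ _ h) (fun h => hr _ _ h) := by
    rw [hrel, TwoSidedIdeal.span_le]
    rintro y ⟨-, k, hk, hy⟩
    rw [SetLike.mem_coe, TwoSidedIdeal.mem_mk']
    refine Submodule.span_mono (Set.image_mono ?_) hy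
    intro q hq
    have hq' : (q.len : ℤ) = k := hq
    change n ≤ q.len
    omega
  have hxS : x ∈ S := by
    have := key (show x ∈ TwoSidedIdeal.ker π from (TwoSidedIdeal.mem_ker _).2 hx)
    rwa [TwoSidedIdeal.mem_mk'] at this
  clear hx
  induction hxS using Submodule.span_induction with
  | zero => rfl
  | add a b _ _ ha hb => rw [coeff_add, ha, hb, add_zero]
  | smul c a _ ha => rw [coeff_smul, ha, mul_zero]
  | mem a ha =>
    obtain ⟨q, hq, rfl⟩ := ha
    have hq' : n ≤ q.len := hq
    rw [coeff_path, if_neg]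
    rintro rfl
    omega

/-- The functional on `Λ` that reads off the coefficient of a path of length less than `n`. -/
lemma IsGradedFactor.exists_coeff_functional (hπ : IsGradedFactor 𝓛 π)
    (hrel : HasRelationsOfDegreeGE n π) {p : QPath V} (hp : p.len < n) :
    ∃ f : L →ₗ[K] K, ∀ x, f (π x) = coeff x p :=
  hπ.exists_functional (coeffHom p) fun _ hx => hrel.coeff_eq_zero hx hp

variable [∀ i j : V, Finite (i ⟶ j)] [GradedAlgebra 𝓛]

lemma IsGradedFactor.decompose_apply (hπ : IsGradedFactor 𝓛 π) (k : ℤ) (x : PathAlg K V) :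
    (decompose 𝓛 (π x) k : L) = π (component k x) := by
  induction x using PathAlg.induction with
  | zero => simp
  | add a b ha hb =>
    rw [map_add π, decompose_add, DirectSum.add_apply, Submodule.coe_add, ha, hb, ← map_add π,
      ← map_add (component k)]
  | smul c a ha =>
    rw [map_smul π, decompose_smul, DirectSum.smul_apply, Submodule.coe_smul, ha, ← map_smul π,
      ← map_smul (component k)]
  | path p =>
    by_cases h : (p.len : ℤ) = k
    · rw [component_of_mem (path_mem' p h)]
      exact decompose_of_mem_same _ (hπ.map_mem _ _ (path_mem' p h))
    · rw [component_of_ne h (path_mem p), map_zero]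
      exact decompose_of_mem_ne _ (hπ.map_mem _ _ (path_mem p)) h

lemma IsGradedFactor.map_component (hπ : IsGradedFactor 𝓛 π) (k : ℤ) {x : PathAlg K V}
    (hx : π x = 0) : π (component k x) = 0 := by
  rw [← hπ.decompose_apply, hx, decompose_zero]
  rfl

lemma IsGradedFactor.exists_of_mem (hπ : IsGradedFactor 𝓛 π) {k : ℤ} {l : L} (hl : l ∈ 𝓛 k) :
    ∃ x ∈ pathDeg K V k, π x = l := by
  obtain ⟨x, rfl⟩ := hπ.surjective l
  exact ⟨component k x, component_mem k x, by
    rw [← hπ.decompose_apply, decompose_of_mem_same _ hl]⟩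

/-- The functional on `Λ` given by an element of `I_n^⊥`. -/
lemma IsGradedFactor.exists_perp_functional (hπ : IsGradedFactor 𝓛 π) {x : PathAlg K V}
    (hx : x ∈ perp n π) :
    ∃ f : L →ₗ[K] K, ∀ p ∈ paths V n, f (π (path p 1)) = coeff x p := by
  classical
  obtain ⟨f, hf⟩ := hπ.exists_functional (∑ p ∈ paths V n, coeff x p • coeffHom p) (by
    intro y hy
    have h := hx.2 _ (component_mem n y) (hπ.map_component n hy)
    rw [pairing_eq_sum hx.1] at h
    have h2 := congrArg (fun r : V → K => ∑ j, r j) h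
    simp only [Finset.sum_apply, Pi.zero_apply, Finset.sum_const_zero] at h2
    rw [Finset.sum_comm] at h2
    rw [LinearMap.sum_apply, ← h2]
    refine Finset.sum_congr rfl fun p hp => ?_
    rw [Finset.sum_pi_single']
    simp [coeffHom_apply, coeff_component y (mem_paths.1 hp)])
  refine ⟨f, fun p hp => ?_⟩
  rw [hf, LinearMap.sum_apply, Finset.sum_eq_single p]
  · simp [coeffHom_apply, coeff_path]
  · intro q _ hq
    simp [coeffHom_apply, coeff_path, hq.symm]
  · exact fun h => (h hp).elim

/-- The values of a functional on `Λ` at the paths of length `n` are the coefficients of an element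
of `I_n^⊥`. -/
lemma sum_functional_mem_perp (f : L →ₗ[K] K) :
    ∑ p ∈ paths V n, f (π (path p 1)) • (path p 1 : PathAlg K V) ∈ perp n π := by
  classical
  have hmem : ∑ p ∈ paths V n, f (π (path p 1)) • (path p 1 : PathAlg K V) ∈ pathDeg K V n :=
    sum_mem fun p hp => Submodule.smul_mem _ _ (path_mem' p (mem_paths.1 hp))
  refine ⟨hmem, fun y hy h0 => ?_⟩
  rw [pairing_eq_sum hmem]
  ext j
  have hj : π (y * vertexHom (Pi.single j 1)) = 0 := by rw [map_mul, h0, zero_mul]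
  have hy' : y * vertexHom (Pi.single j 1) ∈ pathDeg K V n :=
    mul_mem_pathDeg' (add_zero _) hy (vertexSum_mem _)
  rw [← sum_coeff_smul_path hy', map_sum] at hj
  have := congrArg f hj
  rw [map_zero, map_sum] at this
  rw [Finset.sum_apply, Pi.zero_apply, ← this]
  refine Finset.sum_congr rfl fun p hp => ?_
  rw [coeff_sum_smul_path (fun p => f (π (path p 1))) hp, coeff_mul_vertexHom, map_smul,
    map_smul, smul_eq_mul]
  by_cases h : p.tgt = j
  · subst h
    rw [Pi.single_eq_same, Pi.single_eq_same, one_mul, mul_comm]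
  · rw [Pi.single_eq_of_ne (Ne.symm h), Pi.single_eq_of_ne h, zero_mul, zero_mul]

end Functionals

/-! ### Epimorphisms and isomorphisms of graded modules -/

namespace GrMod

variable {K B : Type u} [Field K] [Ring B] [Algebra K B] {𝓑 : ℤ → Submodule K B}
  {M N : GrMod 𝓑}

lemma decompose_map (f : M ⟶ N) (x : M.carrier) (i : ℤ) :
    (decompose N.deg (f.toLin x) i : N.carrier) = f.toLin (decompose M.deg x i) := by
  induction x using DirectSum.Decomposition.inductionOn M.deg with
  | zero => simp
  | add a b ha hb =>
    rw [f.toLin.map_add, decompose_add, decompose_add, DirectSum.add_apply, DirectSum.add_apply,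
      AddSubgroup.coe_add, AddSubgroup.coe_add, ha, hb, f.toLin.map_add]
  | @homogeneous j a =>
    by_cases h : j = i
    · subst h
      rw [decompose_of_mem_same _ (f.map_mem a.2), decompose_of_mem_same _ a.2]
    · rw [decompose_of_mem_ne _ (f.map_mem a.2) h, decompose_of_mem_ne _ a.2 h, map_zero]

/-- The homogeneous component of degree `i` of an element. -/
def part (M : GrMod 𝓑) (i : ℤ) (x : M.carrier) : M.carrier := decompose M.deg x i

lemma part_mem (M : GrMod 𝓑) (i : ℤ) (x : M.carrier) : M.part i x ∈ M.deg i :=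
  (decompose M.deg x i).2

lemma part_of_mem {i : ℤ} {x : M.carrier} (hx : x ∈ M.deg i) : M.part i x = x :=
  decompose_of_mem_same _ hx

lemma map_part (f : M ⟶ N) (i : ℤ) (x : M.carrier) :
    f.toLin (M.part i x) = N.part i (f.toLin x) := (decompose_map f x i).symm

lemma part_zero (M : GrMod 𝓑) (i : ℤ) : M.part i 0 = 0 := by
  rw [part, decompose_zero]
  rfl

/-- A subgroup that contains the homogeneous components of an element contains the element. -/
lemma mem_of_part_mem (S : AddSubgroup M.carrier) {x : M.carrier} (h : ∀ i, M.part i x ∈ S) :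
    x ∈ S := by
  classical
  rw [← DirectSum.sum_support_decompose M.deg x]
  exact sum_mem fun i _ => h i

lemma range_isHomogeneous (f : M ⟶ N) : (LinearMap.range f.toLin).IsHomogeneous N.deg := by
  rintro i _ ⟨x, rfl⟩
  exact ⟨_, (decompose_map f x i).symm⟩

lemma epi_of_surjective (f : M ⟶ N) (h : Function.Surjective f.toLin) : Epi f :=
  ⟨fun g g' hg => hom_ext (LinearMap.ext fun x => by
    obtain ⟨y, rfl⟩ := h x
    exact LinearMap.congr_fun (congrArg Hom.toLin hg) y)⟩

/-- A morphism onto whose image every generating degree falls is surjective. -/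
lemma surjective_of_generatedIn {𝒳 : Set ℤ} (hN : N.GeneratedIn 𝒳) (f : M ⟶ N)
    (h : ∀ i ∈ 𝒳, ∀ x ∈ N.deg i, ∃ y, f.toLin y = x) : Function.Surjective f.toLin := by
  rw [← LinearMap.range_eq_top]
  by_contra hc
  obtain ⟨i, hi, hle⟩ := hN _ (range_isHomogeneous f) hc
  exact hle fun x hx => h i hi x hx

section Quotient

variable (S : Submodule Bᵐᵒᵖ M.carrier)

/-- The homogeneous components of a quotient module. -/
def quotientDeg (i : ℤ) : AddSubgroup (M.carrier ⧸ S) := (M.deg i).map S.mkQ.toAddMonoidHom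

/-- Auxiliary: the map that decomposes the class of an element. -/
def quotientDecompose : M.carrier →+ ⨁ i, quotientDeg S i :=
  (DirectSum.toAddMonoid fun i => (DirectSum.of (fun i => quotientDeg S i) i).comp
    (AddMonoidHom.mk' (fun x : M.deg i => (⟨S.mkQ x.1, ⟨x.1, x.2, rfl⟩⟩ : quotientDeg S i))
      fun x y => Subtype.ext (map_add S.mkQ x.1 y.1))).comp (decomposeAddEquiv M.deg).toAddMonoidHom

variable {S} in
lemma quotientDecompose_of_mem {i : ℤ} {x : M.carrier} (hx : x ∈ M.deg i) :
    quotientDecompose S x = DirectSum.of (fun i => quotientDeg S i) i ⟨S.mkQ x, ⟨x, hx, rfl⟩⟩ := by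
  simp only [quotientDecompose, AddMonoidHom.comp_apply]
  change DirectSum.toAddMonoid _ (decompose M.deg x) = _
  rw [decompose_of_mem _ hx, DirectSum.toAddMonoid_of]
  rfl

lemma quotientDecompose_eq_zero (hS : S.IsHomogeneous M.deg) {x : M.carrier} (hx : x ∈ S) :
    quotientDecompose S x = 0 := by
  classical
  change DirectSum.toAddMonoid _ (decompose M.deg x) = 0
  rw [← DirectSum.sum_support_of (decompose M.deg x), map_sum]
  refine Finset.sum_eq_zero fun i _ => ?_
  rw [DirectSum.toAddMonoid_of, AddMonoidHom.comp_apply]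
  convert map_zero (DirectSum.of (fun i => quotientDeg S i) i)
  exact Subtype.ext ((Submodule.Quotient.mk_eq_zero S).2 (hS i hx))

/-- The graded quotient of a graded module by a homogeneous submodule. -/
def quotient (hS : S.IsHomogeneous M.deg) : GrMod 𝓑 :=
  letI D : (M.carrier ⧸ S) →+ ⨁ i, quotientDeg S i :=
    QuotientAddGroup.lift S.toAddSubgroup (quotientDecompose S)
      fun _ hx => quotientDecompose_eq_zero S hS hx
  letI : DirectSum.Decomposition (quotientDeg S) := DirectSum.Decomposition.ofAddHom _ D
    (by
      refine AddMonoidHom.ext fun y => ?_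
      obtain ⟨x, rfl⟩ := Submodule.mkQ_surjective S y
      change DirectSum.coeAddMonoidHom _ (quotientDecompose S x) = S.mkQ x
      induction x using DirectSum.Decomposition.inductionOn M.deg with
      | zero => simp
      | add a b ha hb => rw [map_add, map_add, ha, hb, map_add]
      | homogeneous a => rw [quotientDecompose_of_mem a.2, DirectSum.coeAddMonoidHom_of])
    (by
      refine DirectSum.addHom_ext' fun i => AddMonoidHom.ext ?_
      rintro ⟨_, x, hx, rfl⟩
      rw [AddMonoidHom.comp_apply, AddMonoidHom.comp_apply, DirectSum.coeAddMonoidHom_of]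
      exact quotientDecompose_of_mem hx)
  { carrier := M.carrier ⧸ S
    deg := quotientDeg S
    smul_mem := by
      rintro i j _ b ⟨x, hx, rfl⟩ hb
      exact ⟨_, M.smul_mem hx hb, rfl⟩ }

/-- Epimorphisms of graded modules are surjective. -/
lemma surjective_of_epi (f : M ⟶ N) [Epi f] : Function.Surjective f.toLin := by
  set S := LinearMap.range f.toLin
  let g : N ⟶ quotient S (range_isHomogeneous f) := ⟨S.mkQ, fun h => ⟨_, h, rfl⟩⟩
  have h : f ≫ g = f ≫ 0 := hom_ext (LinearMap.ext fun x =>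
    (Submodule.Quotient.mk_eq_zero S).2 ⟨x, rfl⟩)
  have h0 : g = 0 := (cancel_epi f).1 h
  intro y
  have hy : S.mkQ y = 0 := LinearMap.congr_fun (congrArg Hom.toLin h0) y
  exact (Submodule.Quotient.mk_eq_zero S).1 hy

end Quotient

lemma map_mem_iff_of_injective {f : M ⟶ N} (h : Function.Injective f.toLin) {i : ℤ}
    {x : M.carrier} : f.toLin x ∈ N.deg i ↔ x ∈ M.deg i := by
  refine ⟨fun hx => ?_, f.map_mem⟩
  have h1 := decompose_map f x i
  rw [decompose_of_mem_same _ hx] at h1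
  rw [h h1]
  exact (decompose M.deg x i).2

/-- A bijective morphism of graded modules is an isomorphism. -/
def isoOfBijective (f : M ⟶ N) (h : Function.Bijective f.toLin) : M ≅ N where
  hom := f
  inv := ⟨(LinearEquiv.ofBijective f.toLin h).symm, fun {i x} hx => by
    rw [← map_mem_iff_of_injective h.1]
    convert hx
    exact (LinearEquiv.ofBijective f.toLin h).apply_symm_apply x⟩
  hom_inv_id := hom_ext (LinearMap.ext fun x =>
    (LinearEquiv.ofBijective f.toLin h).symm_apply_apply x)
  inv_hom_id := hom_ext (LinearMap.ext fun x =>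
    (LinearEquiv.ofBijective f.toLin h).apply_symm_apply x)

lemma map_mem_mulRadical (f : M ⟶ N) {x : M.carrier} (hx : x ∈ M.mulRadical) :
    f.toLin x ∈ N.mulRadical := by
  induction hx using AddSubgroup.closure_induction with
  | zero => rw [map_zero]; exact zero_mem _
  | add a b _ _ ha hb => rw [map_add]; exact add_mem ha hb
  | neg a _ ha => rw [map_neg]; exact neg_mem ha
  | mem a ha =>
    obtain ⟨y, b, hb, rfl⟩ := ha
    rw [f.toLin.map_smul]
    exact AddSubgroup.subset_closure ⟨_, b, hb, rfl⟩

end GrMod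

/-! ### The graded modules `Y ⊗ Λ` -/

section Free

variable {K V L : Type u} [Field K] [Quiver.{u} V] [Fintype V] [Ring L] [Algebra K L]

/-- The algebra `Λ` as a `KQ₀`-`Λ`-bimodule. -/
def LeftL (_ : PathAlg K V →ₐ[K] L) : Type u := L

section

variable (π : PathAlg K V →ₐ[K] L)

instance : AddCommGroup (LeftL π) := inferInstanceAs (AddCommGroup L)

instance : Module Lᵐᵒᵖ (LeftL π) := inferInstanceAs (Module Lᵐᵒᵖ L)

instance : Module (V → K) (LeftL π) :=
  Module.compHom L ((π.comp vertexHom : (V → K) →ₐ[K] L) : (V → K) →+* L)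

instance : SMulCommClass (V → K) Lᵐᵒᵖ (LeftL π) :=
  ⟨fun r b x => (mul_assoc (π (vertexHom r)) (show L from x) b.unop).symm⟩

/-- The right `Λ`-module `Y ⊗ Λ`, the tensor product being over `KQ₀`. The two factors are written
in the opposite order. -/
def FreeMod (N : Type u) [AddCommGroup N] [Module (V → K) N] : Type u := LeftL π ⊗[V → K] N

variable (N : Type u) [AddCommGroup N] [Module (V → K) N]

instance : AddCommGroup (FreeMod π N) := inferInstanceAs (AddCommGroup (LeftL π ⊗[V → K] N))

instance : Module Lᵐᵒᵖ (FreeMod π N) := inferInstanceAs (Module Lᵐᵒᵖ (LeftL π ⊗[V → K] N))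

end

namespace FreeMod

variable {π : PathAlg K V →ₐ[K] L} {N N' : Type u} [AddCommGroup N] [Module (V → K) N]
  [AddCommGroup N'] [Module (V → K) N']

variable (π) in
/-- The element `y ⊗ l` of `Y ⊗ Λ`. -/
def tmul (l : L) (y : N) : FreeMod π N := (show LeftL π from l) ⊗ₜ[V → K] y

lemma tmul_add (l : L) (y z : N) : tmul π l (y + z) = tmul π l y + tmul π l z :=
  TensorProduct.tmul_add ..

lemma add_tmul (l l' : L) (y : N) : tmul π (l + l') y = tmul π l y + tmul π l' y :=
  TensorProduct.add_tmul ..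

lemma tmul_zero (l : L) : tmul π l (0 : N) = 0 := TensorProduct.tmul_zero ..

lemma zero_tmul (y : N) : tmul π 0 y = 0 := TensorProduct.zero_tmul ..

variable (π) in
/-- `y ⊗ l`, as a biadditive map. -/
def tmulHom : L →+ N →+ FreeMod π N :=
  AddMonoidHom.mk' (fun l => AddMonoidHom.mk' (fun y => tmul π l y) (tmul_add l))
    fun l l' => AddMonoidHom.ext fun y => add_tmul l l' y

lemma tmul_sum {ι : Type*} (s : Finset ι) (l : L) (y : ι → N) :
    tmul π l (∑ i ∈ s, y i) = ∑ i ∈ s, tmul π l (y i) := map_sum (tmulHom π l) _ _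

lemma sum_tmul {ι : Type*} (s : Finset ι) (l : ι → L) (y : N) :
    tmul π (∑ i ∈ s, l i) y = ∑ i ∈ s, tmul π (l i) y :=
  map_sum (AddMonoidHom.mk' (fun l => tmul π l y) fun l l' => add_tmul l l' y) _ _

lemma smul_tmul (b l : L) (y : N) : MulOpposite.op b • tmul π l y = tmul π (l * b) y :=
  TensorProduct.smul_tmul' ..

lemma tmul_smul (r : V → K) (l : L) (y : N) :
    tmul π l (r • y) = tmul π (π (vertexHom r) * l) y :=
  (TensorProduct.smul_tmul r (show LeftL π from l) y).symm

lemma tmul_const_smul (c : K) (l : L) (y : N) :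
    tmul π l ((fun _ => c : V → K) • y) = tmul π (c • l) y := by
  rw [tmul_smul, vertexHom_const, AlgHom.commutes, Algebra.smul_def]

lemma tmul_path_single [DecidableEq V] (p : QPath V) (c : K) (y : N) :
    tmul π (π (path p 1)) ((Pi.single p.src c : V → K) • y) = tmul π (c • π (path p 1)) y := by
  rw [tmul_smul, ← map_mul, vertexHom_mul_path, Pi.single_eq_same, map_smul]

@[elab_as_elim]
lemma induction {P : FreeMod π N → Prop} (t : FreeMod π N) (zero : P 0)
    (tmul : ∀ l y, P (tmul π l y)) (add : ∀ s t, P s → P t → P (s + t)) : P t :=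
  TensorProduct.induction_on (motive := P) t zero tmul add

/-- The additive map on `Y ⊗ Λ` given by a balanced biadditive map. -/
def lift {A : Type*} [AddCommGroup A] (f : L →+ N →+ A)
    (hf : ∀ (r : V → K) l y, f (π (vertexHom r) * l) y = f l (r • y)) : FreeMod π N →+ A :=
  TensorProduct.liftAddHom (R := V → K) (M := LeftL π) f hf

section Eval

/-- A linear functional on `Λ` induces a map `Y ⊗ Λ → Y`. -/
def eval (f : L →ₗ[K] K) : FreeMod π N →+ N :=
  lift
    (AddMonoidHom.mk' (fun l => AddMonoidHom.mk'
      (fun y : N => (fun i : V => f (π (idem i) * l)) • y) fun y z => smul_add _ y z)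
      fun l l' => AddMonoidHom.ext fun y => by
        change (fun i : V => f (π (idem i) * (l + l'))) • y =
          (fun i : V => f (π (idem i) * l)) • y + (fun i : V => f (π (idem i) * l')) • y
        rw [← add_smul]
        congr 1
        ext i
        rw [mul_add, map_add]
        rfl)
    (fun r l y => by
      change (fun i : V => f (π (idem i) * (π (vertexHom r) * l))) • y =
        (fun i : V => f (π (idem i) * l)) • r • y
      rw [smul_smul]
      congr 1
      ext i
      rw [← mul_assoc, ← map_mul, path_mul_vertexHom, map_smul, smul_mul_assoc, map_smul,
        smul_eq_mul, mul_comm]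
      rfl)

lemma eval_tmul (f : L →ₗ[K] K) (l : L) (y : N) :
    eval f (tmul π l y) = (fun i : V => f (π (idem i) * l) : V → K) • y := rfl

lemma eval_tmul_path [DecidableEq V] (f : L →ₗ[K] K) (p : QPath V) (y : N) :
    eval f (tmul π (π (path p 1)) y) = (Pi.single p.src (f (π (path p 1))) : V → K) • y := by
  rw [eval_tmul]
  congr 1
  ext i
  rw [← map_mul, path_mul_path]
  by_cases h : i = p.src
  · subst h
    rw [Pi.single_eq_same, pathMul_of_eq rfl, QPath.triv_concat]
  · rw [Pi.single_eq_of_ne h, pathMul_of_ne h, map_zero, map_zero]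

end Eval

variable {𝓛 : ℤ → Submodule K L} {n : ℕ}

/-- The map `Y ⊗ Λ → Y` that reads off the coefficient of a path of length less than `n`. -/
lemma exists_coeff (hπ : IsGradedFactor 𝓛 π) (hrel : HasRelationsOfDegreeGE n π) {p : QPath V}
    (hp : p.len < n) (N : Type u) [AddCommGroup N] [Module (V → K) N] [DecidableEq V]
    [DecidableEq (QPath V)] :
    ∃ f : FreeMod π N →+ N, ∀ q y, f (tmul π (π (path q 1)) y) =
      if q = p then (Pi.single p.src 1 : V → K) • y else 0 := by
  obtain ⟨g, hg⟩ := hπ.exists_coeff_functional hrel hp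
  refine ⟨eval g, fun q y => ?_⟩
  rw [eval_tmul_path, hg, coeff_path]
  by_cases h : q = p
  · subst h
    rw [if_pos rfl, if_pos rfl]
  · rw [if_neg h, if_neg h, Pi.single_zero, zero_smul]

/-- The projection `Y ⊗ Λ → Y ⊗ Λ₀ = Y`. -/
lemma exists_counit (hπ : IsGradedFactor 𝓛 π) (hrel : HasRelationsOfDegreeGE n π)
    (hn : 0 < n) (N : Type u) [AddCommGroup N] [Module (V → K) N] :
    ∃ ε : FreeMod π N →+ N, (∀ y, ε (tmul π 1 y) = y) ∧
      ∀ x : PathAlg K V, (∀ i, coeff x (QPath.triv i) = 0) → ∀ y, ε (tmul π (π x) y) = 0 := by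
  classical
  choose g hg using fun i : V => hπ.exists_coeff_functional hrel (p := QPath.triv i) hn
  refine ⟨eval (∑ i, g i), fun y => ?_, fun x hx y => ?_⟩
  · rw [eval_tmul]
    convert one_smul (V → K) y
    rename_i i
    rw [mul_one, LinearMap.sum_apply, Finset.sum_eq_single i]
    · rw [hg, coeff_path, if_pos rfl]
      rfl
    · intro j _ hj
      rw [hg, coeff_path, if_neg]
      intro h
      exact hj (congrArg Sigma.fst h).symm
    · simp
  · rw [eval_tmul]
    convert zero_smul (V → K) y
    rename_i i
    rw [LinearMap.sum_apply]
    refine Finset.sum_eq_zero fun j _ => ?_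
    rw [← map_mul, hg]
    have h : (idem i : PathAlg K V) = vertexHom (Pi.single i 1) := by
      rw [vertexHom_single, one_smul]
    rw [h, coeff_vertexHom_mul, hx, mul_zero]

lemma tmul_one_injective (hπ : IsGradedFactor 𝓛 π) (hrel : HasRelationsOfDegreeGE n π)
    (hn : 0 < n) : Function.Injective (tmul π 1 : N → FreeMod π N) := by
  obtain ⟨ε, hε, -⟩ := exists_counit hπ hrel hn N
  exact Function.LeftInverse.injective (g := ε) hε

section Perp

variable [∀ i j : V, Finite (i ⟶ j)]

/-- The coefficients of the paths of length less than `n` are determined by an element of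
`Y ⊗ Λ`. -/
lemma sum_tmul_path_injective [DecidableEq V] (hπ : IsGradedFactor 𝓛 π)
    (hrel : HasRelationsOfDegreeGE n π) {k : ℤ} (hk : k < n) {y z : QPath V → N}
    (hy : ∀ p ∈ paths V k, (Pi.single p.src 1 : V → K) • y p = y p)
    (hz : ∀ p ∈ paths V k, (Pi.single p.src 1 : V → K) • z p = z p)
    (h : ∑ p ∈ paths V k, tmul π (π (path p 1)) (y p) =
      ∑ p ∈ paths V k, tmul π (π (path p 1)) (z p)) {p : QPath V} (hp : p ∈ paths V k) :
    y p = z p := by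
  classical
  obtain ⟨f, hf⟩ := exists_coeff hπ hrel (p := p) (by
    have := mem_paths.1 hp
    omega) N
  have := congrArg f h
  simp only [map_sum, hf] at this
  rwa [Finset.sum_ite_eq', Finset.sum_ite_eq', if_pos hp, if_pos hp, hy p hp, hz p hp] at this

/-- If `∑ y_p ⊗ p`, the sum being over the paths `p` of length `n`, is zero in `Y ⊗ Λ`, then `y` is
orthogonal to `I_n^⊥`. -/
lemma sum_coeff_smul_eq_zero [GradedAlgebra 𝓛] [DecidableEq V] (hπ : IsGradedFactor 𝓛 π)
    (y : QPath V → N)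
    (hy : ∀ p ∈ paths V n, (Pi.single p.src 1 : V → K) • y p = y p)
    (h : ∑ p ∈ paths V n, tmul π (π (path p 1)) (y p) = 0) {x : PathAlg K V}
    (hx : x ∈ perp n π) : ∑ p ∈ paths V n, (fun _ => coeff x p : V → K) • y p = 0 := by
  obtain ⟨f, hf⟩ := hπ.exists_perp_functional hx
  have := congrArg (eval f) h
  rw [map_sum, map_zero] at this
  rw [← this]
  refine Finset.sum_congr rfl fun p hp => ?_
  rw [eval_tmul_path, hf p hp, ← hy p hp, smul_smul, smul_smul]
  congr 1
  ext i
  by_cases h : i = p.src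
  · subst h
    simp
  · simp [Pi.single_eq_of_ne h]

/-- If `y` is orthogonal to `I_n^⊥`, then `∑ y_p ⊗ p`, the sum being over the paths `p` of length
`n`, is zero in `Y ⊗ Λ`. Coordinates in a basis of `Λ` give elements of `I_n^⊥`. -/
lemma sum_tmul_path_eq_zero (y : QPath V → N)
    (h : ∀ x ∈ perp n π, ∑ p ∈ paths V n, (fun _ => coeff x p : V → K) • y p = 0) :
    ∑ p ∈ paths V n, tmul π (π (path p 1)) (y p) = 0 := by
  classical
  let b := Module.Basis.ofVectorSpace K L
  let S := (paths V n).biUnion fun p => (b.repr (π (path p 1))).support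
  have h1 : ∀ p ∈ paths V n, tmul π (π (path p 1)) (y p) =
      ∑ s ∈ S, tmul π (b s) ((fun _ => b.coord s (π (path p 1)) : V → K) • y p) := by
    intro p hp
    have h2 : π (path p 1) = ∑ s ∈ S, b.repr (π (path p 1)) s • b s := by
      conv_lhs => rw [← b.linearCombination_repr (π (path p 1)), Finsupp.linearCombination_apply]
      refine Finsupp.sum_of_support_subset _ ?_ _ fun s _ => zero_smul _ _
      exact Finset.subset_biUnion_of_mem (fun p => (b.repr (π (path p 1))).support) hp
    conv_lhs => rw [h2, sum_tmul]
    exact Finset.sum_congr rfl fun s _ => (tmul_const_smul _ _ _).symm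
  rw [Finset.sum_congr rfl h1, Finset.sum_comm]
  refine Finset.sum_eq_zero fun s _ => ?_
  rw [← tmul_sum]
  have h3 := h _ (sum_functional_mem_perp (π := π) (n := n) (b.coord s))
  rw [Finset.sum_congr rfl fun p hp => by rw [coeff_sum_smul_path _ hp]] at h3
  rw [h3, tmul_zero]

end Perp

end FreeMod

namespace FreeMod

variable {𝓛 : ℤ → Submodule K L} {π : PathAlg K V →ₐ[K] L}
  {N N' : Type u} [AddCommGroup N] [Module (V → K) N] [AddCommGroup N'] [Module (V → K) N']

variable (𝓛 π N) in
/-- The homogeneous components of `Y ⊗ Λ`, where `Y` is put in degree `d`. -/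
def deg (d i : ℤ) : AddSubgroup (FreeMod π N) :=
  AddSubgroup.closure {t | ∃ l ∈ 𝓛 (i - d), ∃ y, t = tmul π l y}

lemma tmul_mem {d i : ℤ} {l : L} (hl : l ∈ 𝓛 (i - d)) (y : N) : tmul π l y ∈ deg 𝓛 π N d i :=
  AddSubgroup.subset_closure ⟨l, hl, y, rfl⟩

lemma tmul_mem' {d i k : ℤ} (h : k + d = i) {l : L} (hl : l ∈ 𝓛 k) (y : N) :
    tmul π l y ∈ deg 𝓛 π N d i := tmul_mem (by rwa [← h, add_sub_cancel_right]) y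

lemma deg_induction {d i : ℤ} {P : FreeMod π N → Prop} {t : FreeMod π N}
    (ht : t ∈ deg 𝓛 π N d i) (zero : P 0) (tmul : ∀ l ∈ 𝓛 (i - d), ∀ y, P (tmul π l y))
    (add : ∀ s t, P s → P t → P (s + t)) : P t := by
  have : P t ∧ P (-t) := by
    induction ht using AddSubgroup.closure_induction with
    | zero => exact ⟨zero, by rwa [neg_zero]⟩
    | add a b _ _ ha hb => exact ⟨add _ _ ha.1 hb.1, by rw [neg_add]; exact add _ _ ha.2 hb.2⟩
    | neg a _ ha => exact ⟨ha.2, by rw [neg_neg]; exact ha.1⟩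
    | mem a ha =>
      obtain ⟨l, hl, y, rfl⟩ := ha
      refine ⟨tmul l hl y, ?_⟩
      rw [show -FreeMod.tmul π l y = FreeMod.tmul π (-l) y from
        (map_neg (AddMonoidHom.mk' (fun l => FreeMod.tmul π l y)
          fun l l' => add_tmul l l' y) l).symm]
      exact tmul _ (neg_mem hl) y
  exact this.1

variable [GradedAlgebra 𝓛]

lemma vertexHom_mul_mem (hπ : IsGradedFactor 𝓛 π) (r : V → K) {k : ℤ} {l : L} (hl : l ∈ 𝓛 k) :
    π (vertexHom r) * l ∈ 𝓛 k := by
  have := SetLike.GradedMul.mul_mem (A := 𝓛) (hπ.map_mem 0 _ (vertexSum_mem r)) hl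
  rwa [zero_add] at this

variable (𝓛 π N) in
/-- Auxiliary: the biadditive map that decomposes `y ⊗ l`. -/
def decomposeBil (d : ℤ) : L →+ N →+ ⨁ i, deg 𝓛 π N d i :=
  (DirectSum.toAddMonoid fun k => AddMonoidHom.mk' (fun l : 𝓛 k =>
    (DirectSum.of (fun i => deg 𝓛 π N d i) (k + d)).comp (AddMonoidHom.mk'
      (fun y => (⟨tmul π l.1 y, tmul_mem' rfl l.2 y⟩ : deg 𝓛 π N d (k + d)))
      fun y z => Subtype.ext (tmul_add _ y z)))
    fun l l' => AddMonoidHom.ext fun y => by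
      rw [AddMonoidHom.add_apply, AddMonoidHom.comp_apply, AddMonoidHom.comp_apply,
        AddMonoidHom.comp_apply, ← map_add]
      congr 1
      exact Subtype.ext (add_tmul _ _ y)).comp (decomposeAddEquiv 𝓛).toAddMonoidHom

lemma decomposeBil_of_mem {d k i : ℤ} (h : k + d = i) {l : L} (hl : l ∈ 𝓛 k) (y : N) :
    decomposeBil 𝓛 π N d l y =
      DirectSum.of (fun i => deg 𝓛 π N d i) i ⟨tmul π l y, tmul_mem' h hl y⟩ := by
  subst h
  change (DirectSum.toAddMonoid _ (decompose 𝓛 l) : N →+ _) y = _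
  rw [decompose_of_mem _ hl, DirectSum.toAddMonoid_of]
  rfl

variable (N) in
/-- Auxiliary: the map that decomposes an element of `Y ⊗ Λ`. -/
def decomposeHom (hπ : IsGradedFactor 𝓛 π) (d : ℤ) : FreeMod π N →+ ⨁ i, deg 𝓛 π N d i :=
  lift (decomposeBil 𝓛 π N d) fun r l y => by
    induction l using DirectSum.Decomposition.inductionOn 𝓛 with
    | zero => simp
    | add a b ha hb =>
      rw [mul_add, map_add, map_add, AddMonoidHom.add_apply, AddMonoidHom.add_apply, ha, hb]
    | homogeneous l =>
      rw [decomposeBil_of_mem rfl l.2, decomposeBil_of_mem rfl (vertexHom_mul_mem hπ r l.2)]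
      congr 1
      exact Subtype.ext (tmul_smul r _ y).symm

variable (N) in
/-- `Y ⊗ Λ` is the direct sum of its homogeneous components. -/
@[reducible]
def decomposition (hπ : IsGradedFactor 𝓛 π) (d : ℤ) : DirectSum.Decomposition (deg 𝓛 π N d) :=
  DirectSum.Decomposition.ofAddHom _ (decomposeHom N hπ d)
    (by
      refine AddMonoidHom.ext fun t => ?_
      induction t using FreeMod.induction with
      | zero => simp
      | add s t hs ht => rw [map_add, map_add, hs, ht]
      | tmul l y =>
        rw [AddMonoidHom.comp_apply]
        change DirectSum.coeAddMonoidHom _ (decomposeBil 𝓛 π N d l y) = tmul π l y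
        induction l using DirectSum.Decomposition.inductionOn 𝓛 with
        | zero => rw [map_zero, zero_tmul, AddMonoidHom.zero_apply, map_zero]
        | add a b ha hb =>
          rw [map_add, AddMonoidHom.add_apply, map_add, ha, hb, add_tmul]
        | homogeneous l =>
          rw [decomposeBil_of_mem rfl l.2, DirectSum.coeAddMonoidHom_of])
    (by
      refine DirectSum.addHom_ext' fun i => AddMonoidHom.ext ?_
      rintro ⟨t, ht⟩
      rw [AddMonoidHom.comp_apply, AddMonoidHom.comp_apply, DirectSum.coeAddMonoidHom_of]
      have key : ∃ ht' : t ∈ deg 𝓛 π N d i,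
          decomposeHom N hπ d t = DirectSum.of (fun i => deg 𝓛 π N d i) i ⟨t, ht'⟩ := by
        refine deg_induction (P := fun t => ∃ ht' : t ∈ deg 𝓛 π N d i,
          decomposeHom N hπ d t = DirectSum.of (fun i => deg 𝓛 π N d i) i ⟨t, ht'⟩) ht ?_ ?_ ?_
        · exact ⟨zero_mem _, (map_zero _).trans
            (map_zero (DirectSum.of (fun i => deg 𝓛 π N d i) i)).symm⟩
        · exact fun l hl y => ⟨tmul_mem hl y, decomposeBil_of_mem (sub_add_cancel _ _) hl y⟩
        · rintro s t ⟨hs, hs'⟩ ⟨ht, ht'⟩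
          refine ⟨add_mem hs ht, ?_⟩
          rw [map_add, hs', ht', ← map_add]
          rfl
      exact key.2)

lemma smul_mem_deg {d i j : ℤ} {t : FreeMod π N} {b : L} (ht : t ∈ deg 𝓛 π N d i) (hb : b ∈ 𝓛 j) :
    MulOpposite.op b • t ∈ deg 𝓛 π N d (i + j) := by
  refine deg_induction (P := fun t => MulOpposite.op b • t ∈ deg 𝓛 π N d (i + j)) ht
    (by rw [smul_zero]; exact zero_mem _) ?_
    (fun s t hs ht => by rw [smul_add]; exact add_mem hs ht)
  intro l hl y
  rw [smul_tmul]
  refine tmul_mem ?_ y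
  rw [show i + j - d = i - d + j by ring]
  exact SetLike.GradedMul.mul_mem hl hb

variable (N) in
/-- The graded `Λ`-module `Y ⊗ Λ`, where `Y` is put in degree `d`. -/
abbrev graded (hπ : IsGradedFactor 𝓛 π) (d : ℤ) : GrMod 𝓛 where
  carrier := FreeMod π N
  deg := deg 𝓛 π N d
  decomposition := decomposition N hπ d
  smul_mem := smul_mem_deg

variable {hπ : IsGradedFactor 𝓛 π} {d : ℤ} {M : GrMod 𝓛}

lemma one_tmul_mem (y : N) : tmul π 1 y ∈ (graded N hπ d).deg d :=
  tmul_mem' (zero_add d) (SetLike.GradedOne.one_mem (A := 𝓛)) y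

/-- The component of `Y ⊗ Λ` in the degree of `Y` is `Y`. -/
lemma exists_one_tmul [∀ i j : V, Finite (i ⟶ j)] {t : FreeMod π N}
    (ht : t ∈ (graded N hπ d).deg d) : ∃ y, t = tmul π 1 y := by
  refine deg_induction (P := fun t => ∃ y, t = tmul π 1 y) ht ⟨0, (tmul_zero _).symm⟩ ?_ ?_
  · intro l hl y
    rw [sub_self] at hl
    obtain ⟨x, hx, rfl⟩ := hπ.exists_of_mem hl
    obtain ⟨r, rfl⟩ := exists_vertexHom hx
    exact ⟨r • y, by rw [tmul_smul, mul_one]⟩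
  · rintro s t ⟨y, rfl⟩ ⟨z, rfl⟩
    exact ⟨y + z, (tmul_add _ _ _).symm⟩

/-- An element of `Y ⊗ Λ` of degree `k` above that of `Y` is a combination of the paths of length
`k`. -/
lemma exists_sum_paths [∀ i j : V, Finite (i ⟶ j)] [DecidableEq V] {k i : ℤ} (hi : k + d = i)
    {t : FreeMod π N} (ht : t ∈ (graded N hπ d).deg i) :
    ∃ y : QPath V → N, (∀ p, (Pi.single p.src 1 : V → K) • y p = y p) ∧
      t = ∑ p ∈ paths V k, tmul π (π (path p 1)) (y p) := by
  refine deg_induction (P := fun t => ∃ y : QPath V → N,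
    (∀ p, (Pi.single p.src 1 : V → K) • y p = y p) ∧
      t = ∑ p ∈ paths V k, tmul π (π (path p 1)) (y p)) ht ⟨0, by simp, by simp [tmul_zero]⟩ ?_ ?_
  · intro l hl y
    rw [← hi, add_sub_cancel_right] at hl
    obtain ⟨x, hx, rfl⟩ := hπ.exists_of_mem hl
    refine ⟨fun p => (Pi.single p.src (coeff x p) : V → K) • y, fun p => ?_, ?_⟩
    · rw [smul_smul, ← Pi.single_mul, one_mul]
    · conv_lhs => rw [← sum_coeff_smul_path hx, map_sum, sum_tmul]
      refine Finset.sum_congr rfl fun p _ => ?_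
      rw [tmul_path_single, map_smul]
  · rintro s t ⟨y, hy, rfl⟩ ⟨z, hz, rfl⟩
    refine ⟨y + z, fun p => by rw [Pi.add_apply, smul_add, hy, hz], ?_⟩
    rw [← Finset.sum_add_distrib]
    exact Finset.sum_congr rfl fun p _ => (tmul_add _ _ _).symm

/-- Auxiliary: the additive map underlying `FreeMod.desc`. -/
def descHom (φ : N →+ M.carrier)
    (hr : ∀ (r : V → K) y, φ (r • y) = MulOpposite.op (π (vertexHom r)) • φ y) :
    FreeMod π N →+ M.carrier :=
  lift (AddMonoidHom.mk' (fun l => AddMonoidHom.mk' (fun y => MulOpposite.op l • φ y)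
      (fun y z => by rw [map_add, smul_add])) fun l l' => AddMonoidHom.ext fun y => by
        change MulOpposite.op (l + l') • φ y = MulOpposite.op l • φ y + MulOpposite.op l' • φ y
        rw [MulOpposite.op_add, add_smul]) (fun r l y => by
      change MulOpposite.op (π (vertexHom r) * l) • φ y = MulOpposite.op l • φ (r • y)
      rw [hr, MulOpposite.op_mul, mul_smul])

omit [GradedAlgebra 𝓛] in
lemma descHom_tmul (φ : N →+ M.carrier)
    (hr : ∀ (r : V → K) y, φ (r • y) = MulOpposite.op (π (vertexHom r)) • φ y) (l : L) (y : N) :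
    descHom φ hr (tmul π l y) = MulOpposite.op l • φ y := rfl

/-- The morphism `Y ⊗ Λ → M` that extends a map from `Y` to the component of `M` in the degree
of `Y`. -/
def desc (φ : N →+ M.carrier) (hφ : ∀ y, φ y ∈ M.deg d)
    (hr : ∀ (r : V → K) y, φ (r • y) = MulOpposite.op (π (vertexHom r)) • φ y) :
    graded N hπ d ⟶ M where
  toLin :=
    { toFun := descHom φ hr
      map_add' := map_add _
      map_smul' := fun b t => by
        obtain ⟨b, rfl⟩ := MulOpposite.op_surjective b
        rw [RingHom.id_apply]
        refine FreeMod.induction (P := fun t => descHom φ hr (MulOpposite.op b • t) =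
          MulOpposite.op b • descHom φ hr t) t (by rw [smul_zero, map_zero, smul_zero])
          (fun l y => ?_) (fun s t hs ht => by rw [smul_add, map_add, map_add, hs, ht, smul_add])
        rw [smul_tmul, descHom_tmul, descHom_tmul, MulOpposite.op_mul, mul_smul] }
  map_mem := by
    intro i t ht
    refine deg_induction (P := fun t => descHom φ hr t ∈ M.deg i) ht
      (by rw [map_zero]; exact zero_mem _) ?_
      (fun s t hs ht => by rw [map_add]; exact add_mem hs ht)
    intro l hl y
    have := M.smul_mem (hφ y) hl
    rwa [add_sub_cancel] at this

lemma desc_tmul (φ : N →+ M.carrier) (hφ : ∀ y, φ y ∈ M.deg d)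
    (hr : ∀ (r : V → K) y, φ (r • y) = MulOpposite.op (π (vertexHom r)) • φ y) (l : L) (y : N) :
    (desc (hπ := hπ) φ hφ hr).toLin (tmul π l y) = MulOpposite.op l • φ y := rfl

lemma hom_tmul (f : graded N hπ d ⟶ M) (l : L) (y : N) :
    f.toLin (tmul π l y) = MulOpposite.op l • f.toLin (tmul π 1 y) := by
  rw [← f.toLin.map_smul]
  congr 1
  exact ((smul_tmul _ _ _).trans (by rw [one_mul])).symm

lemma hom_ext {f g : graded N hπ d ⟶ M}
    (h : ∀ y, f.toLin (tmul π 1 y) = g.toLin (tmul π 1 y)) : f = g := by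
  refine GrMod.hom_ext (LinearMap.ext fun t => ?_)
  refine FreeMod.induction t (by rw [map_zero, map_zero])
    (fun l y => by rw [hom_tmul, h, ← hom_tmul]) (fun s t hs ht => ?_)
  refine (map_add f.toLin s t).trans ?_
  rw [hs, ht]
  exact (map_add g.toLin s t).symm

/-- The morphism `Y ⊗ Λ → Y' ⊗ Λ` induced by a map `Y → Y'`. -/
def mapHom (g : N →ₗ[V → K] N') : graded N hπ d ⟶ graded N' hπ d :=
  desc (((tmulHom π 1 : N' →+ FreeMod π N')).comp g.toAddMonoidHom) (fun y => one_tmul_mem (g y))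
    fun r y => by
      change tmul π 1 (g (r • y)) = MulOpposite.op (π (vertexHom r)) • tmul π 1 (g y)
      rw [g.map_smul, smul_tmul, tmul_smul, one_mul, mul_one]

lemma mapHom_tmul (g : N →ₗ[V → K] N') (l : L) (y : N) :
    (mapHom (hπ := hπ) (d := d) g).toLin (tmul π l y) = tmul π l (g y) := by
  change MulOpposite.op l • tmul π 1 (g y) = _
  rw [smul_tmul, one_mul]

lemma mapHom_id : mapHom (hπ := hπ) (d := d) (LinearMap.id : N →ₗ[V → K] N) = 𝟙 _ :=
  hom_ext fun y => mapHom_tmul _ 1 y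

lemma mapHom_comp {N'' : Type u} [AddCommGroup N''] [Module (V → K) N''] (g : N →ₗ[V → K] N')
    (g' : N' →ₗ[V → K] N'') :
    mapHom (hπ := hπ) (d := d) (g' ∘ₗ g) = mapHom g ≫ mapHom g' := hom_ext fun y => by
  refine (mapHom_tmul _ 1 y).trans ?_
  refine Eq.trans ?_ (congrArg (mapHom g').toLin (mapHom_tmul g 1 y)).symm
  exact (mapHom_tmul g' 1 (g y)).symm

lemma mapHom_injective {n : ℕ} (hrel : HasRelationsOfDegreeGE n π) (hn : 0 < n)
    {g g' : N →ₗ[V → K] N'} (h : mapHom (hπ := hπ) (d := d) g = mapHom g') : g = g' :=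
  LinearMap.ext fun y => tmul_one_injective hπ hrel hn (by
    rw [← mapHom_tmul (hπ := hπ) (d := d), ← mapHom_tmul (hπ := hπ) (d := d), h])

/-- Morphisms between the modules `Y ⊗ Λ` generated in a given degree come from maps between
the modules `Y`. -/
lemma exists_mapHom [∀ i j : V, Finite (i ⟶ j)] {n : ℕ} (hrel : HasRelationsOfDegreeGE n π)
    (hn : 0 < n) (f : graded N hπ d ⟶ graded N' hπ d) : ∃ g : N →ₗ[V → K] N', f = mapHom g := by
  have hinj := tmul_one_injective (N := N') hπ hrel hn
  choose g hg using fun y : N => exists_one_tmul (f.map_mem (one_tmul_mem y))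
  refine ⟨⟨⟨g, fun y z => hinj ?_⟩, fun r y => hinj ?_⟩, hom_ext fun y => ?_⟩
  · rw [tmul_add, ← hg, ← hg, ← hg, tmul_add]
    exact map_add f.toLin _ _
  · rw [← hg, tmul_smul, RingHom.id_apply, tmul_smul, mul_one, hom_tmul, hg, smul_tmul, one_mul]
  · rw [mapHom_tmul]
    exact hg y

lemma generatedIn : (graded N hπ d).GeneratedIn {d} := by
  intro S _ hS
  refine ⟨d, rfl, fun hle => hS (eq_top_iff.2 fun t _ => ?_)⟩
  refine FreeMod.induction (P := fun t => t ∈ S) t S.zero_mem (fun l y => ?_)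
    (fun s t hs ht => S.add_mem hs ht)
  have h : tmul π l y = MulOpposite.op l • tmul π 1 y := by rw [smul_tmul, one_mul]
  rw [h]
  exact S.smul_mem _ (hle (one_tmul_mem y))

end FreeMod

namespace GrMod

variable {π : PathAlg K V →ₐ[K] L} {𝓛 : ℤ → Submodule K L}

/-- A homogeneous component of a graded `Λ`-module, as a module over `KQ₀`. -/
def Comp (_ : IsGradedFactor 𝓛 π) (M : GrMod 𝓛) (d : ℤ) : Type u := M.deg d

variable (hπ : IsGradedFactor 𝓛 π) (M : GrMod 𝓛) (d : ℤ)

instance : AddCommGroup (Comp hπ M d) := inferInstanceAs (AddCommGroup (M.deg d))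

instance : Module (V → K) (Comp hπ M d) where
  smul r x := ⟨MulOpposite.op (π (vertexHom r)) • x.1, by
    have := M.smul_mem x.2 (hπ.map_mem 0 _ (vertexSum_mem r))
    rwa [add_zero] at this⟩
  one_smul x := Subtype.ext (by
    change MulOpposite.op (π (vertexHom 1)) • x.1 = x.1
    rw [map_one, map_one, MulOpposite.op_one, one_smul])
  mul_smul r s x := Subtype.ext (by
    change MulOpposite.op (π (vertexHom (r * s))) • x.1 =
      MulOpposite.op (π (vertexHom r)) • MulOpposite.op (π (vertexHom s)) • x.1
    rw [mul_comm, map_mul, map_mul, MulOpposite.op_mul, mul_smul])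
  smul_zero r := Subtype.ext (smul_zero _)
  smul_add r x y := Subtype.ext (smul_add _ _ _)
  add_smul r s x := Subtype.ext (by
    change MulOpposite.op (π (vertexHom (r + s))) • x.1 =
      MulOpposite.op (π (vertexHom r)) • x.1 + MulOpposite.op (π (vertexHom s)) • x.1
    rw [map_add, map_add, MulOpposite.op_add, add_smul])
  zero_smul x := Subtype.ext (by
    change MulOpposite.op (π (vertexHom 0)) • x.1 = 0
    rw [map_zero, map_zero, MulOpposite.op_zero, zero_smul])

variable {hπ M d} in
/-- An element of `M_d`. -/
def Comp.mk (x : M.carrier) (hx : x ∈ M.deg d) : Comp hπ M d := ⟨x, hx⟩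

variable {hπ M d} in
/-- The inclusion `M_d → M`. -/
def Comp.val : Comp hπ M d →+ M.carrier := (M.deg d).subtype

variable {hπ M d} in
lemma Comp.val_mk (x : M.carrier) (hx : x ∈ M.deg d) : (Comp.mk x hx : Comp hπ M d).val = x := rfl

variable {hπ M d} in
lemma Comp.val_mem (x : Comp hπ M d) : x.val ∈ M.deg d := x.2

variable {hπ M d} in
lemma Comp.ext {x y : Comp hπ M d} (h : x.val = y.val) : x = y := Subtype.ext h

variable {hπ M d} in
lemma Comp.val_smul (r : V → K) (x : Comp hπ M d) :
    (r • x).val = MulOpposite.op (π (vertexHom r)) • x.val := rfl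

variable [GradedAlgebra 𝓛]

/-- The multiplication map `M_d ⊗ Λ → M`. -/
def mulMap : FreeMod.graded (Comp hπ M d) hπ d ⟶ M :=
  FreeMod.desc Comp.val Comp.val_mem Comp.val_smul

lemma mulMap_tmul (l : L) (y : Comp hπ M d) :
    (mulMap hπ M d).toLin (FreeMod.tmul π l y) = MulOpposite.op l • y.val := rfl

variable {hπ M d}

/-- The graded module `Y ⊗ Λ` is projective, because `KQ₀` is semisimple. -/
lemma projective_graded (N : Type u) [AddCommGroup N] [Module (V → K) N] (d : ℤ) :
    Projective (FreeMod.graded N hπ d) where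
  factors {E X} f e _ := by
    have he := surjective_of_epi e
    let e' : Comp hπ E d →ₗ[V → K] Comp hπ X d :=
      { toFun := fun x => Comp.mk (e.toLin x.val) (e.map_mem x.val_mem)
        map_add' := fun x y => Comp.ext (map_add e.toLin _ _)
        map_smul' := fun r x => Comp.ext (e.toLin.map_smul _ _) }
    have he' : Function.Surjective e' := by
      rintro ⟨x, hx⟩
      obtain ⟨y, rfl⟩ := he x
      refine ⟨Comp.mk _ (decompose E.deg y d).2, Comp.ext ?_⟩
      change e.toLin (decompose E.deg y d : E.carrier) = e.toLin y
      rw [← decompose_map, decompose_of_mem_same _ hx]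
    let f' : N →ₗ[V → K] Comp hπ X d :=
      { toFun := fun y => Comp.mk (f.toLin (FreeMod.tmul π 1 y))
          (f.map_mem (FreeMod.one_tmul_mem y))
        map_add' := fun y z => Comp.ext (by
          rw [map_add, Comp.val_mk, Comp.val_mk, Comp.val_mk, FreeMod.tmul_add, map_add])
        map_smul' := fun r y => Comp.ext (by
          rw [RingHom.id_apply, Comp.val_smul, Comp.val_mk, Comp.val_mk, FreeMod.tmul_smul, mul_one,
            FreeMod.hom_tmul]) }
    have : Module.Projective (V → K) N := Module.projective_of_isSemisimpleRing _ _
    obtain ⟨g, hg⟩ := Module.projective_lifting_property e' f' he'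
    refine ⟨FreeMod.desc (Comp.val.comp g.toAddMonoidHom) (fun y => (g y).val_mem) (fun r y => by
      change (g (r • y)).val = _
      rw [map_smul]
      rfl), FreeMod.hom_ext fun y => ?_⟩
    refine (congrArg e.toLin (FreeMod.desc_tmul _ _ _ 1 y)).trans ?_
    rw [MulOpposite.op_one, one_smul]
    exact congrArg Comp.val (LinearMap.congr_fun hg y)

/-- A projective graded module generated in one degree is free on its component in that degree: a
section of the multiplication map is surjective, because it is so in the generating degree. -/
lemma mulMap_bijective [∀ i j : V, Finite (i ⟶ j)] (hP : Projective M)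
    (hd : M.GeneratedIn {d}) : Function.Bijective (mulMap hπ M d).toLin := by
  have hsurj : Function.Surjective (mulMap hπ M d).toLin := by
    refine surjective_of_generatedIn hd _ ?_
    rintro _ rfl x hx
    exact ⟨FreeMod.tmul π 1 (Comp.mk x hx), by
      rw [mulMap_tmul, MulOpposite.op_one, one_smul, Comp.val_mk]⟩
  refine ⟨?_, hsurj⟩
  have := epi_of_surjective _ hsurj
  obtain ⟨s, hs⟩ := hP.factors (𝟙 M) (mulMap hπ M d)
  have h : mulMap hπ M d ≫ s = 𝟙 _ := FreeMod.hom_ext fun y => by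
    rw [comp_toLin, LinearMap.comp_apply, mulMap_tmul, MulOpposite.op_one, one_smul]
    obtain ⟨z, hz⟩ := FreeMod.exists_one_tmul (s.map_mem y.val_mem)
    have h1 : (mulMap hπ M d).toLin (s.toLin y.val) = y.val :=
      LinearMap.congr_fun (congrArg Hom.toLin hs) y.val
    rw [hz, mulMap_tmul, MulOpposite.op_one, one_smul] at h1
    rw [hz, Comp.ext h1]
    rfl
  intro x y hxy
  have hx : s.toLin ((mulMap hπ M d).toLin x) = x :=
    LinearMap.congr_fun (congrArg Hom.toLin h) x
  have hy : s.toLin ((mulMap hπ M d).toLin y) = y :=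
    LinearMap.congr_fun (congrArg Hom.toLin h) y
  rw [← hx, hxy, hy]

section Radical

variable [∀ i j : V, Finite (i ⟶ j)] {N : Type u} [AddCommGroup N] [Module (V → K) N]

/-- The radical of `Y ⊗ Λ` meets `Y` in zero. -/
lemma eq_zero_of_mem_mulRadical {n : ℕ} (hrel : HasRelationsOfDegreeGE n π) (hn : 0 < n) {y : N}
    (hy : FreeMod.tmul π 1 y ∈ (FreeMod.graded N hπ d).mulRadical) : y = 0 := by
  obtain ⟨ε, h1, h0⟩ := FreeMod.exists_counit hπ hrel hn N
  have h0' : ∀ k : ℤ, 0 < k → ∀ l ∈ 𝓛 k, ∀ y, ε (FreeMod.tmul π l y) = 0 := by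
    intro k hk l hl y
    obtain ⟨x, hx, rfl⟩ := hπ.exists_of_mem hl
    exact h0 x (fun i => coeff_of_mem hx hk.ne) y
  have h2 : ∀ b ∈ gradedRadical 𝓛, ∀ t : FreeMod π N, ε (MulOpposite.op b • t) = 0 := by
    intro b hb t
    refine Submodule.iSup_induction (fun i : {i : ℤ // 0 < i} => 𝓛 i.1)
      (motive := fun b => ε (MulOpposite.op b • t) = 0) hb ?_ ?_ ?_
    · rintro ⟨k, hk⟩ b hb
      induction t using FreeMod.induction with
      | zero => rw [smul_zero, map_zero]
      | add s t hs ht => rw [smul_add, map_add, hs, ht, add_zero]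
      | tmul l y =>
        rw [FreeMod.smul_tmul]
        induction l using DirectSum.Decomposition.inductionOn 𝓛 with
        | zero => rw [zero_mul, FreeMod.zero_tmul, map_zero]
        | add a a' ha ha' => rw [add_mul, FreeMod.add_tmul, map_add, ha, ha', add_zero]
        | @homogeneous j l =>
          rcases lt_or_ge j 0 with hj | hj
          · obtain ⟨x, hx, hxl⟩ := hπ.exists_of_mem l.2
            rw [← hxl, pathDeg_eq_zero hj hx, map_zero, zero_mul, FreeMod.zero_tmul, map_zero]
          · exact h0' (j + k) (by omega) _ (SetLike.GradedMul.mul_mem l.2 hb) y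
    · rw [MulOpposite.op_zero, zero_smul, map_zero]
    · intro a b ha hb
      rw [MulOpposite.op_add, add_smul, map_add, ha, hb, add_zero]
  have h3 : ∀ t ∈ (FreeMod.graded N hπ d).mulRadical, ε t = 0 := by
    intro t ht
    induction ht using AddSubgroup.closure_induction with
    | zero => exact map_zero ε
    | add a b _ _ ha hb => exact (map_add ε a b).trans (by rw [ha, hb, add_zero])
    | neg a _ ha => exact (map_neg ε a).trans (by rw [ha, neg_zero])
    | mem a ha =>
      obtain ⟨x, b, hb, rfl⟩ := ha
      exact h2 b hb x
  rw [← h1 y, h3 _ hy]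

/-- An element of `Y ⊗ Λ` whose component in the degree of `Y` is zero belongs to the radical. -/
lemma mem_mulRadical {t : FreeMod π N}
    (ht : (FreeMod.graded N hπ d).part d t = 0) :
    t ∈ (FreeMod.graded N hπ d).mulRadical := by
  refine mem_of_part_mem (M := FreeMod.graded N hπ d) _ fun i => ?_
  by_cases hi : i = d
  · subst hi
    rw [ht]
    exact zero_mem _
  · refine FreeMod.deg_induction (P := fun t => t ∈ (FreeMod.graded N hπ d).mulRadical)
      (part_mem (FreeMod.graded N hπ d) i t) (zero_mem _) ?_ fun s t hs ht => add_mem hs ht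
    intro l hl y
    rcases lt_or_ge (i - d) 0 with hj | hj
    · obtain ⟨x, hx, hxl⟩ := hπ.exists_of_mem hl
      rw [← hxl, pathDeg_eq_zero hj hx, map_zero, FreeMod.zero_tmul]
      exact zero_mem _
    · refine AddSubgroup.subset_closure ⟨FreeMod.tmul π 1 y, l, ?_, ?_⟩
      · exact Submodule.mem_iSup_of_mem (p := fun i : {i : ℤ // 0 < i} => 𝓛 i.1)
          ⟨i - d, by omega⟩ hl
      · rw [FreeMod.smul_tmul, one_mul]

end Radical

end GrMod

end Free

/-! ### Graded left modules over the path algebra and their linear complexes -/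

/-- A family of homogeneous components in a left `KQ`-module. The components need not be
independent, because only the components themselves enter into the constructions below. Left
`KQ`-modules are the same as right `KQᵒᵖ`-modules. -/
structure PathRep (K V : Type u) [Field K] [Quiver.{u} V] [Fintype V] where
  carrier : Type u
  [addCommGroup : AddCommGroup carrier]
  [module : Module (PathAlg K V) carrier]
  deg : ℤ → AddSubgroup carrier
  smul_mem : ∀ {i k : ℤ} {p : PathAlg K V} {x : carrier}, p ∈ pathDeg K V k → x ∈ deg i →
    p • x ∈ deg (i + k)

namespace PathRep

attribute [instance] PathRep.addCommGroup PathRep.module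

section

variable {K V : Type u} [Field K] [Quiver.{u} V] [Fintype V] (Y : PathRep K V)

lemma smul_mem' {i j k : ℤ} (h : i + k = j) {p : PathAlg K V} {x : Y.carrier}
    (hp : p ∈ pathDeg K V k) (hx : x ∈ Y.deg i) : p • x ∈ Y.deg j := h ▸ Y.smul_mem hp hx

/-- The components are modules over `KQ₀`. -/
instance compModule (i : ℤ) : Module (V → K) (Y.deg i) where
  smul r x := ⟨vertexHom r • x.1, Y.smul_mem' (add_zero i) (vertexSum_mem r) x.2⟩
  one_smul x := Subtype.ext (by
    change vertexHom 1 • x.1 = x.1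
    rw [map_one, one_smul])
  mul_smul r s x := Subtype.ext (by
    change vertexHom (r * s) • x.1 = vertexHom r • vertexHom s • x.1
    rw [map_mul, mul_smul])
  smul_zero r := Subtype.ext (smul_zero _)
  smul_add r x y := Subtype.ext (smul_add _ _ _)
  add_smul r s x := Subtype.ext (by
    change vertexHom (r + s) • x.1 = vertexHom r • x.1 + vertexHom s • x.1
    rw [map_add, add_smul])
  zero_smul x := Subtype.ext (by
    change vertexHom 0 • x.1 = 0
    rw [map_zero, zero_smul])

variable {Y}

lemma smul_val {i : ℤ} (r : V → K) (x : Y.deg i) : (r • x).1 = vertexHom r • x.1 := rfl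

variable [∀ i j : V, Finite (i ⟶ j)]

/-- The action `Y_i → Y_j` of the component of degree `j - i` of an element of the path algebra. -/
def move {i : ℤ} (j : ℤ) (p : PathAlg K V) : Y.deg i →+ Y.deg j :=
  AddMonoidHom.mk' (fun x => ⟨component (j - i) p • x.1,
    Y.smul_mem' (add_sub_cancel i j) (component_mem _ _) x.2⟩)
    fun _ _ => Subtype.ext (smul_add _ _ _)

lemma move_val {i j k : ℤ} (h : i + k = j) {p : PathAlg K V} (hp : p ∈ pathDeg K V k)
    (x : Y.deg i) : (move j p x).1 = p • x.1 := by
  obtain rfl : k = j - i := by omega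
  exact congrArg (· • x.1) (component_of_mem hp)

lemma move_path_val {i j k : ℤ} (h : i + k = j) {p : QPath V} (hp : p ∈ paths V k)
    (x : Y.deg i) : (move j (path p 1) x).1 = (path p 1 : PathAlg K V) • x.1 :=
  move_val h (path_mem' p (mem_paths.1 hp)) x

lemma move_component {i j : ℤ} (p : PathAlg K V) (x : Y.deg i) :
    move j (component (j - i) p) x = move j p x :=
  Subtype.ext (move_val (add_sub_cancel i j) (component_mem _ _) x)

lemma zero_move {i j : ℤ} (x : Y.deg i) : move j (0 : PathAlg K V) x = 0 := Subtype.ext (by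
  change component _ 0 • x.1 = 0
  rw [map_zero, zero_smul])

lemma add_move {i j : ℤ} (p q : PathAlg K V) (x : Y.deg i) :
    move j (p + q) x = move j p x + move j q x := Subtype.ext (by
  change component _ (p + q) • x.1 = component _ p • x.1 + component _ q • x.1
  rw [map_add, add_smul])

lemma smul_move {i j : ℤ} (c : K) (p : PathAlg K V) (x : Y.deg i) :
    move j (c • p) x = (fun _ => c : V → K) • move j p x := Subtype.ext (by
  change component _ (c • p) • x.1 = vertexHom _ • component _ p • x.1
  rw [map_smul, smul_smul, vertexHom_const, ← Algebra.smul_def])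

lemma move_mul {i j l : ℤ} {p q : PathAlg K V} (hp : p ∈ pathDeg K V (l - j))
    (hq : q ∈ pathDeg K V (j - i)) (x : Y.deg i) :
    move l (p * q) x = move l p (move j q x) := Subtype.ext (by
  rw [move_val (k := l - i) (by ring) (mul_mem_pathDeg' (by ring) hp hq),
    move_val (by ring) hp, move_val (by ring) hq, mul_smul])

lemma move_vertexHom {i : ℤ} (r : V → K) (x : Y.deg i) : move i (vertexHom r) x = r • x :=
  Subtype.ext (move_val (add_zero i) (vertexSum_mem r) x)

lemma single_smul_move [DecidableEq V] {i j k : ℤ} (h : i + k = j) {p : QPath V}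
    (hp : p ∈ paths V k) (x : Y.deg i) :
    (Pi.single p.src 1 : V → K) • move j (path p 1) x = move j (path p 1) x := Subtype.ext (by
  rw [smul_val, move_path_val h hp, smul_smul, vertexHom_mul_path, Pi.single_eq_same, one_smul])

/-- An element killed by all paths of length `k` is killed by `KQ_k`. -/
lemma smul_eq_zero_of_paths {M : Type*} [AddCommGroup M] [Module (PathAlg K V) M] {k : ℤ} {x : M}
    (h : ∀ p ∈ paths V k, (path p 1 : PathAlg K V) • x = 0) {p : PathAlg K V}
    (hp : p ∈ pathDeg K V k) : p • x = 0 := by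
  rw [← sum_coeff_smul_path hp, Finset.sum_smul]
  refine Finset.sum_eq_zero fun q hq => ?_
  rw [Algebra.smul_def, mul_smul, h q hq, smul_zero]

end

variable {K V L : Type u} [Field K] [Quiver.{u} V] [Fintype V] [Ring L] [Algebra K L]
  [∀ i j : V, Finite (i ⟶ j)] {𝓛 : ℤ → Submodule K L} [GradedAlgebra 𝓛]
  {π : PathAlg K V →ₐ[K] L} (hπ : IsGradedFactor 𝓛 π) (Y : PathRep K V)

/-- The module `Y_k ⊗ Λ`, generated in degree `-k`. -/
abbrev obj (k : ℤ) : GrMod 𝓛 := FreeMod.graded (Y.deg k) hπ (-k)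

/-- The differential `Y_k ⊗ Λ → Y_{k+1} ⊗ Λ`, given by `y ↦ ∑ a y ⊗ a`, where `a` runs through the
arrows. -/
def diff (k : ℤ) : Y.obj hπ k ⟶ Y.obj hπ (k + 1) :=
  FreeMod.desc (∑ p ∈ paths V 1, (FreeMod.tmulHom π (π (path p 1))).comp (move (k + 1) (path p 1)))
    (fun y => by
      rw [AddMonoidHom.finsetSum_apply]
      refine sum_mem fun p hp => ?_
      exact FreeMod.tmul_mem' (by ring) (hπ.map_mem _ _ (path_mem' p (mem_paths.1 hp))) _)
    (fun r y => by
      rw [AddMonoidHom.finsetSum_apply, AddMonoidHom.finsetSum_apply]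
      refine Eq.trans ?_ Finset.smul_sum.symm
      refine Finset.sum_congr rfl fun p hp => ?_
      change FreeMod.tmul π (π (path p 1)) (move (k + 1) (path p 1) (r • y)) =
        MulOpposite.op (π (vertexHom r)) •
          FreeMod.tmul π (π (path p 1)) (move (k + 1) (path p 1) y)
      rw [FreeMod.smul_tmul, ← map_mul, path_mul_vertexHom, map_smul π, ← FreeMod.tmul_const_smul]
      congr 1
      refine Subtype.ext ?_
      rw [smul_val, move_path_val rfl hp, move_path_val rfl hp, smul_val, smul_smul, smul_smul,
        path_mul_vertexHom, vertexHom_const, ← Algebra.smul_def])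

lemma diff_tmul_one (k : ℤ) (y : Y.deg k) :
    (Y.diff hπ k).toLin (FreeMod.tmul π 1 y) =
      ∑ p ∈ paths V 1, FreeMod.tmul π (π (path p 1)) (move (k + 1) (path p 1) y) := by
  refine (FreeMod.desc_tmul _ _ _ 1 y).trans ?_
  rw [MulOpposite.op_one, one_smul, AddMonoidHom.finsetSum_apply]
  rfl

/-- A composite of `r` differentials is given by `y ↦ ∑ p y ⊗ p`, where `p` runs through the paths
of length `r`. -/
lemma iterD_tmul_one (r : ℕ) (hr : r ≠ 0) {i j : ℤ} (h : i + r = j) (y : Y.deg i) :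
    (iterD (X := Y.obj hπ) (Y.diff hπ) r i j h).toLin (FreeMod.tmul π 1 y) =
      ∑ p ∈ paths V r, FreeMod.tmul π (π (path p 1)) (move j (path p 1) y) := by
  obtain ⟨r, rfl⟩ := Nat.exists_eq_succ_of_ne_zero hr
  induction r generalizing i with
  | zero =>
    subst h
    have : iterD (X := Y.obj hπ) (Y.diff hπ) 1 i (i + (1 : ℕ)) rfl = Y.diff hπ i := by
      simp [iterD]
    exact (LinearMap.congr_fun (congrArg GrMod.Hom.toLin this) _).trans (Y.diff_tmul_one hπ i y)
  | succ r ih =>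
    have h' : i + 1 + ((r + 1 : ℕ) : ℤ) = j := by
      rw [← h]
      push_cast
      ring
    change (iterD (X := Y.obj hπ) (Y.diff hπ) (r + 1) (i + 1) j h').toLin
      ((Y.diff hπ i).toLin (FreeMod.tmul π 1 y)) = _
    rw [diff_tmul_one, map_sum]
    have h1 : ∀ a ∈ paths V 1, (iterD (X := Y.obj hπ) (Y.diff hπ) (r + 1) (i + 1) j h').toLin
        (FreeMod.tmul π (π (path a 1)) (move (i + 1) (path a 1) y)) =
        ∑ p ∈ paths V (r + 1 : ℕ), FreeMod.tmul π (π (path p 1) * π (path a 1))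
          (move j (path p 1) (move (i + 1) (path a 1) y)) := by
      intro a _
      rw [FreeMod.hom_tmul, ih _ (Nat.succ_ne_zero r) h']
      refine Finset.smul_sum.trans (Finset.sum_congr rfl fun p _ => ?_)
      exact FreeMod.smul_tmul _ _ _
    rw [Finset.sum_congr rfl h1, Finset.sum_comm]
    have key : ∀ p ∈ paths V (r + 1 : ℕ), ∀ a ∈ paths V 1,
        FreeMod.tmul π (π (path p 1) * π (path a 1))
          (move j (path p 1) (move (i + 1) (path a 1) y)) =
        FreeMod.tmul π (π (path p 1 * path a 1)) (move j (path p 1 * path a 1) y) := by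
      intro p hp a ha
      rw [map_mul]
      congr 1
      refine Subtype.ext ?_
      have hpa : (path p 1 : PathAlg K V) * path a 1 ∈ pathDeg K V ((r + 1 : ℕ) + 1) :=
        mul_mem_pathDeg (path_mem' p (mem_paths.1 hp)) (path_mem' a (mem_paths.1 ha))
      rw [move_path_val h' hp, move_path_val rfl ha, move_val (by rw [← h']; ring) hpa, mul_smul]
    rw [Finset.sum_congr rfl fun p hp => Finset.sum_congr rfl fun a ha => key p hp a ha]
    refine sum_paths_concat (k := (r + 1 : ℕ)) (l := 1) (by positivity) (by norm_num)
      (by push_cast; ring)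
      (fun p a => FreeMod.tmul π (π (path p 1 * path a 1)) (move j (path p 1 * path a 1) y))
      (fun p => FreeMod.tmul π (π (path p 1)) (move j (path p 1) y)) ?_ ?_
    · intro p a hpa
      rw [path_mul_path, pathMul_of_eq hpa]
    · intro p a hpa
      rw [path_mul_path, pathMul_of_ne hpa, map_zero, FreeMod.zero_tmul]

lemma sum_coeff_smul_move {i j : ℤ} {k : ℤ} (h : i + k = j) {x : PathAlg K V}
    (hx : x ∈ pathDeg K V k) (y : Y.deg i) :
    (∑ p ∈ paths V k, (fun _ => coeff x p : V → K) • move j (path p 1) y).1 = x • y.1 := by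
  rw [AddSubgroup.val_finsetSum]
  conv_rhs => rw [← sum_coeff_smul_path hx, Finset.sum_smul]
  refine Finset.sum_congr rfl fun p hp => ?_
  rw [smul_val, move_path_val h hp, vertexHom_const, smul_smul, ← Algebra.smul_def]

/-- If `Y` is a module over `Λ^!`, then the composites of `n` differentials vanish. -/
lemma iterD_eq_zero {n : ℕ} (hn : n ≠ 0)
    (hY : ∀ x ∈ perp n π, ∀ y : Y.carrier, x • y = 0) {i j : ℤ} (h : i + n = j) :
    iterD (X := Y.obj hπ) (Y.diff hπ) n i j h = 0 := by
  refine FreeMod.hom_ext fun y => ?_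
  rw [iterD_tmul_one hπ Y n hn h]
  refine FreeMod.sum_tmul_path_eq_zero (n := n) _ fun x hx => Subtype.ext ?_
  rw [sum_coeff_smul_move Y h hx.1, hY x hx]
  rfl

/-- If the composites of `n` differentials vanish, then `I_n^⊥` acts as zero. -/
lemma smul_eq_zero_of_iterD {n : ℕ} (hn : n ≠ 0) {i j : ℤ} (h : i + n = j)
    (h0 : iterD (X := Y.obj hπ) (Y.diff hπ) n i j h = 0) {x : PathAlg K V} (hx : x ∈ perp n π)
    (y : Y.deg i) : x • y.1 = 0 := by
  classical
  have h1 := iterD_tmul_one hπ Y n hn h y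
  rw [h0] at h1
  have h2 := FreeMod.sum_coeff_smul_eq_zero hπ (n := n) (fun p => move j (path p 1) y)
    (fun p hp => single_smul_move h hp y) h1.symm hx
  rw [← sum_coeff_smul_move Y h hx.1, h2]
  rfl

/-- The linear `n`-complex of a graded `Λ^!`-module. -/
def complex {n : ℕ} (hn : n ≠ 0) (hY : ∀ x ∈ perp n π, ∀ y : Y.carrier, x • y = 0) :
    LinearNComplex 𝓛 n where
  X := Y.obj hπ
  d := Y.diff hπ
  d_iter _ := iterD_eq_zero hπ Y hn hY rfl
  projective k := GrMod.projective_graded (hπ := hπ) (Y.deg k) (-k)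
  generated _ := FreeMod.generatedIn

end PathRep

/-! ### Degrees of the components of the contracted complex -/

/-- The degree `-δ_m(-j)` of the component that gives the `j`-th term of the contraction. -/
abbrev idx (n : ℕ) (m j : ℤ) : ℤ := -delta n m (-j)

/-- The set `-S`. -/
def suppDeg (n : ℕ) (m : ℤ) : Set ℤ := {i | -i - m ∈ suppSet n}

lemma idx_mem (n : ℕ) (m j : ℤ) : idx n m j ∈ suppDeg n m := by
  change - -delta n m (-j) - m ∈ suppSet n
  rw [delta]
  rcases Int.emod_two_eq_zero_or_one (-j) with h | h
  · exact Or.inl ⟨-j / 2, by rw [h]; ring⟩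
  · exact Or.inr ⟨-j / 2, by rw [h]; ring⟩

lemma exists_idx {n : ℕ} {m i : ℤ} (hi : i ∈ suppDeg n m) : ∃ j, idx n m j = i := by
  rcases hi with ⟨c, hc⟩ | ⟨c, hc⟩
  · refine ⟨-(2 * c), ?_⟩
    rw [idx, delta, neg_neg, show 2 * c / 2 = c by omega, show 2 * c % 2 = 0 by omega]
    linarith
  · refine ⟨-(2 * c + 1), ?_⟩
    rw [idx, delta, neg_neg, show (2 * c + 1) / 2 = c by omega, show (2 * c + 1) % 2 = 1 by omega]
    linarith

lemma idx_add_step {n : ℕ} (hn : 2 ≤ n) (m j : ℤ) : idx n m j + step n j = idx n m (j + 1) :=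
  neg_delta_add_step hn m j

lemma step_pos {n : ℕ} (hn : 2 ≤ n) (j : ℤ) : 0 < step n j := by
  unfold step
  split_ifs <;> omega

lemma step_lt {n : ℕ} (hn : 2 ≤ n) (j : ℤ) : step n j < n := by
  unfold step
  split_ifs <;> omega

lemma idx_strictMono {n : ℕ} (hn : 2 ≤ n) (m : ℤ) : StrictMono (idx n m) :=
  strictMono_int_of_lt_succ fun j => by
    have := idx_add_step hn m j
    have := step_pos hn j
    omega

lemma idx_odd (n : ℕ) (m k : ℤ) : idx n m (2 * k - 1) = -m + k * n - 1 := by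
  rw [idx, delta, show -(2 * k - 1) / 2 = -k by omega, show -(2 * k - 1) % 2 = 1 by omega]
  ring

/-! ### The category of linear representations -/

section LinRep

variable {K V L : Type u} [Field K] [Quiver.{u} V] [Fintype V] [Ring L] [Algebra K L]

/-- Graded modules over `Λ^!`, written as left `KQ`-modules annihilated by `I_n^⊥`, such that for
`n > 2` no nonzero element of a degree in `-m - 1 + nℤ` is killed by all arrows. -/
structure LinRep (n : ℕ) (π : PathAlg K V →ₐ[K] L) (m : ℤ) extends PathRep K V where
  perp_smul : ∀ x ∈ perp n π, ∀ y : carrier, x • y = 0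
  torsion_free : 2 < n → ∀ i, (n : ℤ) ∣ i + m + 1 → ∀ y ∈ deg i,
    (∀ p ∈ pathDeg K V 1, p • y = 0) → y = 0

variable [∀ i j : V, Finite (i ⟶ j)] {n : ℕ} {π : PathAlg K V →ₐ[K] L} {m : ℤ}

namespace LinRep

/-- A morphism of linear representations is given on the components with degree in `-S` only. It
commutes with all paths that lead from one of these components to another. -/
@[ext]
structure Hom (Y Z : LinRep n π m) where
  app : ∀ i, i ∈ suppDeg n m → (Y.deg i →+ Z.deg i)
  comm : ∀ i j (hi : i ∈ suppDeg n m) (hj : j ∈ suppDeg n m) (p : PathAlg K V) (x : Y.deg i),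
    app j hj (PathRep.move j p x) = PathRep.move j p (app i hi x)

instance : Category (LinRep n π m) where
  Hom := Hom
  id Y := ⟨fun _ _ => AddMonoidHom.id _, fun _ _ _ _ _ _ => rfl⟩
  comp f g := ⟨fun i hi => (g.app i hi).comp (f.app i hi), fun i j hi hj p x => by
    simp only [AddMonoidHom.comp_apply, f.comm i j hi hj, g.comm i j hi hj]⟩

lemma hom_ext {Y Z : LinRep n π m} {f g : Y ⟶ Z}
    (h : ∀ i hi x, Hom.app f i hi x = Hom.app g i hi x) : f = g :=
  Hom.ext (funext fun i => funext fun hi => AddMonoidHom.ext (h i hi))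

end LinRep

/-- A component of a morphism, as a linear map over `KQ₀`. -/
def LinRep.Hom.lin {Y Z : LinRep n π m} (f : Y ⟶ Z) (i : ℤ) (hi : i ∈ suppDeg n m) :
    Y.deg i →ₗ[V → K] Z.deg i where
  toFun := LinRep.Hom.app f i hi
  map_add' := map_add _
  map_smul' r x := by
    rw [← PathRep.move_vertexHom, LinRep.Hom.comm f i i hi hi, PathRep.move_vertexHom]
    rfl

section Complex

variable {𝓛 : ℤ → Submodule K L} [GradedAlgebra 𝓛] (hπ : IsGradedFactor 𝓛 π)

/-- A morphism commutes with composites of differentials exactly if its components commute with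
the action of the paths. -/
lemma PathRep.mapHom_comp_iterD_iff (hrel : HasRelationsOfDegreeGE n π) {Y Z : PathRep K V}
    {r : ℕ} (hr : r ≠ 0) (hrn : r < n) {i j : ℤ} (h : i + r = j)
    (f : Y.deg i →ₗ[V → K] Z.deg i) (g : Y.deg j →ₗ[V → K] Z.deg j) :
    (show Y.obj hπ i ⟶ Z.obj hπ i from FreeMod.mapHom f) ≫
        iterD (X := Z.obj hπ) (Z.diff hπ) r i j h =
      iterD (X := Y.obj hπ) (Y.diff hπ) r i j h ≫
        (show Y.obj hπ j ⟶ Z.obj hπ j from FreeMod.mapHom g) ↔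
    ∀ p ∈ pathDeg K V r, ∀ x, g (PathRep.move j p x) = PathRep.move j p (f x) := by
  classical
  have e1 : ∀ y, ((show Y.obj hπ i ⟶ Z.obj hπ i from FreeMod.mapHom f) ≫
        iterD (X := Z.obj hπ) (Z.diff hπ) r i j h).toLin (FreeMod.tmul π 1 y) =
      ∑ p ∈ paths V r, FreeMod.tmul π (π (path p 1)) (PathRep.move j (path p 1) (f y)) := by
    intro y
    refine Eq.trans ?_ (Z.iterD_tmul_one hπ r hr h (f y))
    exact congrArg (iterD (X := Z.obj hπ) (Z.diff hπ) r i j h).toLin (FreeMod.mapHom_tmul f 1 y)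
  have e2 : ∀ y, (iterD (X := Y.obj hπ) (Y.diff hπ) r i j h ≫
        (show Y.obj hπ j ⟶ Z.obj hπ j from FreeMod.mapHom g)).toLin (FreeMod.tmul π 1 y) =
      ∑ p ∈ paths V r, FreeMod.tmul π (π (path p 1)) (g (PathRep.move j (path p 1) y)) := by
    intro y
    refine (congrArg (FreeMod.mapHom (hπ := hπ) (d := -j) g).toLin
      (Y.iterD_tmul_one hπ r hr h y)).trans ?_
    rw [map_sum]
    exact Finset.sum_congr rfl fun p _ => FreeMod.mapHom_tmul g _ _
  constructor
  · intro heq p hp x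
    have h1 : ∀ q ∈ paths V r, g (PathRep.move j (path q 1) x) =
        PathRep.move j (path q 1) (f x) := by
      intro q hq
      refine FreeMod.sum_tmul_path_injective hπ hrel (k := r) (by omega) (y := fun q =>
        g (PathRep.move j (path q 1) x)) (z := fun q => PathRep.move j (path q 1) (f x)) ?_ ?_ ?_ hq
      · intro q hq
        rw [← map_smul, PathRep.single_smul_move h hq]
      · intro q hq
        rw [PathRep.single_smul_move h hq]
      · rw [← e1, ← e2, heq]
    have h2 : ∀ W : PathRep K V, ∀ x : W.deg i, PathRep.move j p x =
        ∑ q ∈ paths V r, (fun _ => coeff p q : V → K) • PathRep.move j (path q 1) x :=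
      fun W x => Subtype.ext (by rw [W.sum_coeff_smul_move h hp, PathRep.move_val h hp])
    rw [h2, h2, map_sum]
    exact Finset.sum_congr rfl fun q hq => by rw [map_smul, h1 q hq]
  · intro H
    refine FreeMod.hom_ext fun y => ?_
    rw [e1, e2]
    exact Finset.sum_congr rfl fun p hp => by rw [H _ (path_mem' p (mem_paths.1 hp))]

lemma PathRep.diff_eq_zero_iff (hrel : HasRelationsOfDegreeGE n π) (hn : 1 < n) {Y : PathRep K V}
    {k : ℤ} (y : Y.deg k) : (Y.diff hπ k).toLin (FreeMod.tmul π 1 y) = 0 ↔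
      ∀ p ∈ pathDeg K V 1, p • y.1 = 0 := by
  classical
  rw [PathRep.diff_tmul_one]
  constructor
  · intro h0 p hp
    refine PathRep.smul_eq_zero_of_paths (k := 1) (fun q hq => ?_) hp
    have := FreeMod.sum_tmul_path_injective hπ hrel (k := 1) (by omega) (y := fun q =>
      PathRep.move (k + 1) (path q 1) y) (z := 0)
      (fun q hq => PathRep.single_smul_move rfl hq _) (fun q _ => smul_zero _)
      (h0.trans (by simp [FreeMod.tmul_zero])) hq
    rw [← PathRep.move_path_val rfl hq, this]
    rfl
  · intro H
    refine Finset.sum_eq_zero fun p hp => ?_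
    have : PathRep.move (k + 1) (path p 1) y = 0 := Subtype.ext (by
      rw [PathRep.move_path_val rfl hp, H _ (path_mem' p (mem_paths.1 hp))]
      rfl)
    rw [this, FreeMod.tmul_zero]

omit [GradedAlgebra 𝓛] in
lemma LinearNComplex.contract_d (hn : 2 ≤ n) (P : LinearNComplex 𝓛 n) (j : ℤ) :
    (P.contract hn m).d j (j + 1) = iterD P.d (step n j) _ _ (idx_add_step hn m j) :=
  CochainComplex.of_d (fun j => P.X (-delta n m (-j)))
    (fun j => iterD P.d (step n j) _ _ (neg_delta_add_step hn m j)) j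

/-- The condition `Ker d^{2k-1} ⊆ P^{2k-1} J` for all `k`. -/
def KerInRadical (C : CochainComplex (GrMod 𝓛) ℤ) : Prop :=
  ∀ (k : ℤ) (x : (C.X (2 * k - 1)).carrier), (C.d (2 * k - 1) (2 * k)).toLin x = 0 →
    x ∈ (C.X (2 * k - 1)).mulRadical

omit [GradedAlgebra 𝓛] in
lemma KerInRadical.of_iso {C D : CochainComplex (GrMod 𝓛) ℤ} (e : C ≅ D) (h : KerInRadical C) :
    KerInRadical D := by
  intro k x hx
  have h1 := h k ((e.inv.f (2 * k - 1)).toLin x) (by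
    have := LinearMap.congr_fun (congrArg GrMod.Hom.toLin (e.inv.comm (2 * k - 1) (2 * k))) x
    refine this.trans ?_
    rw [GrMod.comp_toLin, LinearMap.comp_apply, hx, map_zero])
  have h2 := GrMod.map_mem_mulRadical (e.hom.f (2 * k - 1)) h1
  have h3 : (e.hom.f (2 * k - 1)).toLin ((e.inv.f (2 * k - 1)).toLin x) = x := by
    have : e.inv.f (2 * k - 1) ≫ e.hom.f (2 * k - 1) = 𝟙 _ := by
      rw [← HomologicalComplex.comp_f, e.inv_hom_id, HomologicalComplex.id_f]
    exact LinearMap.congr_fun (congrArg GrMod.Hom.toLin this) x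
  rwa [h3] at h2

/-- The condition on the kernels says that no nonzero element of `Y` in a degree belonging to
`-m - 1 + nℤ` is killed by all arrows. -/
lemma PathRep.kerInRadical_iff (hrel : HasRelationsOfDegreeGE n π) (hn : 2 ≤ n)
    (Y : PathRep K V) (hY : ∀ x ∈ perp n π, ∀ y : Y.carrier, x • y = 0) :
    KerInRadical ((Y.complex hπ (by omega) hY).contract hn m) ↔
      ∀ i, (n : ℤ) ∣ i + m + 1 → ∀ y ∈ Y.deg i, (∀ p ∈ pathDeg K V 1, p • y = 0) → y = 0 := by
  have key : ∀ k j : ℤ, j + 1 = 2 * k → (∀ x : FreeMod π (Y.deg (idx n m j)),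
      (((Y.complex hπ (by omega) hY).contract hn m).d j (2 * k)).toLin x = 0 ↔
      (Y.diff hπ (idx n m j)).toLin x = 0) := by
    intro k j hj x
    rw [← hj, LinearNComplex.contract_d]
    have hs : step n j = 1 := if_neg (by rw [Int.not_even_iff_odd]; exact ⟨k - 1, by omega⟩)
    have h2 : ∀ (r : ℕ) (i : ℤ) (hi : idx n m j + r = i), r = 1 →
        ((iterD (X := Y.obj hπ) (Y.diff hπ) r _ i hi).toLin x = 0 ↔
        (Y.diff hπ (idx n m j)).toLin x = 0) := by
      rintro r i hi rfl
      subst hi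
      have : iterD (X := Y.obj hπ) (Y.diff hπ) 1 _ (idx n m j + (1 : ℕ)) rfl =
        Y.diff hπ (idx n m j) := by simp [iterD]
      exact iff_of_eq (congrArg (· = 0) (LinearMap.congr_fun (congrArg GrMod.Hom.toLin this) x))
    exact h2 _ _ _ hs
  constructor
  · intro H i hi y hy h0
    obtain ⟨c, hc⟩ := hi
    have hidx : idx n m (2 * c - 1) = i := by
      rw [idx_odd]
      linarith
    subst hidx
    have h1 := H c (FreeMod.tmul π 1 (⟨y, hy⟩ : Y.deg _)) ((key c (2 * c - 1) (by ring) _).2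
      ((PathRep.diff_eq_zero_iff hπ hrel (by omega) _).2 h0))
    exact congrArg Subtype.val (GrMod.eq_zero_of_mem_mulRadical (hπ := hπ) hrel (by omega) h1)
  · intro H k x hx
    have h1 := (key k (2 * k - 1) (by ring) x).1 hx
    refine GrMod.mem_mulRadical (hπ := hπ) (N := Y.deg (idx n m (2 * k - 1))) ?_
    obtain ⟨y, hy⟩ := FreeMod.exists_one_tmul
      (GrMod.part_mem (Y.obj hπ (idx n m (2 * k - 1))) (-idx n m (2 * k - 1)) x)
    refine hy.trans ?_
    have h2 : (Y.diff hπ (idx n m (2 * k - 1))).toLin (FreeMod.tmul π 1 y) = 0 := by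
      rw [← hy]
      refine (GrMod.map_part (Y.diff hπ (idx n m (2 * k - 1))) _ x).trans ?_
      exact (congrArg _ h1).trans (GrMod.part_zero _ _)
    have h3 : y = 0 := Subtype.ext (H _ ⟨k, by rw [idx_odd]; ring⟩ y.1 y.2
      ((PathRep.diff_eq_zero_iff hπ hrel (by omega) y).1 h2))
    rw [h3, FreeMod.tmul_zero]

end Complex

end LinRep

/-! ### From linear representations to liftable complexes -/

section ToYo

variable {K V L : Type u} [Field K] [Quiver.{u} V] [Fintype V] [Ring L] [Algebra K L]
  [∀ i j : V, Finite (i ⟶ j)] {𝓛 : ℤ → Submodule K L} [GradedAlgebra 𝓛]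
  {π : PathAlg K V →ₐ[K] L} {n : ℕ} {m : ℤ} (hn : 2 ≤ n) (hπ : IsGradedFactor 𝓛 π)
  (hrel : HasRelationsOfDegreeGE n π)

namespace LinRep

/-- The contraction of the linear complex of a linear representation. -/
abbrev contraction (Y : LinRep n π m) : CochainComplex (GrMod 𝓛) ℤ :=
  (Y.complex hπ (show n ≠ 0 by omega) Y.perp_smul).contract hn m

include hrel in
lemma contraction_mem (Y : LinRep n π m) : Yo 𝓛 hn m (Y.contraction hn hπ) := by
  refine ⟨⟨_, ⟨Iso.refl _⟩⟩, fun j => ⟨GrMod.projective_graded (hπ := hπ) _ _, ?_⟩, fun h =>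
    (PathRep.kerInRadical_iff hπ hrel hn _ Y.perp_smul).2 (Y.torsion_free h)⟩
  have := FreeMod.generatedIn (hπ := hπ) (N := Y.deg (idx n m j)) (d := -idx n m j)
  rw [← neg_neg (delta n m (-j))]
  exact this

include hrel in
lemma contraction_comm_iff {Y Z : LinRep n π m} (j : ℤ)
    (f : Y.deg (idx n m j) →ₗ[V → K] Z.deg (idx n m j))
    (g : Y.deg (idx n m (j + 1)) →ₗ[V → K] Z.deg (idx n m (j + 1))) :
    (show (Y.contraction hn hπ).X j ⟶ (Z.contraction hn hπ).X j from FreeMod.mapHom f) ≫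
        (Z.contraction hn hπ).d j (j + 1) =
      (Y.contraction hn hπ).d j (j + 1) ≫
        (show (Y.contraction hn hπ).X (j + 1) ⟶ (Z.contraction hn hπ).X (j + 1)
          from FreeMod.mapHom g) ↔
    ∀ p ∈ pathDeg K V (step n j), ∀ x,
      g (PathRep.move (idx n m (j + 1)) p x) = PathRep.move (idx n m (j + 1)) p (f x) := by
  rw [LinearNComplex.contract_d, LinearNComplex.contract_d]
  exact PathRep.mapHom_comp_iterD_iff hπ hrel (step_pos hn j).ne' (step_lt hn j)
    (idx_add_step hn m j) f g

/-- The chain map of a morphism of linear representations. -/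
def contractionMap {Y Z : LinRep n π m} (f : Y ⟶ Z) :
    Y.contraction hn hπ ⟶ Z.contraction hn hπ :=
  CochainComplex.ofHom (fun j => FreeMod.mapHom (LinRep.Hom.lin f _ (idx_mem n m j)))
    (fun j => (contraction_comm_iff hn hπ hrel j _ _).2 fun p _ x =>
      LinRep.Hom.comm f _ _ _ _ p x)

lemma contractionMap_id (Y : LinRep n π m) :
    contractionMap hn hπ hrel (𝟙 Y) = 𝟙 (Y.contraction hn hπ) :=
  HomologicalComplex.hom_ext _ _ fun j => FreeMod.mapHom_id (N := Y.deg (idx n m j))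

lemma contractionMap_comp {X Y Z : LinRep n π m} (f : X ⟶ Y) (g : Y ⟶ Z) :
    contractionMap hn hπ hrel (f ≫ g) =
      contractionMap hn hπ hrel f ≫ contractionMap hn hπ hrel g :=
  HomologicalComplex.hom_ext _ _ fun j => FreeMod.mapHom_comp
    (LinRep.Hom.lin f _ (idx_mem n m j)) (LinRep.Hom.lin g _ (idx_mem n m j))

include hn in
/-- A family of `KQ₀`-linear maps that commutes with the paths leading from one degree of `-S` to
the next one commutes with all paths. -/
lemma comm_of_step {Y Z : PathRep K V} (f : ∀ j, Y.deg (idx n m j) →ₗ[V → K] Z.deg (idx n m j))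
    (h : ∀ j, ∀ p ∈ pathDeg K V (step n j), ∀ x, f (j + 1) (PathRep.move (idx n m (j + 1)) p x) =
      PathRep.move (idx n m (j + 1)) p (f j x)) (i j : ℤ) (p : PathAlg K V)
    (x : Y.deg (idx n m i)) :
    f j (PathRep.move (idx n m j) p x) = PathRep.move (idx n m j) p (f i x) := by
  rw [← PathRep.move_component, ← PathRep.move_component (Y := Z)]
  have hp := component_mem (idx n m j - idx n m i) p
  generalize component (idx n m j - idx n m i) p = q at hp
  rcases lt_or_ge j i with hji | hij
  · have : q = 0 := by
      have h1 : idx n m j - idx n m i < 0 := sub_neg.2 (idx_strictMono hn m hji)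
      exact pathDeg_eq_zero h1 hp
    subst this
    rw [PathRep.zero_move, PathRep.zero_move, map_zero]
  induction j, hij using Int.leInduction generalizing q with
  | base =>
    rw [sub_self] at hp
    obtain ⟨r, rfl⟩ := exists_vertexHom hp
    rw [PathRep.move_vertexHom, PathRep.move_vertexHom, map_smul]
  | succ j hij ih =>
    have hs : idx n m (j + 1) - idx n m j = step n j := by
      rw [← idx_add_step hn m j]
      ring
    have h1 := pathDeg_add_le K V (k := step n j) (l := idx n m j - idx n m i)
      (by positivity) (sub_nonneg.2 ((idx_strictMono hn m).monotone hij))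
      (show _ = idx n m (j + 1) - idx n m i by rw [← hs]; ring)
    have h2 := h1 hp
    clear hp
    induction h2 using Submodule.span_induction with
    | zero => rw [PathRep.zero_move, PathRep.zero_move, map_zero]
    | add a b _ _ ha hb => rw [PathRep.add_move, map_add, ha, hb, PathRep.add_move]
    | smul c a _ ha => rw [PathRep.smul_move, map_smul, ha, PathRep.smul_move]
    | mem a ha =>
      obtain ⟨b, hb, c, hc, rfl⟩ := ha
      rw [PathRep.move_mul (by rwa [hs]) hc, h j b hb, ih c hc,
        PathRep.move_mul (by rwa [hs]) hc]

end LinRep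

variable (m) in
/-- The functor that takes a linear representation to the contraction of its linear complex. -/
def toYo : LinRep n π m ⥤ (Yo 𝓛 hn m).FullSubcategory where
  obj Y := ⟨Y.contraction hn hπ, Y.contraction_mem hn hπ hrel⟩
  map f := ObjectProperty.homMk (LinRep.contractionMap hn hπ hrel f)
  map_id Y := by
    apply ObjectProperty.hom_ext
    exact LinRep.contractionMap_id hn hπ hrel Y
  map_comp f g := by
    apply ObjectProperty.hom_ext
    exact LinRep.contractionMap_comp hn hπ hrel f g

instance : (toYo m hn hπ hrel).Faithful where
  map_injective {Y Z f g} h := LinRep.hom_ext fun i hi x => by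
    obtain ⟨j, rfl⟩ := exists_idx hi
    have h1 := HomologicalComplex.congr_hom (congrArg (fun t => t.hom) h) j
    have h2 := FreeMod.mapHom_injective hrel (by omega) h1
    exact LinearMap.congr_fun h2 x

instance : (toYo m hn hπ hrel).Full where
  map_surjective {Y Z} F := by
    choose g hg using fun j => FreeMod.exists_mapHom hrel (by omega) (F.hom.f j)
    have hcomm := LinRep.comm_of_step hn g fun j =>
      (LinRep.contraction_comm_iff hn hπ hrel j (g j) (g (j + 1))).1
        (by rw [← hg, ← hg]; exact F.hom.comm j (j + 1))
    have hkey : ∀ (i : ℤ) (hi : i ∈ suppDeg n m), ∃ f : Y.deg i →+ Z.deg i,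
        ∀ j (hj : idx n m j = i) (x : Y.deg (idx n m j)),
          (f ⟨x.1, hj ▸ x.2⟩).1 = (g j x).1 := by
      intro i hi
      obtain ⟨j, rfl⟩ := exists_idx hi
      refine ⟨(g j).toAddMonoidHom, fun j' hj' x => ?_⟩
      obtain rfl := (idx_strictMono hn m).injective hj'
      rfl
    choose f hf using hkey
    refine ⟨⟨f, ?_⟩, ?_⟩
    · intro i j hi hj p x
      obtain ⟨i, rfl⟩ := exists_idx hi
      obtain ⟨j, rfl⟩ := exists_idx hj
      have h1 : ∀ j hj x, f (idx n m j) hj x = g j x := fun j hj x => Subtype.ext (hf _ hj j rfl x)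
      rw [h1, h1]
      exact hcomm i j p x
    · ext j : 2
      refine Eq.trans ?_ (hg j).symm
      change FreeMod.mapHom _ = _
      congr 1
      exact LinearMap.ext fun x => Subtype.ext (hf _ _ j rfl x)

end ToYo

/-! ### Modules over the path algebra from the action of the arrows -/

section ArrowModule

variable {K V : Type u} [Field K] [Quiver.{u} V]
  {M : Type u} [AddCommGroup M] [Module (V → K) M]

open scoped Classical in
/-- The action of a path when actions `T` of the arrows are given: the last arrow acts first. -/
def pathAct (T : QPath V → M →+ M) (i : V) : ∀ {j : V}, Quiver.Path i j → M →+ M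
  | _, .nil => DistribSMul.toAddMonoidHom M (Pi.single i 1 : V → K)
  | _, .cons p e => (pathAct T i p).comp (T ⟨_, _, e.toPath⟩)

/-- Families of operators that belong to the arrows: the image of the operator of an arrow lies
over its origin, and all vertices except its terminus act as zero on its argument. The family is
indexed by all paths, but only its members at the paths of length one matter. -/
structure IsArrowAction (T : QPath V → M →+ M) : Prop where
  single_smul : ∀ [DecidableEq V] p y, (Pi.single p.src 1 : V → K) • T p y = T p y
  map_smul : ∀ p (r : V → K) y, T p (r • y) = (fun _ => r p.tgt : V → K) • T p y

variable {T : QPath V → M →+ M}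

lemma smul_pathAct {i j : V} (p : Quiver.Path i j) (r : V → K) (y : M) :
    r • pathAct (K := K) T i p y = (fun _ => r i : V → K) • pathAct (K := K) T i p y := by
  classical
  induction p generalizing y with
  | nil =>
    change r • (Pi.single i 1 : V → K) • y = (fun _ => r i : V → K) • (Pi.single i 1 : V → K) • y
    rw [smul_smul, smul_smul]
    congr 1
    ext v
    rcases eq_or_ne v i with rfl | h
    · simp
    · simp [Pi.single_eq_of_ne h]
  | cons p e ih => exact ih _

namespace IsArrowAction

lemma pathAct_smul (hT : IsArrowAction (K := K) T) {i j : V} (p : Quiver.Path i j) (r : V → K)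
    (y : M) :
    pathAct (K := K) T i p (r • y) = (fun _ => r j : V → K) • pathAct (K := K) T i p y := by
  classical
  induction p generalizing r y with
  | nil =>
    change (Pi.single i 1 : V → K) • r • y = (fun _ => r i : V → K) • (Pi.single i 1 : V → K) • y
    rw [smul_smul, smul_smul]
    congr 1
    ext v
    rcases eq_or_ne v i with rfl | h
    · simp
    · simp [Pi.single_eq_of_ne h]
  | cons p e ih =>
    change pathAct (K := K) T i p (T _ (r • y)) = _ • pathAct (K := K) T i p (T _ y)
    rw [hT.map_smul, ih]

lemma pathAct_comp (hT : IsArrowAction (K := K) T) {i j k : V} (p : Quiver.Path i j)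
    (q : Quiver.Path j k) (y : M) :
    pathAct (K := K) T i (p.comp q) y = pathAct (K := K) T i p (pathAct (K := K) T j q y) := by
  classical
  induction q generalizing y with
  | nil =>
    change _ = pathAct (K := K) T i p ((Pi.single j 1 : V → K) • y)
    rw [hT.pathAct_smul, Pi.single_eq_same]
    exact (one_smul (V → K) _).symm
  | cons q e ih => exact ih _

lemma pathAct_eq_zero (hT : IsArrowAction (K := K) T) {i j k l : V} (p : Quiver.Path i j)
    (q : Quiver.Path k l) (h : j ≠ k) (y : M) :
    pathAct (K := K) T i p (pathAct (K := K) T k q y) = 0 := by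
  classical
  have h1 : pathAct (K := K) T k q y = (Pi.single k 1 : V → K) • pathAct (K := K) T k q y := by
    rw [smul_pathAct, Pi.single_eq_same]
    exact (one_smul (V → K) _).symm
  rw [h1, hT.pathAct_smul, Pi.single_eq_of_ne h]
  exact zero_smul (V → K) _

end IsArrowAction

/-- The `K`-vector space underlying a `KQ₀`-module. -/
abbrev vectorSpace (M : Type u) [AddCommGroup M] [Module (V → K) M] : Module K M :=
  Module.compHom M (Pi.constRingHom V K)

variable (T) in
/-- The action of the path algebra when actions of the arrows are given. -/
def algAct : PathAlg K V →+ M →+ M :=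
  letI := vectorSpace (K := K) (V := V) M
  (PathAlg.lift (K := K) fun p => pathAct (K := K) T p.src p.2.2).toAddMonoidHom

lemma algAct_path (p : QPath V) : algAct (K := K) T (path p 1) = pathAct (K := K) T p.src p.2.2 :=
  let _ := vectorSpace (K := K) (V := V) M
  PathAlg.lift_path _ p

lemma algAct_smul (c : K) (x : PathAlg K V) (y : M) :
    algAct T (c • x) y = (fun _ => c : V → K) • algAct T x y := by
  let _ := vectorSpace (K := K) (V := V) M
  exact DFunLike.congr_fun (map_smul (PathAlg.lift (K := K) fun p =>
    pathAct (K := K) T p.src p.2.2) c x) y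

variable [Fintype V]

lemma algAct_vertexSum (r : V → K) (y : M) : algAct T (vertexSum r) y = r • y := by
  classical
  rw [vertexSum, map_sum, AddMonoidHom.finsetSum_apply]
  have : ∀ i : V, algAct T (path (QPath.triv i) (r i)) y = (Pi.single i (r i) : V → K) • y := by
    intro i
    rw [path_eq_smul, algAct_smul, algAct_path]
    change (fun _ => r i : V → K) • (Pi.single i 1 : V → K) • y = _
    rw [smul_smul]
    congr 1
    ext v
    rcases eq_or_ne v i with rfl | h
    · simp
    · simp [Pi.single_eq_of_ne h]
  rw [Finset.sum_congr rfl fun i _ => this i, ← Finset.sum_smul, Finset.univ_sum_single]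

omit [Fintype V] in
lemma IsArrowAction.algAct_const (hT : IsArrowAction (K := K) T) (c : K) (x : PathAlg K V)
    (y : M) : algAct T x ((fun _ => c : V → K) • y) = (fun _ => c : V → K) • algAct T x y := by
  induction x using PathAlg.induction with
  | zero => simp
  | add a b ha hb => simp [map_add, ha, hb]
  | smul d a ha => rw [algAct_smul, ha, smul_comm, algAct_smul]
  | path p => rw [algAct_path, hT.pathAct_smul]

lemma IsArrowAction.algAct_mul (hT : IsArrowAction (K := K) T) (x x' : PathAlg K V) (y : M) :
    algAct T (x * x') y = algAct T x (algAct T x' y) := by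
  induction x using PathAlg.induction with
  | zero => simp
  | add a b ha hb => simp [add_mul, ha, hb]
  | smul d a ha => rw [smul_mul_assoc, algAct_smul, ha, algAct_smul]
  | path p =>
    induction x' using PathAlg.induction with
    | zero => simp
    | add a b ha hb => simp [mul_add, ha, hb]
    | smul d a ha => rw [mul_smul_comm, algAct_smul, ha, algAct_smul, hT.algAct_const]
    | path q =>
      rw [path_mul_path, algAct_path, algAct_path]
      obtain ⟨i, j, p⟩ := p
      obtain ⟨k, l, q⟩ := q
      by_cases h : j = k
      · subst h
        rw [pathMul_of_eq rfl, algAct_path, QPath.concat_mk]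
        exact hT.pathAct_comp p q y
      · rw [pathMul_of_ne h, map_zero, hT.pathAct_eq_zero p q h]
        rfl

/-- The module over the path algebra given by actions of the arrows. -/
abbrev IsArrowAction.module (hT : IsArrowAction (K := K) T) : Module (PathAlg K V) M where
  smul x y := algAct T x y
  one_smul y := by
    change algAct T (vertexSum 1) y = y
    rw [algAct_vertexSum, one_smul]
  mul_smul x x' y := hT.algAct_mul x x' y
  smul_zero x := map_zero _
  smul_add x := map_add _
  add_smul x x' y := by
    change algAct T (x + x') y = _
    rw [map_add]
    rfl
  zero_smul y := by
    change algAct T 0 y = 0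
    rw [map_zero]
    rfl

namespace PathRep

variable {N : ℤ → Type u} [∀ k, AddCommGroup (N k)] [∀ k, Module (V → K) (N k)]
  {T : ∀ k, QPath V → N k →+ N (k + 1)}

omit [Fintype V] in
variable (T) in
/-- The action of an arrow on the sum of all components. -/
def totalArrow (p : QPath V) : (⨁ k, N k) →+ ⨁ k, N k :=
  DirectSum.toAddMonoid fun k => (DirectSum.of N (k + 1)).comp (T k p)

omit [Fintype V] [∀ k, Module (V → K) (N k)] in
lemma totalArrow_of (p : QPath V) (k : ℤ) (y : N k) :
    totalArrow T p (DirectSum.of N k y) = DirectSum.of N (k + 1) (T k p y) :=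
  DirectSum.toAddMonoid_of _ _ _

omit [Fintype V] [Quiver.{u} V] in
lemma of_smul (r : V → K) (k : ℤ) (y : N k) :
    DirectSum.of N k (r • y) = r • DirectSum.of N k y := map_smul (DirectSum.lof (V → K) ℤ N k) r y

omit [Fintype V] in
lemma isArrowAction_totalArrow
    (h1 : ∀ [DecidableEq V] k p y, (Pi.single p.src 1 : V → K) • T k p y = T k p y)
    (h2 : ∀ k p (r : V → K) y, T k p (r • y) = (fun _ => r p.tgt : V → K) • T k p y) :
    IsArrowAction (K := K) (totalArrow T) where
  single_smul p y := by
    induction y using DirectSum.induction_on with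
    | zero => rw [map_zero, smul_zero]
    | of k y => rw [totalArrow_of, ← of_smul, h1]
    | add y z hy hz => rw [map_add, smul_add, hy, hz]
  map_smul p r y := by
    induction y using DirectSum.induction_on with
    | zero => rw [smul_zero, map_zero, smul_zero]
    | of k y => rw [← of_smul, totalArrow_of, totalArrow_of, h2, of_smul]
    | add y z hy hz => rw [smul_add, map_add, map_add, hy, hz, smul_add]

omit [Fintype V] in
lemma pathAct_totalArrow_mem {i j : V} (p : Quiver.Path i j) {k : ℤ} {y : ⨁ k, N k}
    (hy : y ∈ (DirectSum.of N k).range) :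
    pathAct (K := K) (totalArrow T) i p y ∈ (DirectSum.of N (k + p.length)).range := by
  classical
  induction p generalizing k y with
  | nil =>
    obtain ⟨y, rfl⟩ := hy
    rw [Quiver.Path.length_nil, Nat.cast_zero, add_zero]
    exact ⟨(Pi.single i 1 : V → K) • y, of_smul _ _ _⟩
  | cons p e ih =>
    obtain ⟨y, rfl⟩ := hy
    have := ih (k := k + 1) (y := totalArrow T ⟨_, _, e.toPath⟩ (DirectSum.of N k y))
      ⟨_, (totalArrow_of _ _ _).symm⟩
    rw [Quiver.Path.length_cons, Nat.cast_succ, add_comm (p.length : ℤ), ← add_assoc]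
    exact this

/-- The graded `KQ`-module `⨁ N_k` given by actions `N_k → N_{k+1}` of the arrows. -/
def ofArrows (hT : IsArrowAction (K := K) (totalArrow T)) : PathRep K V :=
  letI := hT.module
  { carrier := ⨁ k, N k
    deg := fun k => (DirectSum.of N k).range
    smul_mem := fun {i k p x} hp hx => by
      change algAct (totalArrow T) p x ∈ (DirectSum.of N (i + k)).range
      induction hp using Submodule.span_induction with
      | zero =>
        rw [map_zero]
        exact zero_mem _
      | add a b _ _ ha hb =>
        rw [map_add]
        exact add_mem ha hb
      | smul c a _ ha =>
        rw [algAct_smul]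
        obtain ⟨y, hy⟩ := ha
        exact ⟨(fun _ => c : V → K) • y, by rw [of_smul, hy]⟩
      | mem a ha =>
        obtain ⟨q, rfl, rfl⟩ := ha
        change algAct (totalArrow T) (path q 1) x ∈ _
        rw [algAct_path]
        exact pathAct_totalArrow_mem q.2.2 hx }

/-- The `k`-th component of `⨁ N_k` is isomorphic to `N_k`. -/
def ofArrowsEquiv (hT : IsArrowAction (K := K) (totalArrow T)) (k : ℤ) :
    N k ≃ₗ[V → K] (ofArrows hT).deg k :=
  LinearEquiv.ofBijective
    { toFun := fun y => (⟨DirectSum.of N k y, y, rfl⟩ : (ofArrows hT).deg k)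
      map_add' := fun _ _ => Subtype.ext (map_add (DirectSum.of N k) _ _)
      map_smul' := fun r y => Subtype.ext ((of_smul r k y).trans
        (algAct_vertexSum (T := totalArrow T) r (DirectSum.of N k y)).symm) }
    ⟨fun _ _ h => DirectSum.of_injective k (congrArg Subtype.val h), fun ⟨_, y, hy⟩ =>
      ⟨y, Subtype.ext hy⟩⟩

lemma path_smul_ofArrowsEquiv (hT : IsArrowAction (K := K) (totalArrow T)) {k : ℤ} {p : QPath V}
    (hp : (p.len : ℤ) = 1) (y : N k) :
    (path p 1 : PathAlg K V) • (ofArrowsEquiv hT k y).1 =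
      (ofArrowsEquiv hT (k + 1) (T k p y)).1 := by
  classical
  obtain ⟨i, j, q⟩ := p
  cases q with
  | nil => exact absurd (show (0 : ℤ) = 1 from hp) (by norm_num)
  | cons q e =>
    have hl : (((q.cons e).length : ℕ) : ℤ) = 1 := hp
    have hl' : q.length = 0 := by
      rw [Quiver.Path.length_cons] at hl
      omega
    obtain rfl := q.eq_of_length_zero hl'
    obtain rfl := q.eq_nil_of_length_zero hl'
    change algAct (totalArrow T) (path _ 1) (DirectSum.of N k y) = DirectSum.of N (k + 1) _
    rw [algAct_path, ← totalArrow_of]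
    exact hT.single_smul _ _

/-- The components of `ofArrows` span. -/
lemma ofArrows_induction (hT : IsArrowAction (K := K) (totalArrow T))
    {P : (ofArrows hT).carrier → Prop} (y : (ofArrows hT).carrier) (zero : P 0)
    (add : ∀ y z, P y → P z → P (y + z)) (deg : ∀ k (y : (ofArrows hT).deg k), P y.1) : P y :=
  DirectSum.induction_on (motive := P) y zero (fun k y => deg k ⟨_, y, rfl⟩) add

end PathRep

end ArrowModule

/-! ### Every liftable complex comes from a linear representation -/

section EssSurj

variable {K V L : Type u} [Field K] [Quiver.{u} V] [Fintype V] [Ring L] [Algebra K L]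
  [∀ i j : V, Finite (i ⟶ j)] {𝓛 : ℤ → Submodule K L} [GradedAlgebra 𝓛]
  {π : PathAlg K V →ₐ[K] L} {n : ℕ} {m : ℤ} (hn : 2 ≤ n) (hπ : IsGradedFactor 𝓛 π)
  (hrel : HasRelationsOfDegreeGE n π)

include hn hrel in
/-- A morphism between modules generated in consecutive degrees is given by operators that belong
to the arrows. -/
lemma FreeMod.exists_arrows {N N' : Type u} [AddCommGroup N] [Module (V → K) N] [AddCommGroup N']
    [Module (V → K) N'] {d d' : ℤ} (hd : 1 + d' = d) (f : graded N hπ d ⟶ graded N' hπ d') :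
    ∃ T : QPath V → N →+ N',
      (∀ [DecidableEq V] p y, (Pi.single p.src 1 : V → K) • T p y = T p y) ∧
      (∀ p (r : V → K) y, T p (r • y) = (fun _ => r p.tgt : V → K) • T p y) ∧
      ∀ y, f.toLin (tmul π 1 y) = ∑ p ∈ paths V 1, tmul π (π (path p 1)) (T p y) := by
  classical
  have h1 : ∀ y : N, ∃ z : QPath V → N', (∀ p, (Pi.single p.src 1 : V → K) • z p = z p) ∧
      f.toLin (tmul π 1 y) = ∑ p ∈ paths V 1, tmul π (π (path p 1)) (z p) := fun y =>
    exists_sum_paths hd (f.map_mem (one_tmul_mem y))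
  choose z hz hf using h1
  have hconst : ∀ {p : QPath V} {w : N'} (r : V → K), (Pi.single p.src 1 : V → K) • w = w →
      (Pi.single p.src 1 : V → K) • r • w = r • w := fun r h => by
    rw [smul_comm, h]
  have hadd : ∀ y y' p, p ∈ paths V 1 → z (y + y') p = z y p + z y' p := fun y y' p hp =>
    sum_tmul_path_injective hπ hrel (k := 1) (by omega) (fun p _ => hz _ p)
      (z := fun p => z y p + z y' p)
      (fun p _ => by rw [smul_add, hz, hz])
      (by
        rw [← hf, tmul_add]
        simp only [tmul_add, Finset.sum_add_distrib]
        rw [← hf, ← hf]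
        exact map_add f.toLin _ _) hp
  have hsmul : ∀ (r : V → K) y p, p ∈ paths V 1 →
      z (r • y) p = (fun _ => r p.tgt : V → K) • z y p := fun r y p hp =>
    sum_tmul_path_injective hπ hrel (k := 1) (z := fun p => (fun _ => r p.tgt : V → K) • z y p)
      (by omega) (fun p _ => hz _ p) (fun p _ => hconst _ (hz y p))
      (by
        rw [← hf, tmul_smul, mul_one, hom_tmul, hf]
        refine Finset.smul_sum.trans (Finset.sum_congr rfl fun p _ => ?_)
        rw [smul_tmul, ← map_mul, path_mul_vertexHom, map_smul π, tmul_const_smul]) hp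
  let T : QPath V → N →+ N' := fun p => if hp : p ∈ paths V 1 then
    AddMonoidHom.mk' (fun y => z y p) (fun y y' => hadd y y' p hp) else 0
  have hT : ∀ p ∈ paths V 1, ∀ y, T p y = z y p := fun p hp y =>
    DFunLike.congr_fun (dif_pos hp) y
  have hT0 : ∀ p ∉ paths V 1, T p = 0 := fun p hp => dif_neg hp
  refine ⟨T, fun p y => ?_, fun p r y => ?_, fun y => ?_⟩
  · by_cases hp : p ∈ paths V 1
    · rw [hT p hp]
      convert hz y p
    · rw [hT0 p hp]
      exact smul_zero _
  · by_cases hp : p ∈ paths V 1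
    · rw [hT p hp, hT p hp, hsmul r y p hp]
    · rw [hT0 p hp]
      exact (smul_zero _).symm
  · rw [hf]
    exact Finset.sum_congr rfl fun p hp => by rw [hT p hp]

lemma comp_eq_of_conj {C : Type*} [Category C] {A B D A' B' D' : C} (ε : A ≅ B) (μ : B ≅ D)
    (ε' : A' ≅ B') (μ' : B' ≅ D') {d : D ⟶ D'} {δ : A ⟶ A'}
    (h : (μ.hom ≫ d ≫ μ'.inv) ≫ ε'.inv = ε.inv ≫ δ) :
    (ε ≪≫ μ).hom ≫ d = δ ≫ (ε' ≪≫ μ').hom := by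
  rw [← cancel_epi ε.inv, ← cancel_mono (ε' ≪≫ μ').inv]
  simpa using h

lemma iterD_naturality {C : Type*} [Category C] {X X' : ℤ → C} (d : ∀ i, X i ⟶ X (i + 1))
    (d' : ∀ i, X' i ⟶ X' (i + 1)) (ψ : ∀ i, X i ⟶ X' i) (h : ∀ i, ψ i ≫ d' i = d i ≫ ψ (i + 1))
    (r : ℕ) (i j : ℤ) (hij : i + r = j) : ψ i ≫ iterD d' r i j hij = iterD d r i j hij ≫ ψ j := by
  induction r generalizing i with
  | zero =>
    obtain rfl : i = j := by simpa using hij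
    simp [iterD]
  | succ r ih => rw [iterD, iterD, ← Category.assoc, h, Category.assoc, ih, Category.assoc]

include hn hrel in
/-- Every linear `n`-complex is the linear complex of a graded `Λ^!`-module. -/
lemma LinearNComplex.exists_pathRep (P : LinearNComplex 𝓛 n) :
    ∃ (Y : PathRep K V) (hY : ∀ x ∈ perp n π, ∀ y : Y.carrier, x • y = 0)
      (ψ : ∀ k, (Y.complex hπ (show n ≠ 0 by omega) hY).X k ≅ P.X k),
      ∀ k, (ψ k).hom ≫ P.d k =
        (Y.complex hπ (show n ≠ 0 by omega) hY).d k ≫ (ψ (k + 1)).hom := by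
  classical
  let N : ℤ → Type u := fun k => GrMod.Comp hπ (P.X k) (-k)
  let μ : ∀ k, FreeMod.graded (N k) hπ (-k) ≅ P.X k := fun k =>
    GrMod.isoOfBijective (GrMod.mulMap hπ (P.X k) (-k))
      (GrMod.mulMap_bijective (P.projective k) (P.generated k))
  choose T h1 h2 h3 using fun k => FreeMod.exists_arrows hn hπ hrel (N := N k) (N' := N (k + 1))
    (d := -k) (d' := -(k + 1)) (by ring) ((μ k).hom ≫ P.d k ≫ (μ (k + 1)).inv)
  have hT := PathRep.isArrowAction_totalArrow (K := K) (T := T)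
    (fun {_} k p y => h1 k p y) h2
  let Y := PathRep.ofArrows hT
  let e : ∀ k, FreeMod.graded (N k) hπ (-k) ⟶ Y.obj hπ k := fun k =>
    FreeMod.mapHom (PathRep.ofArrowsEquiv hT k).toLinearMap
  let e' : ∀ k, Y.obj hπ k ⟶ FreeMod.graded (N k) hπ (-k) := fun k =>
    FreeMod.mapHom (PathRep.ofArrowsEquiv hT k).symm.toLinearMap
  let ε : ∀ k, Y.obj hπ k ≅ FreeMod.graded (N k) hπ (-k) := fun k =>
    { hom := e' k
      inv := e k
      hom_inv_id := by
        refine (FreeMod.mapHom_comp _ _).symm.trans ?_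
        rw [LinearEquiv.comp_symm, FreeMod.mapHom_id]
      inv_hom_id := by
        refine (FreeMod.mapHom_comp _ _).symm.trans ?_
        rw [LinearEquiv.symm_comp, FreeMod.mapHom_id] }
  have hd : ∀ k, ((μ k).hom ≫ P.d k ≫ (μ (k + 1)).inv) ≫ e (k + 1) = e k ≫ Y.diff hπ k := by
    intro k
    refine FreeMod.hom_ext fun y => ?_
    have ha := congrArg (e (k + 1)).toLin (h3 k y)
    have hb : (e k ≫ Y.diff hπ k).toLin (FreeMod.tmul π 1 y) =
        (Y.diff hπ k).toLin (FreeMod.tmul π 1 (PathRep.ofArrowsEquiv hT k y)) :=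
      congrArg (Y.diff hπ k).toLin (FreeMod.mapHom_tmul _ 1 y)
    refine ha.trans (Eq.trans ?_ (hb.trans (Y.diff_tmul_one hπ k _)).symm)
    rw [map_sum]
    refine Finset.sum_congr rfl fun p hp => (FreeMod.mapHom_tmul _ _ _).trans ?_
    congr 1
    refine Subtype.ext ?_
    rw [PathRep.move_path_val rfl hp]
    exact (PathRep.path_smul_ofArrowsEquiv hT (mem_paths.1 hp) y).symm
  have hψ : ∀ k, ((ε k) ≪≫ μ k).hom ≫ P.d k = Y.diff hπ k ≫ ((ε (k + 1)) ≪≫ μ (k + 1)).hom := by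
    exact fun k => comp_eq_of_conj (ε k) (μ k) (ε (k + 1)) (μ (k + 1)) (hd k)
  have hY : ∀ x ∈ perp n π, ∀ y : Y.carrier, x • y = 0 := by
    intro x hx y
    have hk : ∀ k (y : Y.deg k), x • y.1 = 0 := fun k y => by
      refine PathRep.smul_eq_zero_of_iterD hπ Y (by omega) (rfl : k + n = k + n) ?_ hx y
      have h4 := iterD_naturality (X := Y.obj hπ) (Y.diff hπ) P.d (fun k => ((ε k) ≪≫ μ k).hom)
        hψ n k _ rfl
      rw [P.d_iter, Limits.comp_zero] at h4
      rw [← cancel_mono ((ε (k + n)) ≪≫ μ (k + n)).hom, ← h4, Limits.zero_comp]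
    exact PathRep.ofArrows_induction hT (P := fun y => x • y = 0) y (smul_zero _)
      (fun y z hy hz => by rw [smul_add, hy, hz, add_zero]) hk
  exact ⟨Y, hY, fun k => ε k ≪≫ μ k, hψ⟩

instance : (toYo m hn hπ hrel).EssSurj where
  mem_essImage C := by
    obtain ⟨⟨P, ⟨γ⟩⟩, -, hrad⟩ := C.property
    obtain ⟨Y, hY, ψ, hψ⟩ := P.exists_pathRep hn hπ hrel
    let φ : (Y.complex hπ (show n ≠ 0 by omega) hY).contract hn m ≅ P.contract hn m :=
      HomologicalComplex.Hom.isoOfComponents (fun j => ψ (idx n m j)) (by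
        rintro i _ rfl
        rw [LinearNComplex.contract_d]
        refine Eq.trans ?_ (congrArg (· ≫ (ψ (idx n m (i + 1))).hom)
          (LinearNComplex.contract_d hn _ i)).symm
        exact iterD_naturality _ _ (fun k => (ψ k).hom) hψ _ _ _ _)
    exact ⟨⟨Y, hY, fun h2 => (PathRep.kerInRadical_iff hπ hrel hn Y hY (m := m)).1
      (KerInRadical.of_iso (φ ≪≫ γ).symm (hrad h2))⟩, ⟨ObjectProperty.isoMk _ (φ ≪≫ γ)⟩⟩

instance : (toYo m hn hπ hrel).IsEquivalence where

end EssSurj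

/-! ### From linear representations to modules over the truncated dual algebra -/

section ToLo

variable {K V L : Type u} [Field K] [Quiver.{u} V] [Fintype V] [Ring L] [Algebra K L]
  {n : ℕ} {π : PathAlg K V →ₐ[K] L} {m : ℤ}

/-- If `i ∈ -S` and `i + u + v ∈ -S` with `u, v ∈ U`, then `u + v ∈ U` exactly if `i + u ∈ -S`. -/
lemma add_mem_suppSet_iff {i u v : ℤ} (hi : i ∈ suppDeg n m) (hu : u ∈ suppSet n)
    (hv : v ∈ suppSet n) (h : i + u + v ∈ suppDeg n m) :
    u + v ∈ suppSet n ↔ i + u ∈ suppDeg n m := by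
  have h1 : -(i + u + v) - m + v + u ∈ suppSet n := by
    rwa [show -(i + u + v) - m + v + u = -i - m by ring]
  have h2 : i + u ∈ suppDeg n m ↔ -(i + u + v) - m + v ∈ suppSet n := by
    rw [show -(i + u + v) - m + v = -(i + u) - m by ring]
    rfl
  rw [h2, add_comm u v]
  exact ⟨fun h3 => suppSet_assoc' h hv hu h3 h1, fun h3 => suppSet_assoc h hv hu h3 h1⟩

namespace LinRep

variable (Y : LinRep n π m)

/-- A linear representation as a right module over `Λ^!`. -/
def dualAct : DualAlg n π →+* (AddMonoid.End Y.carrier)ᵐᵒᵖ :=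
  RingQuot.lift ⟨(Module.toAddMonoidEnd (PathAlg K V) Y.carrier).op, by
    rintro a b ⟨ha, rfl⟩
    rw [map_zero]
    refine congrArg MulOpposite.op (AddMonoidHom.ext fun y => ?_)
    exact Y.perp_smul _ ha y⟩

lemma dualAct_toDual (p : PathAlg K V) (y : Y.carrier) :
    (Y.dualAct (toDual n π p)).unop y = p • y := by
  have : Y.dualAct (toDual n π p) = MulOpposite.op (Module.toAddMonoidEnd (PathAlg K V) _ p) := by
    change RingQuot.lift _ (RingQuot.mkAlgHom K (DualRel n π) (MulOpposite.op p)) = _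
    have h : RingQuot.mkAlgHom K (DualRel n π) (MulOpposite.op p) =
        RingQuot.mkRingHom (DualRel n π) (MulOpposite.op p) :=
      RingHom.congr_fun (RingQuot.mkAlgHom_coe K _) _
    rw [h]
    exact RingQuot.lift_mkRingHom_apply _ _ _
  rw [this]
  rfl

lemma dualAct_mem {i j u : ℤ} (h : i + u = j) {a : DualAlg n π} (ha : a ∈ dualDeg n π u)
    {y : Y.carrier} (hy : y ∈ Y.deg i) : (Y.dualAct a).unop y ∈ Y.deg j := by
  obtain ⟨p, hp, rfl⟩ := ha
  rw [dualAct_toDual]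
  exact Y.smul_mem' h hp hy

/-- The sum of the components with degree in `-S`. -/
abbrev Trunc : Type u := ⨁ s : suppDeg n m, Y.deg s.1

open scoped Classical in
/-- Auxiliary: the action of an element of degree `u` of `Λ^!` on a component; its values outside
the degrees in `-S` are replaced by zero. -/
def homAct (s : suppDeg n m) (u : ℤ) : dualDeg n π u →+ Y.deg s.1 →+ Y.Trunc :=
  AddMonoidHom.mk' (fun a => if h : s.1 + u ∈ suppDeg n m then
      (DirectSum.of (fun s : suppDeg n m => Y.deg s.1) ⟨s.1 + u, h⟩).comp
        (AddMonoidHom.mk' (fun y => ⟨(Y.dualAct a.1).unop y.1, Y.dualAct_mem rfl a.2 y.2⟩)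
          fun _ _ => Subtype.ext (map_add _ _ _))
      else 0) fun a b => by
    split_ifs with h
    · refine AddMonoidHom.ext fun y => ?_
      refine Eq.trans ?_ (map_add (DirectSum.of _ _) _ _)
      refine congrArg (DirectSum.of (fun s : suppDeg n m => Y.deg s.1) ⟨s.1 + u, h⟩)
        (Subtype.ext ?_)
      change (Y.dualAct (a.1 + b.1)).unop y.1 = _
      rw [map_add]
      rfl
    · rw [add_zero]

/-- The truncated action of `Λ^!` on the sum of the components with degree in `-S`. -/
def truncAct : DualAlg n π →+ Y.Trunc →+ Y.Trunc :=
  AddMonoidHom.mk' (fun a => DirectSum.toAddMonoid fun s =>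
      DirectSum.toAddMonoid (Y.homAct s) (decompose (dualDeg n π) a)) fun a b => by
    refine DirectSum.addHom_ext fun s y => ?_
    rw [AddMonoidHom.add_apply]
    simp only [DirectSum.toAddMonoid_of]
    rw [decompose_add, map_add]
    rfl

variable {Y}

/-- The inclusion of a component. -/
def incl (s : suppDeg n m) : Y.deg s.1 →+ Y.Trunc :=
  DirectSum.of (fun s : suppDeg n m => Y.deg s.1) s

lemma incl_injective (s : suppDeg n m) : Function.Injective (incl (Y := Y) s) :=
  DirectSum.of_injective s

@[elab_as_elim]
lemma trunc_induction {P : Y.Trunc → Prop} (x : Y.Trunc) (zero : P 0)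
    (incl : ∀ s y, P (incl s y)) (add : ∀ x y, P x → P y → P (x + y)) : P x :=
  DirectSum.induction_on (motive := P) x zero incl add

variable (Y) in
/-- The components of the truncation. -/
def truncDeg (i : ℤ) : AddSubgroup Y.Trunc where
  carrier := {x | ∀ s : suppDeg n m, s.1 ≠ i → x s = 0}
  zero_mem' _ _ := rfl
  add_mem' {x y} hx hy s hs := by
    change x s + y s = 0
    rw [hx s hs, hy s hs, add_zero]
  neg_mem' {x} hx s hs := by
    change -x s = 0
    rw [hx s hs, neg_zero]

lemma incl_mem (s : suppDeg n m) (y : Y.deg s.1) : incl s y ∈ Y.truncDeg s.1 := fun _ h =>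
  DirectSum.of_eq_of_ne (β := fun s : suppDeg n m => Y.deg s.1) _ _ _
    fun h' => h (congrArg Subtype.val h')

lemma eq_incl {s : suppDeg n m} {x : Y.Trunc} (hx : x ∈ Y.truncDeg s.1) : x = incl s (x s) := by
  refine DFinsupp.ext fun s' => ?_
  by_cases h : s' = s
  · subst h
    exact (DirectSum.of_eq_same (β := fun s : suppDeg n m => Y.deg s.1) _ _).symm
  · refine (hx s' fun h' => h (Subtype.ext h')).trans ?_
    exact (DirectSum.of_eq_of_ne (β := fun s : suppDeg n m => Y.deg s.1) _ _ _ h).symm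

lemma eq_zero_of_mem_truncDeg {i : ℤ} (hi : i ∉ suppDeg n m) {x : Y.Trunc}
    (hx : x ∈ Y.truncDeg i) : x = 0 :=
  DFinsupp.ext fun s => hx s fun h => hi (h ▸ s.2)

instance : DirectSum.Decomposition Y.truncDeg :=
  DirectSum.Decomposition.ofAddHom _
    (DirectSum.toAddMonoid fun s => (DirectSum.of (fun i => Y.truncDeg i) s.1).comp
      ((incl s).codRestrict _ (incl_mem s)))
    (by
      refine DirectSum.addHom_ext fun s y => ?_
      rw [AddMonoidHom.comp_apply, DirectSum.toAddMonoid_of, AddMonoidHom.comp_apply,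
        DirectSum.coeAddMonoidHom_of]
      rfl)
    (by
      refine DirectSum.addHom_ext fun i x => ?_
      rw [AddMonoidHom.comp_apply, DirectSum.coeAddMonoidHom_of]
      by_cases hi : i ∈ suppDeg n m
      · have hx := eq_incl (s := ⟨i, hi⟩) x.2
        rw [hx]
        refine (DirectSum.toAddMonoid_of _ _ _).trans ?_
        exact congrArg (DirectSum.of (fun i => Y.truncDeg i) i) (Subtype.ext hx.symm)
      · obtain rfl : x = 0 := Subtype.ext (eq_zero_of_mem_truncDeg hi x.2)
        rw [map_zero]
        exact map_zero _)

lemma truncAct_incl {u : ℤ} {a : DualAlg n π} (ha : a ∈ dualDeg n π u) (s : suppDeg n m)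
    (y : Y.deg s.1) : Y.truncAct a (incl s y) = Y.homAct s u ⟨a, ha⟩ y := by
  refine (DirectSum.toAddMonoid_of (β := fun s : suppDeg n m => Y.deg s.1) _ s y).trans ?_
  rw [decompose_of_mem (dualDeg n π) ha, DirectSum.toAddMonoid_of]

lemma truncAct_notMem {u : ℤ} {a : DualAlg n π} (ha : a ∈ dualDeg n π u) {s : suppDeg n m}
    (h : s.1 + u ∉ suppDeg n m) (y : Y.deg s.1) : Y.truncAct a (incl s y) = 0 := by
  rw [truncAct_incl ha]
  exact DFunLike.congr_fun (dif_neg h) y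

variable [∀ i j : V, Finite (i ⟶ j)]

lemma truncAct_toDual {u : ℤ} {p : PathAlg K V} (hp : p ∈ pathDeg K V u) {s s' : suppDeg n m}
    (h : s.1 + u = s'.1) (y : Y.deg s.1) :
    Y.truncAct (toDual n π p) (incl s y) = incl s' (PathRep.move s'.1 p y) := by
  obtain ⟨s', hs'⟩ := s'
  obtain rfl : s.1 + u = s' := h
  rw [truncAct_incl (toDual_mem n π hp)]
  refine (DFunLike.congr_fun (dif_pos hs') y).trans ?_
  refine congrArg (incl ⟨s.1 + u, hs'⟩) (Subtype.ext ?_)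
  rw [PathRep.move_val rfl hp]
  exact Y.dualAct_toDual p y

lemma truncAct_mul (t t' : TruncAlg n (dualDeg n π)) (x : Y.Trunc) :
    Y.truncAct (TruncAlg.val _ _ (t * t')) x =
      Y.truncAct (TruncAlg.val _ _ t') (Y.truncAct (TruncAlg.val _ _ t) x) := by
  induction x using trunc_induction with
  | zero => simp only [map_zero]
  | add x y hx hy => simp only [map_add, hx, hy]
  | incl s y =>
    induction t using TruncAlg.induction with
    | zero => simp only [zero_mul, map_zero, AddMonoidHom.zero_apply]
    | add t t₁ h h₁ => simp only [add_mul, map_add, AddMonoidHom.add_apply, h, h₁]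
    | hom u hu a ha =>
      induction t' using TruncAlg.induction with
      | zero => simp only [mul_zero, map_zero, AddMonoidHom.zero_apply]
      | add t t₁ h h₁ => simp only [mul_add, map_add, AddMonoidHom.add_apply, h, h₁]
      | hom v hv b hb =>
        rw [TruncAlg.proj_mul_proj hu hv ha hb, TruncAlg.val_proj_of_mem hu ha,
          TruncAlg.val_proj_of_mem hv hb]
        obtain ⟨p, hp, rfl⟩ := ha
        obtain ⟨q, hq, rfl⟩ := hb
        have hqp : q * p ∈ pathDeg K V (u + v) := mul_mem_pathDeg' (add_comm v u) hq hp
        rw [← toDual_mul]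
        by_cases h1 : s.1 + u + v ∈ suppDeg n m
        · by_cases h2 : s.1 + u ∈ suppDeg n m
          · have h3 := (add_mem_suppSet_iff s.2 hu hv h1).2 h2
            rw [TruncAlg.val_proj_of_mem h3 (toDual_mem n π hqp),
              truncAct_toDual hqp (s' := ⟨_, h1⟩) (add_assoc _ _ _).symm,
              truncAct_toDual hp (s' := ⟨_, h2⟩) rfl, truncAct_toDual hq (s' := ⟨_, h1⟩) rfl,
              ← PathRep.move_mul (by rwa [add_sub_cancel_left]) (by rwa [add_sub_cancel_left])]
          · have h3 := mt (add_mem_suppSet_iff s.2 hu hv h1).1 h2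
            rw [TruncAlg.proj_of_notMem h3 (toDual_mem n π hqp),
              truncAct_notMem (toDual_mem n π hp) h2, map_zero, map_zero]
            rfl
        · have h4 : Y.truncAct (TruncAlg.val n (dualDeg n π) (TruncAlg.proj n _
              (toDual n π (q * p)))) (incl s y) = 0 := by
            by_cases h3 : u + v ∈ suppSet n
            · rw [TruncAlg.val_proj_of_mem h3 (toDual_mem n π hqp)]
              exact truncAct_notMem (toDual_mem n π hqp) (by rwa [← add_assoc]) y
            · rw [TruncAlg.proj_of_notMem h3 (toDual_mem n π hqp), map_zero, map_zero]
              rfl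
          rw [h4]
          by_cases h2 : s.1 + u ∈ suppDeg n m
          · rw [truncAct_toDual hp (s' := ⟨_, h2⟩) rfl]
            exact (truncAct_notMem (toDual_mem n π hq) h1 _).symm
          · rw [truncAct_notMem (toDual_mem n π hp) h2, map_zero]

variable (Y) in
/-- The truncation as a module over `Λ^!_U`. -/
instance truncModule : Module (TruncAlg n (dualDeg n π))ᵐᵒᵖ Y.Trunc where
  smul t x := Y.truncAct (TruncAlg.val _ _ t.unop) x
  one_smul x := by
    change Y.truncAct (TruncAlg.val _ _ 1) x = x
    rw [TruncAlg.val_one, ← toDual_one]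
    induction x using trunc_induction with
    | zero => rw [map_zero]
    | add x y hx hy => rw [map_add, hx, hy]
    | incl s y =>
      rw [truncAct_toDual one_mem_pathDeg (add_zero _), ← map_one vertexHom,
        PathRep.move_vertexHom, one_smul]
  mul_smul t t' x := Y.truncAct_mul t'.unop t.unop x
  smul_zero t := map_zero _
  smul_add t := map_add _
  add_smul t t' x := by
    change Y.truncAct (TruncAlg.val _ _ (t.unop + t'.unop)) x = _
    rw [map_add, map_add]
    rfl
  zero_smul x := by
    change Y.truncAct (TruncAlg.val _ _ 0) x = _
    rw [map_zero, map_zero]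
    rfl

lemma bar_smul {u : ℤ} (hu : u ∈ suppSet n) {p : PathAlg K V} (hp : p ∈ pathDeg K V u)
    (x : Y.Trunc) : MulOpposite.op (bar n π p) • x = Y.truncAct (toDual n π p) x := by
  change Y.truncAct (TruncAlg.val _ _ (TruncAlg.proj _ _ (toDual n π p))) x = _
  rw [TruncAlg.val_proj_of_mem hu (toDual_mem n π hp)]

variable (Y) in
/-- The truncation of a linear representation to the degrees in `-S`, as a graded module. -/
def trunc : GrDualU n π where
  carrier := Y.Trunc
  deg := Y.truncDeg
  smul_mem {i j x t} hx ht := by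
    change Y.truncAct (TruncAlg.val _ _ t) x ∈ Y.truncDeg (i + j)
    have ht' : TruncAlg.val _ _ t ∈ dualDeg n π j := ht
    by_cases hi : i ∈ suppDeg n m
    · rw [eq_incl (s := ⟨i, hi⟩) hx]
      by_cases hj : i + j ∈ suppDeg n m
      · obtain ⟨p, hp, hpt⟩ := ht'
        rw [← hpt, truncAct_toDual hp (s' := ⟨i + j, hj⟩) rfl]
        exact incl_mem (Y := Y) ⟨i + j, hj⟩ _
      · rw [truncAct_notMem ht' hj]
        exact zero_mem _
    · rw [eq_zero_of_mem_truncDeg hi hx, map_zero]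
      exact zero_mem _

end LinRep

/-! ### The degrees in `-(S : U)` -/

lemma suppSet_two (k : ℤ) : k ∈ suppSet 2 := by
  rcases Int.even_or_odd k with ⟨c, rfl⟩ | ⟨c, rfl⟩
  · exact Or.inl ⟨c, by push_cast; ring⟩
  · exact Or.inr ⟨c, by push_cast; ring⟩

lemma mem_shiftSet {z : ℤ} : z ∈ shiftSet n m ↔ z - m ∈ suppSet n := by
  constructor
  · rintro ⟨t, ht, rfl⟩
    rwa [add_sub_cancel_left]
  · exact fun h => ⟨z - m, h, add_sub_cancel _ _⟩

lemma neg_mem_colon_of_dvd {i : ℤ} (h : (n : ℤ) ∣ i + m) :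
    -i ∈ colon (shiftSet n m) (suppSet n) := fun t ht => by
  rw [mem_shiftSet, show -i + t - m = -(i + m) + t by ring]
  exact (add_mem_suppSet ((dvd_neg).2 h)).2 ht

lemma mem_colon_two (i : ℤ) : i ∈ colon (shiftSet 2 m) (suppSet 2) := fun _ _ =>
  mem_shiftSet.2 (suppSet_two _)

lemma dvd_of_neg_mem_colon (hn : 2 < n) {i : ℤ} (h : -i ∈ colon (shiftSet n m) (suppSet n)) :
    (n : ℤ) ∣ i + m := by
  have h0 := mem_shiftSet.1 (h 0 (zero_mem_suppSet n))
  have h1 := mem_shiftSet.1 (h 1 (one_mem_suppSet n))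
  rcases h0 with h0 | h0
  · rw [show i + m = -(-i + 0 - m) by ring]
    exact (dvd_neg).2 h0
  rcases h1 with h1 | h1
  · have h2 := Int.le_of_dvd (by norm_num) (show (n : ℤ) ∣ 2 by
      rw [show (2 : ℤ) = -i + 1 - m - (-i + 0 - m - 1) by ring]
      exact dvd_sub h1 h0)
    omega
  · rw [show i + m = -(-i + 1 - m - 1) by ring]
    exact (dvd_neg).2 h1

/-- If `i, j ∈ -S` and `j - i ∉ U`, then `j - i ∈ nℤ - 1`. -/
lemma dvd_of_sub_notMem_suppSet {i j : ℤ} (hi : i ∈ suppDeg n m) (hj : j ∈ suppDeg n m)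
    (hu : j - i ∉ suppSet n) : (n : ℤ) ∣ i + m ∧ (n : ℤ) ∣ j + m + 1 := by
  rcases hi with hi | hi <;> rcases hj with hj | hj
  · exact absurd (Or.inl (by
      rw [show j - i = -i - m - (-j - m) by ring]
      exact dvd_sub hi hj)) hu
  · exact ⟨by rw [show i + m = -(-i - m) by ring]; exact (dvd_neg).2 hi,
      by rw [show j + m + 1 = -(-j - m - 1) by ring]; exact (dvd_neg).2 hj⟩
  · refine absurd (Or.inr ?_) hu
    rw [show j - i - 1 = (-i - m - 1) - (-j - m) by ring]
    exact dvd_sub hi hj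
  · exact absurd (Or.inl (by
      rw [show j - i = -i - m - 1 - (-j - m - 1) by ring]
      exact dvd_sub hi hj)) hu

lemma mem_suppDeg_of_dvd {i : ℤ} (h : (n : ℤ) ∣ i + m) : i ∈ suppDeg n m := Or.inl (by
  rw [show -i - m = -(i + m) by ring]
  exact (dvd_neg).2 h)

/-! ### The tensor products `M ⊗ KQ_k` -/

lemma TensPath.map_tmul {M N : Type u} [AddCommGroup M] [Module (V → K) M]
    [AddCommGroup N] [Module (V → K) N] (f : M →ₗ[V → K] N) {k : ℤ} (x : M) (y : pathDeg K V k) :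
    TensPath.map f k (TensPath.tmul x y) = TensPath.tmul (f x) y := LinearMap.rTensor_tmul ..

lemma TensPath.map_map {M N P : Type u} [AddCommGroup M] [Module (V → K) M]
    [AddCommGroup N] [Module (V → K) N] [AddCommGroup P] [Module (V → K) P] (f : M →ₗ[V → K] N)
    (g : N →ₗ[V → K] P) {k : ℤ} (t : TensPath K V M k) :
    TensPath.map g k (TensPath.map f k t) = TensPath.map (g ∘ₗ f) k t :=
  (LinearMap.rTensor_comp_apply _ g f t).symm

lemma TensPath.concat_map_map {M N : Type u} [AddCommGroup M] [Module (V → K) M]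
    [AddCommGroup N] [Module (V → K) N] (f : M →ₗ[V → K] N) {k l j : ℤ} (h : k + l = j)
    (t : TensPath K V (TensPath K V M k) l) :
    TensPath.concat (K := K) (V := V) h (TensPath.map (TensPath.map f k) l t) =
      TensPath.map f j (TensPath.concat (K := K) (V := V) h t) := by
  induction t using TensPath.induction with
  | zero => simp only [map_zero]
  | add s t hs ht => simp only [map_add, hs, ht]
  | tmul t q =>
    rw [TensPath.map_tmul]
    induction t using TensPath.induction with
    | zero => simp only [map_zero, TensPath.zero_tmul]
    | add s t hs ht => simp only [map_add, TensPath.add_tmul, hs, ht]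
    | tmul x p => rw [TensPath.map_tmul, TensPath.concat_tmul, TensPath.concat_tmul,
        TensPath.map_tmul]

/-! ### The truncation is an object of `L°(S, U)` -/

variable [∀ i j : V, Finite (i ⟶ j)]

namespace LinRep

variable {Y : LinRep n π m}

lemma act_incl {u : ℤ} (hu : u ∈ suppSet n) {s s' : suppDeg n m} (h : s.1 + u = s'.1)
    (p : pathDeg K V u) (y : Y.deg s.1) :
    Y.trunc.act h p ⟨incl s y, incl_mem s y⟩ =
      ⟨incl s' (PathRep.move s'.1 p.1 y), incl_mem s' _⟩ :=
  Subtype.ext ((bar_smul hu p.2 _).trans (truncAct_toDual p.2 h y))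

variable (Y) in
/-- The components of the truncation are those of the linear representation. -/
def inclEquiv (s : suppDeg n m) : Y.deg s.1 ≃ₗ[V → K] Y.trunc.deg s.1 :=
  LinearEquiv.ofBijective
    { toFun := fun y => (⟨incl s y, incl_mem s y⟩ : Y.trunc.deg s.1)
      map_add' := fun _ _ => Subtype.ext (map_add (incl s) _ _)
      map_smul' := fun r y => by
        refine Eq.trans ?_ (act_incl (zero_mem_suppSet n) (add_zero s.1)
          ⟨vertexHom r, vertexSum_mem r⟩ y).symm
        rw [PathRep.move_vertexHom] }
    ⟨fun _ _ h => incl_injective s (congrArg Subtype.val h), fun x =>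
      ⟨(show Y.Trunc from x.1) s, Subtype.ext (eq_incl x.2).symm⟩⟩

lemma act_inclEquiv {u : ℤ} (hu : u ∈ suppSet n) {s s' : suppDeg n m} (h : s.1 + u = s'.1)
    (p : pathDeg K V u) (y : Y.deg s.1) :
    Y.trunc.act h p (Y.inclEquiv s y) = Y.inclEquiv s' (PathRep.move s'.1 p.1 y) :=
  act_incl hu h p y

variable (Y) in
lemma trunc_cogeneratedIn (hn : 2 ≤ n) :
    Y.trunc.CogeneratedIn {i | -i ∈ colon (shiftSet n m) (suppSet n)} := by
  intro N hN hne
  obtain ⟨x, hx, hx0⟩ := (Submodule.ne_bot_iff N).1 hne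
  obtain ⟨i, hi⟩ : ∃ i, Y.trunc.part i x ≠ 0 := by
    by_contra! hc
    exact hx0 (GrMod.mem_of_part_mem (M := Y.trunc) ⊥ hc)
  have hmem : Y.trunc.part i x ∈ N := hN i hx
  have hdeg : Y.trunc.part i x ∈ Y.trunc.deg i := GrMod.part_mem _ i x
  generalize Y.trunc.part i x = z at hi hmem hdeg
  have his : i ∈ suppDeg n m := by_contra fun h => hi (eq_zero_of_mem_truncDeg h hdeg)
  obtain ⟨y, hy⟩ := (Y.inclEquiv ⟨i, his⟩).surjective ⟨z, hdeg⟩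
  obtain rfl : incl ⟨i, his⟩ y = z := congrArg Subtype.val hy
  -- it suffices to find a nonzero element of `N` in a degree of the set
  suffices h : ∃ j, -j ∈ colon (shiftSet n m) (suppSet n) ∧ ∃ z ∈ N, z ∈ Y.trunc.deg j ∧ z ≠ 0 by
    obtain ⟨j, hj, z, hz, hzj, hz0⟩ := h
    refine ⟨j, hj, fun hbot => hz0 ?_⟩
    have h1 : z ∈ Y.trunc.deg j ⊓ N.toAddSubgroup := ⟨hzj, hz⟩
    rw [hbot] at h1
    exact h1
  by_cases hcol : -i ∈ colon (shiftSet n m) (suppSet n)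
  · exact ⟨i, hcol, _, hmem, hdeg, hi⟩
  have hn2 : 2 < n := by
    rcases hn.lt_or_eq with h | rfl
    · exact h
    · exact absurd (mem_colon_two _) hcol
  have hdvd : (n : ℤ) ∣ i + m + 1 := by
    rcases his with h | h
    · refine absurd (neg_mem_colon_of_dvd ?_) hcol
      rw [show i + m = -(-i - m) by ring]
      exact (dvd_neg).2 h
    · rw [show i + m + 1 = -(-i - m - 1) by ring]
      exact (dvd_neg).2 h
  obtain ⟨p, hp, hpy⟩ : ∃ p ∈ pathDeg K V 1, p • y.1 ≠ 0 := by
    by_contra! hc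
    refine hi ?_
    obtain rfl : y = 0 := Subtype.ext (Y.torsion_free hn2 i hdvd y.1 y.2 hc)
    exact map_zero _
  have hdvd' : (n : ℤ) ∣ i + 1 + m := by rwa [show i + 1 + m = i + m + 1 by ring]
  have hi1 : i + 1 ∈ suppDeg n m := mem_suppDeg_of_dvd hdvd'
  have hact := act_incl (one_mem_suppSet n) (s := ⟨i, his⟩) (s' := ⟨i + 1, hi1⟩) rfl ⟨p, hp⟩ y
  refine ⟨i + 1, neg_mem_colon_of_dvd hdvd', _,
    N.smul_mem (MulOpposite.op (bar n π p)) hmem, ?_, ?_⟩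
  · exact (Y.trunc.act (i := i) (j := i + 1) rfl ⟨p, hp⟩ ⟨_, hdeg⟩).2
  · intro h0
    have h1 : incl ⟨i + 1, hi1⟩ (PathRep.move (i + 1) p y) = 0 :=
      (congrArg Subtype.val hact).symm.trans h0
    have h2 : PathRep.move (i + 1) p y = 0 := incl_injective _ (h1.trans (map_zero _).symm)
    refine hpy ?_
    rw [← PathRep.move_val rfl hp, h2]
    rfl

end LinRep

namespace PathRep

variable {Y : PathRep K V}

variable (Y) in
/-- The map `Y_i → Y_j ⊗ KQ_k`, `y ↦ ∑ p y ⊗ p`, where `p` runs through the paths of length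
`k = j - i`. -/
def comul {i j k : ℤ} (h : i + k = j) : Y.deg i →ₗ[V → K] TensPath K V (Y.deg j) k where
  toFun y := ∑ p ∈ paths V k, TensPath.tmul (move j (path p 1) y)
    ⟨component k (path p 1), component_mem _ _⟩
  map_add' y z := by
    rw [← Finset.sum_add_distrib]
    refine Finset.sum_congr rfl fun p _ => ?_
    rw [map_add, TensPath.add_tmul]
  map_smul' r y := by
    rw [RingHom.id_apply, Finset.smul_sum]
    refine Finset.sum_congr rfl fun p hp => ?_
    have hp' := path_mem' (K := K) p (mem_paths.1 hp)
    have h1 : rightMul k r ⟨component k (path p 1), component_mem _ _⟩ =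
        (fun _ => r p.tgt : V → K) •
          (⟨component k (path p 1), component_mem _ _⟩ : pathDeg K V k) :=
      Subtype.ext (by
        change component k (path p 1) * vertexSum r =
          vertexSum (fun _ => r p.tgt) * component k (path p 1)
        rw [component_of_mem hp', path_mul_vertexSum, vertexSum_mul_path])
    rw [TensPath.smul_tmul, h1, ← TensPath.tmul_smul_left]
    congr 1
    refine Subtype.ext ?_
    rw [smul_val, move_path_val h hp, move_path_val h hp, smul_val, smul_smul, smul_smul,
      path_mul_vertexHom, vertexHom_const, ← Algebra.smul_def]

lemma comul_apply {i j k : ℤ} (h : i + k = j) (y : Y.deg i) :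
    Y.comul h y = ∑ p ∈ paths V k, TensPath.tmul (move j (path p 1) y)
      ⟨component k (path p 1), component_mem _ _⟩ := rfl

/-- Coassociativity. -/
lemma concat_comul {i j l v w u : ℤ} (hv : 0 ≤ v) (hw : 0 ≤ w) (hij : i + w = j) (hjl : j + v = l)
    (hu : v + w = u) (hil : i + u = l) (y : Y.deg i) :
    TensPath.concat (K := K) (V := V) hu (TensPath.map (Y.comul hjl) w (Y.comul hij y)) =
      Y.comul hil y := by
  rw [comul_apply hij, map_sum, map_sum]
  have h1 : ∀ q ∈ paths V w, TensPath.concat (K := K) (V := V) hu (TensPath.map (Y.comul hjl) w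
      (TensPath.tmul (move j (path q 1) y) ⟨component w (path q 1), component_mem _ _⟩)) =
      ∑ a ∈ paths V v, TensPath.tmul (move l (path a 1 * path q 1) y)
        ⟨component u (path a 1 * path q 1), component_mem _ _⟩ := by
    intro q hq
    rw [TensPath.map_tmul, comul_apply]
    have h2 : TensPath.tmul
        (∑ a ∈ paths V v, TensPath.tmul (move l (path a 1) (move j (path q 1) y))
        (⟨component v (path a 1), component_mem _ _⟩ : pathDeg K V v))
        (⟨component w (path q 1), component_mem _ _⟩ : pathDeg K V w) =
      ∑ a ∈ paths V v, TensPath.tmul (TensPath.tmul (move l (path a 1) (move j (path q 1) y))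
        (⟨component v (path a 1), component_mem _ _⟩ : pathDeg K V v))
        (⟨component w (path q 1), component_mem _ _⟩ : pathDeg K V w) :=
      TensorProduct.sum_tmul _ _ _
    rw [h2, map_sum]
    refine Finset.sum_congr rfl fun a ha => ?_
    have ha' := path_mem' (K := K) a (mem_paths.1 ha)
    have hq' := path_mem' (K := K) q (mem_paths.1 hq)
    rw [TensPath.concat_tmul]
    congr 1
    · refine Subtype.ext ?_
      rw [move_val hjl ha', move_val hij hq', move_val hil (mul_mem_pathDeg' hu ha' hq'), mul_smul]
    · refine Subtype.ext ?_
      change component v (path a 1) * component w (path q 1) = component u _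
      rw [component_of_mem ha', component_of_mem hq',
        component_of_mem (mul_mem_pathDeg' hu ha' hq')]
  rw [Finset.sum_congr rfl h1, Finset.sum_comm, comul_apply]
  refine sum_paths_concat hv hw hu (fun a q => TensPath.tmul (move l (path a 1 * path q 1) y)
    ⟨component u (path a 1 * path q 1), component_mem _ _⟩) (fun p =>
      TensPath.tmul (move l (path p 1) y) ⟨component u (path p 1), component_mem _ _⟩) ?_ ?_
  · intro a q haq
    simp only [path_mul_path, pathMul_of_eq haq]
  · intro a q haq
    simp only [path_mul_path, pathMul_of_ne haq]
    rw [zero_move, TensPath.zero_tmul]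

end PathRep

namespace LinRep

variable {Y : LinRep n π m}

lemma _root_.NKoszul.comul_eq_sum (X : GrDualU n π) {i j k : ℤ} (hk : k ∈ suppSet n)
    (h : i + k = j) (x : X.deg i) : comul X hk h x = ∑ p ∈ paths V k,
      TensPath.tmul (X.act h ⟨component k (path p 1), component_mem _ _⟩ x)
        ⟨component k (path p 1), component_mem _ _⟩ := by
  have := finite_paths V k
  let _ := Fintype.ofFinite {p : QPath V // (p.len : ℤ) = k}
  rw [Finset.sum_subtype (p := fun p : QPath V => (p.len : ℤ) = k) (paths V k)
    (fun p => mem_paths)]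
  refine Finset.sum_congr rfl fun p _ => ?_
  have hp : (⟨path p.1 1, path_mem' p.1 p.2⟩ : pathDeg K V k) =
      ⟨component k (path p.1 1), component_mem _ _⟩ :=
    Subtype.ext (component_of_mem (path_mem' p.1 p.2)).symm
  rw [hp]

/-- The comultiplication of the truncation comes from the linear representation. -/
lemma comul_inclEquiv {u : ℤ} (hu : u ∈ suppSet n) {s s' : suppDeg n m} (h : s.1 + u = s'.1)
    (y : Y.deg s.1) : comul Y.trunc hu h (Y.inclEquiv s y) =
      TensPath.map (Y.inclEquiv s').toLinearMap u (Y.comul h y) := by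
  rw [PathRep.comul_apply, map_sum, comul_eq_sum]
  refine Finset.sum_congr rfl fun p hp => ?_
  rw [TensPath.map_tmul, act_inclEquiv hu h]
  exact congrArg (fun z => TensPath.tmul (Y.inclEquiv s' (PathRep.move s'.1 z y))
    (⟨component u (path p 1), component_mem _ _⟩ : pathDeg K V u))
    (component_of_mem (path_mem' p (mem_paths.1 hp)))

variable (Y) in
lemma trunc_canComplete (hn : 2 ≤ n) (k : ℤ) : CanComplete Y.trunc m k := by
  let s₀ : suppDeg n m := ⟨-m - (k + 1) * n, Or.inl ⟨k + 1, by ring⟩⟩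
  let s₁ : suppDeg n m := ⟨-m - k * n - 1, Or.inr ⟨k, by ring⟩⟩
  let s₂ : suppDeg n m := ⟨-m - k * n, Or.inl ⟨k, by ring⟩⟩
  have h01 : s₀.1 + ((n : ℤ) - 1) = s₁.1 := by
    change -m - (k + 1) * n + ((n : ℤ) - 1) = -m - k * n - 1
    ring
  have h12 : s₁.1 + 1 = s₂.1 := sub_add_cancel _ _
  have h02 : s₀.1 + n = s₂.1 := by
    change -m - (k + 1) * n + (n : ℤ) = -m - k * n
    ring
  refine ⟨TensPath.map (Y.inclEquiv s₁).toLinearMap _ ∘ₗ Y.comul h01 ∘ₗ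
    (Y.inclEquiv s₀).symm.toLinearMap, LinearMap.ext fun x => ?_⟩
  obtain ⟨y, rfl⟩ := (Y.inclEquiv s₀).surjective x
  have e1 : comul Y.trunc (one_mem_suppSet n) h12 ∘ₗ (Y.inclEquiv s₁).toLinearMap =
      TensPath.map (Y.inclEquiv s₂).toLinearMap 1 ∘ₗ Y.comul h12 :=
    LinearMap.ext fun z => comul_inclEquiv (one_mem_suppSet n) h12 z
  refine Eq.trans ?_ (comul_inclEquiv (self_mem_suppSet n) h02 y).symm
  rw [← PathRep.concat_comul zero_le_one (by omega) h01 h12 (add_sub_cancel 1 (n : ℤ)) h02 y,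
    ← TensPath.concat_map_map, TensPath.map_map, ← e1, ← TensPath.map_map]
  have e2 : (Y.inclEquiv s₀).symm (Y.inclEquiv s₀ y) = y := LinearEquiv.symm_apply_apply _ y
  conv_rhs => rw [← e2]
  rfl

end LinRep

end ToLo

/-! ### Morphisms between truncations -/

section ToLo

variable {K V L : Type u} [Field K] [Quiver.{u} V] [Fintype V] [Ring L] [Algebra K L]
  {n : ℕ} {π : PathAlg K V →ₐ[K] L} {m : ℤ} [∀ i j : V, Finite (i ⟶ j)]

namespace LinRep

variable {Y Z : LinRep n π m}

/-- The map between the truncations given by a family of maps between the components. -/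
def truncAdd (f : ∀ i, i ∈ suppDeg n m → (Y.deg i →+ Z.deg i)) : Y.Trunc →+ Z.Trunc :=
  DirectSum.toAddMonoid fun s => (incl s).comp (f s.1 s.2)

omit [∀ i j : V, Finite (i ⟶ j)] in
lemma truncAdd_incl (f : ∀ i, i ∈ suppDeg n m → (Y.deg i →+ Z.deg i)) (s : suppDeg n m)
    (y : Y.deg s.1) : truncAdd f (incl s y) = incl s (f s.1 s.2 y) :=
  DirectSum.toAddMonoid_of _ _ _

lemma truncAdd_truncAct (f : Y ⟶ Z) (t : TruncAlg n (dualDeg n π)) (x : Y.Trunc) :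
    truncAdd (LinRep.Hom.app f) (Y.truncAct (TruncAlg.val _ _ t) x) =
      Z.truncAct (TruncAlg.val _ _ t) (truncAdd (LinRep.Hom.app f) x) := by
  induction t using TruncAlg.induction with
  | zero => simp only [map_zero, AddMonoidHom.zero_apply]
  | add t t' h h' => simp only [map_add, AddMonoidHom.add_apply, h, h']
  | hom u hu a ha =>
    rw [TruncAlg.val_proj_of_mem hu ha]
    induction x using trunc_induction with
    | zero => simp only [map_zero]
    | add x y hx hy => simp only [map_add, hx, hy]
    | incl s y =>
      by_cases h : s.1 + u ∈ suppDeg n m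
      · obtain ⟨p, hp, rfl⟩ := ha
        rw [truncAct_toDual hp (s' := ⟨_, h⟩) rfl, truncAdd_incl, truncAdd_incl,
          truncAct_toDual hp (s' := ⟨_, h⟩) rfl, LinRep.Hom.comm f]
      · rw [truncAct_notMem ha h, truncAdd_incl, truncAct_notMem ha h, map_zero]

/-- The morphism between the truncations that a morphism of linear representations induces. -/
def truncMap (f : Y ⟶ Z) : Y.trunc ⟶ Z.trunc where
  toLin :=
    { toFun := fun x => truncAdd (LinRep.Hom.app f) x
      map_add' := map_add _
      map_smul' := fun t x => truncAdd_truncAct f t.unop x }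
  map_mem {i x} hx := by
    by_cases hi : i ∈ suppDeg n m
    · rw [eq_incl (s := ⟨i, hi⟩) hx]
      exact (truncAdd_incl (LinRep.Hom.app f) ⟨i, hi⟩ _).symm ▸ incl_mem (Y := Z) ⟨i, hi⟩ _
    · rw [eq_zero_of_mem_truncDeg hi hx]
      exact (map_zero (truncAdd (LinRep.Hom.app f))).symm ▸ zero_mem _

lemma truncMap_inclEquiv (f : Y ⟶ Z) (s : suppDeg n m) (y : Y.deg s.1) :
    (truncMap f).toLin (Y.inclEquiv s y).1 = (Z.inclEquiv s (LinRep.Hom.app f s.1 s.2 y)).1 :=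
  truncAdd_incl _ s y

lemma trunc_hom_ext {X : GrDualU n π} {F G : Y.trunc ⟶ X}
    (h : ∀ s y, F.toLin (Y.inclEquiv s y).1 = G.toLin (Y.inclEquiv s y).1) : F = G := by
  refine GrMod.hom_ext (LinearMap.ext fun x => ?_)
  refine trunc_induction (P := fun x : Y.Trunc => F.toLin x = G.toLin x) x
    ((map_zero F.toLin).trans (map_zero G.toLin).symm) h fun x y hx hy => ?_
  refine (map_add F.toLin x y).trans ?_
  exact (congrArg₂ (· + ·) hx hy).trans (map_add G.toLin x y).symm

/-- Maps between the components with degree in `-S` that commute with the paths whose length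
belongs to `U` commute with all paths. The only other lengths to be considered are those in
`nℤ - 1`. -/
lemma comm_of_suppSet (hn : 2 ≤ n) (f : ∀ i, i ∈ suppDeg n m → (Y.deg i →+ Z.deg i))
    (h : ∀ i j (hi : i ∈ suppDeg n m) (hj : j ∈ suppDeg n m), j - i ∈ suppSet n →
      ∀ p ∈ pathDeg K V (j - i), ∀ x : Y.deg i,
      f j hj (PathRep.move j p x) = PathRep.move j p (f i hi x))
    (i j : ℤ) (hi : i ∈ suppDeg n m) (hj : j ∈ suppDeg n m) (p : PathAlg K V) (x : Y.deg i) :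
    f j hj (PathRep.move j p x) = PathRep.move j p (f i hi x) := by
  rw [← PathRep.move_component, ← PathRep.move_component (Y := Z.toPathRep)]
  have hp := component_mem (j - i) p
  generalize component (j - i) p = q at hp
  by_cases hu : j - i ∈ suppSet n
  · exact h i j hi hj hu q hp x
  have hi' := dvd_of_sub_notMem_suppSet hi hj hu
  have hn2 : 2 < n := by
    rcases hn.lt_or_eq with h | rfl
    · exact h
    · exact absurd (suppSet_two _) hu
  have hj1 : j + 1 ∈ suppDeg n m := mem_suppDeg_of_dvd (by
    rw [add_right_comm]
    exact hi'.2)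
  have hj1i : j + 1 - i ∈ suppSet n := Or.inl (by
    rw [show j + 1 - i = (j + m + 1) - (i + m) by ring]
    exact dvd_sub hi'.2 hi'.1)
  -- after the action of an arrow both sides agree
  refine sub_eq_zero.1 (Subtype.ext (Z.torsion_free hn2 j hi'.2 _
    (f j hj (PathRep.move j q x) - PathRep.move j q (f i hi x)).2 fun a ha => ?_))
  have ha1 : a ∈ pathDeg K V (j + 1 - j) := by rwa [add_sub_cancel_left]
  have haq : a * q ∈ pathDeg K V (j + 1 - i) := mul_mem_pathDeg' (by ring) ha hp
  rw [← PathRep.move_val rfl ha, map_sub, ← PathRep.move_mul ha1 hp,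
    ← h j (j + 1) hj hj1 (by rw [add_sub_cancel_left]; exact one_mem_suppSet n) a ha1,
    ← PathRep.move_mul ha1 hp, ← h i (j + 1) hi hj1 hj1i _ haq, sub_self]
  rfl

end LinRep

variable (π m) in
/-- The functor that takes a linear representation to its truncation. -/
def toLo (hn : 2 ≤ n) : LinRep n π m ⥤ (Lo n π m).FullSubcategory where
  obj Y := ⟨Y.trunc, Y.trunc_cogeneratedIn hn, Y.trunc_canComplete hn⟩
  map f := ObjectProperty.homMk (LinRep.truncMap f)
  map_id Y := by
    apply ObjectProperty.hom_ext
    exact LinRep.trunc_hom_ext fun s y => LinRep.truncMap_inclEquiv _ s y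
  map_comp f g := by
    apply ObjectProperty.hom_ext
    refine LinRep.trunc_hom_ext fun s y => ?_
    refine (LinRep.truncMap_inclEquiv _ s y).trans ?_
    refine Eq.trans ?_ (congrArg (LinRep.truncMap g).toLin
      (LinRep.truncMap_inclEquiv f s y)).symm
    exact (LinRep.truncMap_inclEquiv g s _).symm

instance (hn : 2 ≤ n) : (toLo π m hn).Faithful where
  map_injective {Y Z f g} h := LinRep.hom_ext fun i hi x => by
    have h1 := congrArg (fun t : (toLo π m hn).obj Y ⟶ (toLo π m hn).obj Z =>
      t.hom.toLin (Y.inclEquiv ⟨i, hi⟩ x).1) h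
    have h2 := (LinRep.truncMap_inclEquiv f ⟨i, hi⟩ x).symm.trans
      (h1.trans (LinRep.truncMap_inclEquiv g ⟨i, hi⟩ x))
    exact (Z.inclEquiv ⟨i, hi⟩).injective (Subtype.ext h2)

instance (hn : 2 ≤ n) : (toLo π m hn).Full where
  map_surjective {Y Z} F := by
    let g : ∀ i, i ∈ suppDeg n m → (Y.deg i →+ Z.deg i) := fun i hi =>
      (Z.inclEquiv ⟨i, hi⟩).symm.toLinearMap.toAddMonoidHom.comp
        ((((show Y.trunc ⟶ Z.trunc from F.hom).toLin.toAddMonoidHom.comp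
          (Y.trunc.deg i).subtype).codRestrict (Z.trunc.deg i) fun x => F.hom.map_mem x.2).comp
          (Y.inclEquiv ⟨i, hi⟩).toLinearMap.toAddMonoidHom)
    have hg : ∀ i hi y, (Z.inclEquiv ⟨i, hi⟩ (g i hi y)).1 =
        (show Y.trunc ⟶ Z.trunc from F.hom).toLin (Y.inclEquiv ⟨i, hi⟩ y).1 := fun i hi y =>
      congrArg Subtype.val (LinearEquiv.apply_symm_apply (Z.inclEquiv ⟨i, hi⟩) _)
    refine ⟨⟨g, LinRep.comm_of_suppSet hn g ?_⟩, ?_⟩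
    · intro i j hi hj hu p hp x
      have h1 := LinRep.act_inclEquiv hu (s := ⟨i, hi⟩) (s' := ⟨j, hj⟩) (add_sub_cancel i j)
        ⟨p, hp⟩ x
      have h2 := LinRep.act_inclEquiv hu (s := ⟨i, hi⟩) (s' := ⟨j, hj⟩) (add_sub_cancel i j)
        ⟨p, hp⟩ (g i hi x)
      refine (Z.inclEquiv ⟨j, hj⟩).injective (Subtype.ext ?_)
      rw [hg]
      refine Eq.trans ?_ (congrArg Subtype.val h2)
      refine (congrArg (F.hom.toLin ·) (congrArg Subtype.val h1)).symm.trans ?_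
      refine (F.hom.toLin.map_smul (MulOpposite.op (bar n π p)) _).trans ?_
      exact congrArg (MulOpposite.op (bar n π p) • ·) (hg i hi x).symm
    · apply ObjectProperty.hom_ext
      refine LinRep.trunc_hom_ext fun s y => ?_
      exact (LinRep.truncMap_inclEquiv _ s y).trans (hg s.1 s.2 y)

end ToLo

/-! ### Modules over the truncated dual algebra and their cofree envelopes -/

section FromLo

variable {K V L : Type u} [Field K] [Quiver.{u} V] [Fintype V] [Ring L] [Algebra K L]
  {n : ℕ} {π : PathAlg K V →ₐ[K] L} {m : ℤ}

variable (n m) in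
/-- The set `-(S : U)` of the cogenerating degrees. -/
def cogenDeg : Set ℤ := {i | -i ∈ colon (shiftSet n m) (suppSet n)}

lemma mem_suppDeg_of_add_mem_cogenDeg {i u : ℤ} (hu : u ∈ suppSet n)
    (h : i + u ∈ cogenDeg n m) : i ∈ suppDeg n m := by
  have h1 := mem_shiftSet.1 (h u hu)
  rwa [show -(i + u) + u - m = -i - m by ring] at h1

lemma mem_suppSet_of_add_mem_cogenDeg (hn : 2 ≤ n) {i u : ℤ} (hi : i ∈ suppDeg n m)
    (h : i + u ∈ cogenDeg n m) : u ∈ suppSet n := by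
  rcases hn.lt_or_eq with hn | rfl
  · rw [show u = (i + u + m) + (-i - m) by ring]
    exact (add_mem_suppSet (dvd_of_neg_mem_colon hn h)).2 hi
  · exact suppSet_two u

namespace GrMod

variable (X : GrDualU n π)

lemma part_add (i : ℤ) (x y : X.carrier) : X.part i (x + y) = X.part i x + X.part i y := by
  rw [part, decompose_add]
  rfl

lemma part_of_ne {i j : ℤ} {x : X.carrier} (hx : x ∈ X.deg i) (h : i ≠ j) : X.part j x = 0 :=
  decompose_of_mem_ne _ hx h

variable {X}

lemma bar_smul_mem {i u j : ℤ} (h : i + u = j) {x : X.carrier} (hx : x ∈ X.deg i)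
    {p : PathAlg K V} (hp : p ∈ pathDeg K V u) : MulOpposite.op (bar n π p) • x ∈ X.deg j := by
  subst h
  exact X.smul_mem hx (bar_mem hp)

/-- The components of an element of a cyclic submodule generated by a homogeneous element. -/
lemma part_smul_mem_span {i : ℤ} {x : X.carrier} (hx : x ∈ X.deg i) (j : ℤ)
    (t : TruncAlg n (dualDeg n π)) :
    X.part j (MulOpposite.op t • x) = 0 ∨ ∃ u ∈ suppSet n, ∃ p ∈ pathDeg K V u, i + u = j ∧
      X.part j (MulOpposite.op t • x) = MulOpposite.op (bar n π p) • x := by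
  by_cases hu : j - i ∈ suppSet n
  · right
    refine ⟨j - i, hu, ?_⟩
    suffices h : ∃ p ∈ pathDeg K V (j - i),
        X.part j (MulOpposite.op t • x) = MulOpposite.op (bar n π p) • x by
      obtain ⟨p, hp, h⟩ := h
      exact ⟨p, hp, add_sub_cancel i j, h⟩
    induction t using TruncAlg.induction with
    | zero => exact ⟨0, zero_mem _, by
        rw [MulOpposite.op_zero, zero_smul, part_zero, map_zero, MulOpposite.op_zero, zero_smul]⟩
    | add s t hs ht =>
      obtain ⟨p, hp, hs⟩ := hs
      obtain ⟨q, hq, ht⟩ := ht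
      exact ⟨p + q, add_mem hp hq, by
        rw [MulOpposite.op_add, add_smul, part_add, hs, ht, map_add, MulOpposite.op_add, add_smul]⟩
    | hom u _ a ha =>
      obtain ⟨p, hp, rfl⟩ := ha
      have hmem := bar_smul_mem (X := X) rfl hx hp
      by_cases h : i + u = j
      · subst h
        exact ⟨p, by rwa [add_sub_cancel_left], part_of_mem hmem⟩
      · exact ⟨0, zero_mem _, by
          rw [map_zero, MulOpposite.op_zero, zero_smul]
          exact part_of_ne X hmem h⟩
  · left
    induction t using TruncAlg.induction with
    | zero => rw [MulOpposite.op_zero, zero_smul, part_zero]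
    | add s t hs ht => rw [MulOpposite.op_add, add_smul, part_add, hs, ht, add_zero]
    | hom u hu' a ha =>
      obtain ⟨p, hp, rfl⟩ := ha
      refine part_of_ne X (bar_smul_mem (X := X) rfl hx hp) fun h => hu ?_
      rwa [← h, add_sub_cancel_left]

/-- In a cogenerated module, a nonzero homogeneous element has a nonzero multiple in one of the
cogenerating degrees. -/
lemma exists_bar_smul_ne_zero {𝒳 : Set ℤ} (hX : X.CogeneratedIn 𝒳) {i : ℤ} {x : X.carrier}
    (hx : x ∈ X.deg i) (h0 : x ≠ 0) : ∃ u ∈ suppSet n, ∃ p ∈ pathDeg K V u, i + u ∈ 𝒳 ∧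
      MulOpposite.op (bar n π p) • x ≠ 0 := by
  let N := Submodule.span (TruncAlg n (dualDeg n π))ᵐᵒᵖ {x}
  have hN : N.IsHomogeneous X.deg := by
    intro j z hz
    obtain ⟨t, rfl⟩ := Submodule.mem_span_singleton.1 hz
    rcases part_smul_mem_span hx j t.unop with h | ⟨u, -, p, -, -, h⟩
    · have : ((decompose X.deg (t • x) j : X.deg j) : X.carrier) = 0 := h
      rw [this]
      exact N.zero_mem
    · have : ((decompose X.deg (t • x) j : X.deg j) : X.carrier) =
        MulOpposite.op (bar n π p) • x := h
      rw [this]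
      exact N.smul_mem _ (Submodule.mem_span_singleton_self x)
  obtain ⟨j, hj, hne⟩ := hX N hN fun h => h0 (Submodule.span_singleton_eq_bot.1 h)
  obtain ⟨⟨z, hz⟩, hne'⟩ := AddSubgroup.ne_bot_iff_exists_ne_zero.1 hne
  have hz0 : z ≠ 0 := fun h => hne' (Subtype.ext h)
  obtain ⟨t, ht⟩ := Submodule.mem_span_singleton.1 hz.2
  have hpart := part_of_mem hz.1
  rw [← ht] at hpart hz0
  rcases part_smul_mem_span hx j t.unop with h | ⟨u, hu, p, hp, rfl, h⟩
  · exact absurd (hpart.symm.trans h) hz0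
  · refine ⟨u, hu, p, hp, hj, fun h1 => hz0 ?_⟩
    exact hpart.symm.trans (h.trans h1)

lemma mem_suppDeg_of_ne_zero (hX : X.CogeneratedIn (cogenDeg n m)) {i : ℤ} {x : X.carrier}
    (hx : x ∈ X.deg i) (h0 : x ≠ 0) : i ∈ suppDeg n m := by
  obtain ⟨u, hu, p, hp, h, -⟩ := exists_bar_smul_ne_zero hX hx h0
  exact mem_suppDeg_of_add_mem_cogenDeg hu h

open scoped Classical in
variable (X) in
/-- The projection onto the components with degree in a given set. -/
def projOn (𝒳 : Set ℤ) : X.carrier →+ X.carrier :=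
  (DirectSum.toAddMonoid fun i => if i ∈ 𝒳 then (X.deg i).subtype else 0).comp
    (decomposeAddEquiv X.deg).toAddMonoidHom

lemma projOn_of_mem {𝒳 : Set ℤ} {i : ℤ} (hi : i ∈ 𝒳) {x : X.carrier} (hx : x ∈ X.deg i) :
    X.projOn 𝒳 x = x := by
  classical
  change DirectSum.toAddMonoid _ (decompose X.deg x) = x
  rw [decompose_of_mem _ hx, DirectSum.toAddMonoid_of, if_pos hi]
  rfl

lemma projOn_of_notMem {𝒳 : Set ℤ} {i : ℤ} (hi : i ∉ 𝒳) {x : X.carrier} (hx : x ∈ X.deg i) :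
    X.projOn 𝒳 x = 0 := by
  classical
  change DirectSum.toAddMonoid _ (decompose X.deg x) = 0
  rw [decompose_of_mem _ hx, DirectSum.toAddMonoid_of, if_neg hi]
  rfl

/-- The additive maps from `Λ^!` to a module over `Λ^!_U`. -/
def Cofree (X : GrDualU n π) : Type u := DualAlg n π →+ X.carrier

namespace Cofree

instance : AddCommGroup (Cofree X) := inferInstanceAs (AddCommGroup (DualAlg n π →+ X.carrier))

/-- The value of an element. -/
def eval (b : DualAlg n π) : Cofree X →+ X.carrier := AddMonoidHom.eval b

/-- The additive maps from `Λ^!` form a right module over `Λ^!`, written as a left module over the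
path algebra: `(p f)(b) = f(p b)`, the product being that of `Λ^!`. -/
instance : Module (PathAlg K V) (Cofree X) where
  smul p f := AddMonoidHom.comp f (AddMonoidHom.mulLeft (toDual n π p))
  one_smul f := AddMonoidHom.ext fun b => by
    change eval (toDual n π 1 * b) f = eval b f
    rw [toDual_one, one_mul]
  mul_smul p q f := AddMonoidHom.ext fun b => by
    change eval (toDual n π (p * q) * b) f = eval (toDual n π q * (toDual n π p * b)) f
    rw [toDual_mul, mul_assoc]
  smul_zero p := rfl
  smul_add p f g := rfl
  add_smul p q f := AddMonoidHom.ext fun b => by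
    change eval (toDual n π (p + q) * b) f =
      eval (toDual n π p * b) f + eval (toDual n π q * b) f
    rw [map_add, add_mul]
    exact map_add (show DualAlg n π →+ X.carrier from f) _ _
  zero_smul f := AddMonoidHom.ext fun b => by
    change eval (toDual n π 0 * b) f = 0
    rw [map_zero, zero_mul]
    exact map_zero (show DualAlg n π →+ X.carrier from f)

lemma eval_smul (p q : PathAlg K V) (f : Cofree X) :
    eval (toDual n π q) (p • f) = eval (toDual n π (q * p)) f := by
  rw [toDual_mul]
  rfl

/-- Elements are determined by their values on homogeneous elements. -/
lemma ext {f g : Cofree X}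
    (h : ∀ l, ∀ q ∈ pathDeg K V l, eval (toDual n π q) f = eval (toDual n π q) g) : f = g := by
  refine AddMonoidHom.ext fun b => ?_
  induction b using DirectSum.Decomposition.inductionOn (dualDeg n π) with
  | zero =>
    exact (map_zero (show DualAlg n π →+ X.carrier from f)).trans
      (map_zero (show DualAlg n π →+ X.carrier from g)).symm
  | @homogeneous k a =>
    obtain ⟨_, q, hq, rfl⟩ := a
    exact h k q hq
  | add a b ha hb =>
    exact (map_add (show DualAlg n π →+ X.carrier from f) _ _).trans
      ((congrArg₂ (· + ·) ha hb).trans (map_add (show DualAlg n π →+ X.carrier from g) _ _).symm)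

variable (m) in
/-- The canonical map from a module over `Λ^!_U` to the additive maps from `Λ^!`. An element `x`
goes to `b ↦ x b`, in which only the components in the cogenerating degrees are kept. -/
def of : X.carrier →+ Cofree X :=
  AddMonoidHom.mk' (fun x => (AddMonoidHom.mk' (fun b =>
      X.projOn (cogenDeg n m) (MulOpposite.op (TruncAlg.proj n (dualDeg n π) b) • x)) fun b c => by
        rw [map_add, MulOpposite.op_add, add_smul, map_add] : DualAlg n π →+ X.carrier))
    fun x y => AddMonoidHom.ext fun b => by
      change X.projOn _ (_ • (x + y)) = X.projOn _ (_ • x) + X.projOn _ (_ • y)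
      rw [smul_add, map_add]

lemma eval_of (x : X.carrier) (q : PathAlg K V) : eval (toDual n π q) (of m x) =
    X.projOn (cogenDeg n m) (MulOpposite.op (bar n π q) • x) := rfl

lemma perp_smul {p : PathAlg K V} (hp : p ∈ perp n π) (f : Cofree X) : p • f = 0 :=
  AddMonoidHom.ext fun b => by
    change eval (toDual n π p * b) f = 0
    rw [toDual_perp n π hp, zero_mul]
    exact map_zero (show DualAlg n π →+ X.carrier from f)

lemma of_injOn (hX : X.CogeneratedIn (cogenDeg n m)) {i : ℤ} {x : X.carrier} (hx : x ∈ X.deg i)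
    (h : of m x = 0) : x = 0 := by
  by_contra h0
  obtain ⟨u, -, p, hp, hd, hne⟩ := exists_bar_smul_ne_zero hX hx h0
  refine hne ?_
  rw [← projOn_of_mem hd (bar_smul_mem rfl hx hp), ← eval_of, h]
  rfl

/-- The canonical map is compatible with the paths that lead from one degree of `-S` to another. -/
lemma smul_of (hn : 2 ≤ n) {i u : ℤ} (hu : u ∈ suppSet n)
    (hiu : i + u ∈ suppDeg n m) {x : X.carrier} (hx : x ∈ X.deg i) {p : PathAlg K V}
    (hp : p ∈ pathDeg K V u) : p • of m x = of m (MulOpposite.op (bar n π p) • x) := by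
  refine ext fun l q hq => ?_
  rw [eval_smul, eval_of, eval_of]
  by_cases hd : i + u + l ∈ cogenDeg n m
  · have hl := mem_suppSet_of_add_mem_cogenDeg hn hiu hd
    rw [bar_mul hl hu hq hp, MulOpposite.op_mul, mul_smul]
  · rw [projOn_of_notMem hd (bar_smul_mem (u := l + u) (by ring) hx (mul_mem_pathDeg hq hp)),
      projOn_of_notMem hd (bar_smul_mem rfl (bar_smul_mem rfl hx hp) hq)]

end Cofree

end GrMod

/-! ### Coefficients in `M ⊗ KQ_k` -/

omit [Fintype V] in
open scoped Classical in
lemma PathAlg.coeff_path_mul_concat {a a' q : QPath V} (h : a.tgt = q.src) (hl : a'.len = a.len)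
    (y : PathAlg K V) :
    coeff (path a' 1 * y) (a.concat q h) = if a' = a then coeff y q else 0 := by
  induction y using PathAlg.induction with
  | zero => rw [mul_zero, coeff_zero, coeff_zero, ite_self]
  | add x y hx hy => rw [mul_add, coeff_add, hx, hy, coeff_add]; split_ifs <;> simp
  | smul c x hx => rw [mul_smul_comm, coeff_smul, hx, coeff_smul]; split_ifs <;> simp
  | path q' =>
    rw [path_mul_path]
    by_cases h' : a'.tgt = q'.src
    · rw [pathMul_of_eq h', coeff_path]
      by_cases he : a'.concat q' h' = a.concat q h
      · obtain ⟨rfl, rfl⟩ := QPath.concat_injective h' h hl he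
        rw [if_pos rfl, if_pos rfl, coeff_path, if_pos rfl]
      · rw [if_neg he]
        split_ifs with ha
        · subst ha
          rw [coeff_path, if_neg]
          rintro rfl
          exact he rfl
        · rfl
    · rw [pathMul_of_ne h', coeff_zero]
      split_ifs with ha
      · subst ha
        rw [coeff_path, if_neg]
        rintro rfl
        exact h' h
      · rfl

open scoped Classical in
/-- The coefficient of a path in an element of `M ⊗ KQ_k`. -/
def TensPath.coeff {N : Type u} [AddCommGroup N] [Module (V → K) N] {k : ℤ} (q : QPath V) :
    TensPath K V N k →+ N :=
  TensorProduct.liftAddHom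
    (AddMonoidHom.mk' (fun z => AddMonoidHom.mk' (fun y : pathDeg K V k =>
        (Pi.single q.src (PathAlg.coeff y.1 q) : V → K) • z) fun y y' => by
          rw [← add_smul, ← Pi.single_add]
          rfl)
      fun z z' => AddMonoidHom.ext fun y => smul_add _ z z')
    fun r z y => by
      change (Pi.single q.src (PathAlg.coeff y.1 q) : V → K) • r • z =
        (Pi.single q.src (PathAlg.coeff (vertexHom r * y.1) q) : V → K) • z
      rw [coeff_vertexHom_mul, smul_smul]
      congr 1
      ext v
      rcases eq_or_ne v q.src with rfl | h
      · simp [mul_comm]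
      · simp [Pi.single_eq_of_ne h]

open scoped Classical in
lemma TensPath.coeff_tmul {N : Type u} [AddCommGroup N] [Module (V → K) N] {k : ℤ}
    (q : QPath V) (z : N) (y : pathDeg K V k) : TensPath.coeff q (TensPath.tmul z y) =
      (Pi.single q.src (PathAlg.coeff y.1 q) : V → K) • z :=
  TensorProduct.liftAddHom_tmul ..

lemma PathAlg.vertexHom_mem (r : V → K) : (vertexHom r : PathAlg K V) ∈ pathDeg K V 0 :=
  vertexSum_mem r

namespace GrMod

variable {X : GrDualU n π}

lemma compModule_val {i : ℤ} (r : V → K) (x : X.deg i) :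
    (r • x).1 = MulOpposite.op (bar n π (vertexHom r)) • x.1 := rfl

lemma bar_smul_bar_smul {u v : ℤ} (hu : u ∈ suppSet n) (hv : v ∈ suppSet n) {p q : PathAlg K V}
    (hp : p ∈ pathDeg K V u) (hq : q ∈ pathDeg K V v) (x : X.carrier) :
    MulOpposite.op (bar n π p) • MulOpposite.op (bar n π q) • x =
      MulOpposite.op (bar n π (p * q)) • x := by
  rw [smul_smul, ← MulOpposite.op_mul, bar_mul hu hv hp hq]

variable [∀ i j : V, Finite (i ⟶ j)]

lemma coeff_comul {i j k : ℤ} (hk : k ∈ suppSet n) (h : i + k = j) (x : X.deg i) {p : QPath V}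
    (hp : p ∈ paths V k) : (TensPath.coeff p (comul X hk h x)).1 =
      MulOpposite.op (bar n π (path p 1)) • x.1 := by
  classical
  have hp' := path_mem' (K := K) p (mem_paths.1 hp)
  rw [comul_eq_sum, map_sum, Finset.sum_eq_single p]
  · rw [TensPath.coeff_tmul, compModule_val]
    change MulOpposite.op (bar n π (vertexHom (Pi.single p.src
      (PathAlg.coeff (component k (path p 1)) p)))) •
      MulOpposite.op (bar n π (component k (path p 1))) • x.1 = _
    rw [component_of_mem hp', coeff_path, if_pos rfl,
      bar_smul_bar_smul (zero_mem_suppSet n) hk (vertexHom_mem _) hp',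
      vertexHom_mul_path, Pi.single_eq_same, one_smul]
  · intro q hq hqp
    have hc : PathAlg.coeff (component k (path q (1 : K))) p = 0 := by
      rw [component_of_mem (path_mem' q (mem_paths.1 hq)), coeff_path, if_neg hqp]
    rw [TensPath.coeff_tmul, hc, Pi.single_zero]
    exact zero_smul (V → K) _
  · exact fun h => absurd hp h

lemma coeff_concat_comul {i j k l : ℤ} (hk : k ∈ suppSet n) (h : i + k = j) {w : ℤ} (hw : k + l = w)
    {a q : QPath V} (ha : a ∈ paths V k) (haq : a.tgt = q.src)
    (t : TensPath K V (X.deg i) l) :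
    (TensPath.coeff (a.concat q haq) (TensPath.concat (K := K) (V := V) hw
      (TensPath.map (comul X hk h) l t))).1 =
      MulOpposite.op (bar n π (path a 1)) • (TensPath.coeff q t).1 := by
  classical
  have ha' := path_mem' (K := K) a (mem_paths.1 ha)
  induction t using TensPath.induction with
  | zero =>
    simp only [map_zero]
    exact (smul_zero _).symm
  | add s t hs ht =>
    simp only [map_add]
    refine (congrArg₂ (· + ·) hs ht).trans ?_
    exact (smul_add _ _ _).symm
  | tmul z y =>
    rw [TensPath.map_tmul, comul_eq_sum]
    have h1 : TensPath.tmul (∑ p ∈ paths V k, TensPath.tmul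
        (X.act h ⟨component k (path p 1), component_mem _ _⟩ z)
        (⟨component k (path p 1), component_mem _ _⟩ : pathDeg K V k)) y =
      ∑ p ∈ paths V k, TensPath.tmul (TensPath.tmul
        (X.act h ⟨component k (path p 1), component_mem _ _⟩ z)
        (⟨component k (path p 1), component_mem _ _⟩ : pathDeg K V k)) y :=
      TensorProduct.sum_tmul _ _ _
    rw [h1, map_sum, map_sum, Finset.sum_eq_single a]
    · rw [TensPath.concat_tmul, TensPath.coeff_tmul, TensPath.coeff_tmul, compModule_val,
        compModule_val]
      change MulOpposite.op (bar n π (vertexHom (Pi.single a.src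
        (PathAlg.coeff (component k (path a 1) * y.1) (a.concat q haq))))) •
        MulOpposite.op (bar n π (component k (path a 1))) • z.1 = _
      rw [component_of_mem ha', coeff_path_mul_concat haq rfl, if_pos rfl,
        bar_smul_bar_smul (zero_mem_suppSet n) hk (vertexHom_mem _) ha',
        bar_smul_bar_smul hk (zero_mem_suppSet n) ha' (vertexHom_mem _),
        vertexHom_mul_path, path_mul_vertexHom, haq, Pi.single_eq_same, Pi.single_eq_same]
    · intro p hp hpa
      have hp' := path_mem' (K := K) p (mem_paths.1 hp)
      have hl : p.len = a.len := by
        exact_mod_cast (mem_paths.1 hp).trans (mem_paths.1 ha).symm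
      have hc : PathAlg.coeff (component k (path p (1 : K)) * y.1) (a.concat q haq) = 0 := by
        rw [component_of_mem hp', coeff_path_mul_concat haq hl, if_neg hpa]
      rw [TensPath.concat_tmul, TensPath.coeff_tmul, hc, Pi.single_zero]
      exact zero_smul (V → K) _
    · exact fun h => absurd ha h

lemma bar_smul_coeff_eq_zero {i l k : ℤ} (hk : k ∈ suppSet n) {a q : QPath V}
    (ha : a ∈ paths V k) (haq : a.tgt ≠ q.src) (t : TensPath K V (X.deg i) l) :
    MulOpposite.op (bar n π (path a 1)) • (TensPath.coeff q t).1 = 0 := by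
  classical
  have ha' := path_mem' (K := K) a (mem_paths.1 ha)
  induction t using TensPath.induction with
  | zero =>
    rw [map_zero]
    exact smul_zero _
  | add s t hs ht =>
    rw [map_add]
    refine (smul_add _ _ _).trans ?_
    rw [hs, ht, add_zero]
  | tmul z y =>
    rw [TensPath.coeff_tmul, compModule_val,
      bar_smul_bar_smul hk (zero_mem_suppSet n) ha' (vertexHom_mem _), path_mul_vertexHom,
      Pi.single_eq_of_ne haq, zero_smul, map_zero, MulOpposite.op_zero, zero_smul]

end GrMod

/-! ### The linear representation of a module over the truncated dual algebra -/

namespace GrMod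

variable {X : GrDualU n π}

open Cofree

variable (X m) in
/-- The components of the linear representation of a module: the component of degree `i` is
generated by the `p x`, where `p` has degree `u` and `x` is a homogeneous element of degree `i - u`
of the module. -/
def cofreeDeg (i : ℤ) : AddSubgroup (Cofree X) :=
  AddSubgroup.closure {y | ∃ u, ∃ p ∈ pathDeg K V u, ∃ x ∈ X.deg (i - u), y = p • of m x}

lemma smul_mem_cofreeDeg {i k : ℤ} {q : PathAlg K V} {y : Cofree X} (hq : q ∈ pathDeg K V k)
    (hy : y ∈ cofreeDeg m X i) : q • y ∈ cofreeDeg m X (i + k) := by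
  induction hy using AddSubgroup.closure_induction with
  | zero => rw [smul_zero]; exact zero_mem _
  | add y z _ _ hy hz => rw [smul_add]; exact add_mem hy hz
  | neg y _ hy => rw [smul_neg]; exact neg_mem hy
  | mem y hy =>
    obtain ⟨u, p, hp, x, hx, rfl⟩ := hy
    refine AddSubgroup.subset_closure ⟨k + u, q * p, mul_mem_pathDeg hq hp, x, ?_, ?_⟩
    · rwa [show i + k - (k + u) = i - u by ring]
    · rw [mul_smul]

lemma of_mem_cofreeDeg {i : ℤ} {x : X.carrier} (hx : x ∈ X.deg i) :
    of m x ∈ cofreeDeg m X i :=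
  AddSubgroup.subset_closure ⟨0, 1, one_mem_pathDeg, x, by rwa [sub_zero], (one_smul _ _).symm⟩

lemma eval_eq_zero_of_mem_cofreeDeg {i l : ℤ} {y : Cofree X} (hy : y ∈ cofreeDeg m X i)
    {q : PathAlg K V} (hq : q ∈ pathDeg K V l) (h : i + l ∉ cogenDeg n m) :
    eval (toDual n π q) y = 0 := by
  induction hy using AddSubgroup.closure_induction with
  | zero => exact map_zero _
  | add y z _ _ hy hz => rw [map_add, hy, hz, add_zero]
  | neg y _ hy => rw [map_neg, hy, neg_zero]
  | mem y hy =>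
    obtain ⟨u, p, hp, x, hx, rfl⟩ := hy
    rw [eval_smul, eval_of]
    exact projOn_of_notMem h (bar_smul_mem (by ring) hx (mul_mem_pathDeg hq hp))

/-- The arrows detect nonzero elements in the degrees belonging to `-m - 1 + nℤ`: elements of such
a degree vanish on `Λ^!_0`, and the higher components of `Λ^!` are products with arrows. -/
lemma eq_zero_of_mem_cofreeDeg (hn : 2 < n) {i : ℤ} (hi : (n : ℤ) ∣ i + m + 1) {y : Cofree X}
    (hy : y ∈ cofreeDeg m X i) (h : ∀ p ∈ pathDeg K V 1, p • y = 0) : y = 0 := by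
  refine Cofree.ext fun l q hq => ?_
  rw [map_zero]
  by_cases hd : i + l ∈ cogenDeg n m
  · have hl : l ≠ 0 := by
      rintro rfl
      rw [add_zero] at hd
      have h1 := dvd_sub hi (dvd_of_neg_mem_colon hn hd)
      rw [add_sub_cancel_left] at h1
      have := Int.le_of_dvd one_pos h1
      omega
    rcases hl.lt_or_gt with hl | hl
    · rw [pathDeg_eq_zero hl hq, map_zero]
      exact map_zero (show DualAlg n π →+ X.carrier from y)
    · have hq' := pathDeg_add_le K V (k := l - 1) (l := 1) (by omega) zero_le_one
        (sub_add_cancel l 1) hq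
      suffices h2 : ∀ c : K, eval (toDual n π (c • q)) y = 0 by
        have := h2 1
        rwa [one_smul] at this
      clear hq
      induction hq' using Submodule.span_induction with
      | zero =>
        intro c
        rw [smul_zero, map_zero]
        exact map_zero (show DualAlg n π →+ X.carrier from y)
      | add a b _ _ ha hb =>
        intro c
        rw [smul_add, map_add]
        refine (map_add (show DualAlg n π →+ X.carrier from y) _ _).trans ?_
        exact (congrArg₂ (· + ·) (ha c) (hb c)).trans (add_zero _)
      | smul d a _ ha =>
        intro c
        rw [smul_smul]
        exact ha _
      | mem a ha =>
        intro c
        obtain ⟨b, _, a, ha, rfl⟩ := ha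
        rw [← smul_mul_assoc, ← eval_smul, h a ha, map_zero]
  · exact eval_eq_zero_of_mem_cofreeDeg hy hq hd

variable (X m) in
/-- The linear representation of a module over `Λ^!_U`. -/
def linRep : LinRep n π m where
  carrier := Cofree X
  deg := cofreeDeg m X
  smul_mem := smul_mem_cofreeDeg
  perp_smul _ hx y := perp_smul hx y
  torsion_free h _ hi _ hy h0 := eq_zero_of_mem_cofreeDeg h hi hy h0

variable [∀ i j : V, Finite (i ⟶ j)]

omit [∀ i j : V, Finite (i ⟶ j)] in
lemma exists_algebraMap_smul_of (hn : 2 ≤ n) {i : ℤ} (hi : i ∈ suppDeg n m) {w : X.carrier}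
    (hw : w ∈ X.deg i) (c : K) :
    ∃ w' ∈ X.deg i, algebraMap K (PathAlg K V) c • of m w = of m w' := by
  have hc : algebraMap K (PathAlg K V) c ∈ pathDeg K V 0 := by
    rw [← vertexHom_const]
    exact vertexHom_mem _
  exact ⟨_, bar_smul_mem (add_zero _) hw hc,
    smul_of hn (zero_mem_suppSet n) (by rwa [add_zero]) hw hc⟩

/-- The condition on the comultiplications implies that in the degrees of `-S` the paths of length
`n - 1` do not lead out of the image of the module. -/
lemma exists_smul_of_eq (hn : 2 < n) {k : ℤ} (hk : CanComplete X m k) {x : X.carrier}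
    (hx : x ∈ X.deg (-m - (k + 1) * n)) {q : PathAlg K V} (hq : q ∈ pathDeg K V (n - 1)) :
    ∃ w ∈ X.deg (-m - k * n - 1), q • of m x = of m w := by
  obtain ⟨φ, hφ⟩ := hk
  have hs0 : -m - (k + 1) * n ∈ suppDeg n m := mem_suppDeg_of_dvd ⟨-(k + 1), by ring⟩
  have hs1 : -m - k * n - 1 ∈ suppDeg n m := Or.inr ⟨k, by ring⟩
  have hs2 : -m - k * n ∈ suppDeg n m := mem_suppDeg_of_dvd ⟨-k, by ring⟩
  have h01 : -m - (k + 1) * n + ((n : ℤ) - 1) = -m - k * n - 1 := by ring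
  have h02 : -m - (k + 1) * n + (n : ℤ) = -m - k * n := by ring
  have h12 : -m - k * n - 1 + 1 = -m - k * (n : ℤ) := sub_add_cancel _ _
  induction hq using Submodule.span_induction with
  | zero => exact ⟨0, zero_mem _, by rw [zero_smul, map_zero]⟩
  | add a b _ _ ha hb =>
    obtain ⟨w, hw, ha⟩ := ha
    obtain ⟨w', hw', hb⟩ := hb
    exact ⟨w + w', add_mem hw hw', by rw [add_smul, ha, hb, map_add]⟩
  | smul c a _ ha =>
    obtain ⟨w, hw, ha⟩ := ha
    obtain ⟨w', hw', h⟩ := exists_algebraMap_smul_of (by omega) hs1 hw c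
    exact ⟨w', hw', by rw [Algebra.smul_def, mul_smul, ha, h]⟩
  | mem a ha =>
    obtain ⟨q, hq, rfl⟩ := ha
    have hq' : q ∈ paths V ((n : ℤ) - 1) := mem_paths.2 hq
    have hqm := path_mem' (K := K) q hq
    let w : X.deg (-m - k * n - 1) := TensPath.coeff q (φ ⟨x, hx⟩)
    refine ⟨w.1, w.2, sub_eq_zero.1 (eq_zero_of_mem_cofreeDeg hn (m := m)
      (i := -m - k * n - 1) ⟨-k, by ring⟩ (sub_mem ?_ (of_mem_cofreeDeg w.2)) fun p hp =>
        PathRep.smul_eq_zero_of_paths (fun a ha => ?_) hp)⟩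
    -- `w` is the coefficient of `q` in `φ x`, and an arrow `a` takes both sides to `x (aq)`
    · have := smul_mem_cofreeDeg hqm (of_mem_cofreeDeg (m := m) hx)
      rwa [h01] at this
    · have ham := path_mem' (K := K) a (mem_paths.1 ha)
      change (path a 1 : PathAlg K V) • (path q (1 : K) • of m x - of m w.1) = 0
      rw [smul_sub, smul_smul, sub_eq_zero,
        smul_of (by omega) (one_mem_suppSet n) (by rwa [h12]) w.2 ham,
        smul_of (by omega) (self_mem_suppSet n) (by rwa [h02]) hx
          (mul_mem_pathDeg' (add_sub_cancel 1 (n : ℤ)) ham hqm)]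
      congr 1
      rw [path_mul_path]
      by_cases haq : a.tgt = q.src
      · rw [pathMul_of_eq haq]
        refine Eq.trans ?_ (coeff_concat_comul (one_mem_suppSet n) h12
          (add_sub_cancel 1 (n : ℤ)) ha haq (φ ⟨x, hx⟩))
        have h3 := LinearMap.congr_fun hφ ⟨x, hx⟩
        refine (coeff_comul (self_mem_suppSet n) h02 ⟨x, hx⟩ (p := a.concat q haq)
          (mem_paths.2 ?_)).symm.trans ?_
        swap
        · exact congrArg (fun t => (TensPath.coeff (K := K) (a.concat q haq) t).1) h3.symm
        have h1 := mem_paths.1 ha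
        have h2 := mem_paths.1 hq'
        rw [QPath.len_concat]
        push_cast
        omega
      · rw [pathMul_of_ne haq, map_zero, MulOpposite.op_zero, zero_smul]
        exact (bar_smul_coeff_eq_zero (one_mem_suppSet n) ha haq _).symm

/-- In the degrees of `-S` the linear representation coincides with the module. -/
lemma exists_eq_of (hn : 2 ≤ n) (hX : Lo n π m X) {i : ℤ} (hi : i ∈ suppDeg n m) {y : Cofree X}
    (hy : y ∈ cofreeDeg m X i) : ∃ x ∈ X.deg i, y = of m x := by
  induction hy using AddSubgroup.closure_induction with
  | zero => exact ⟨0, zero_mem _, (map_zero _).symm⟩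
  | add y z _ _ hy hz =>
    obtain ⟨x, hx, rfl⟩ := hy
    obtain ⟨x', hx', rfl⟩ := hz
    exact ⟨x + x', add_mem hx hx', (map_add _ _ _).symm⟩
  | neg y _ hy =>
    obtain ⟨x, hx, rfl⟩ := hy
    exact ⟨-x, neg_mem hx, (map_neg _ _).symm⟩
  | mem y hy =>
    obtain ⟨u, p, hp, x, hx, rfl⟩ := hy
    by_cases hx0 : x = 0
    · exact ⟨0, zero_mem _, by rw [hx0, map_zero, smul_zero]⟩
    have hiu : i - u ∈ suppDeg n m := mem_suppDeg_of_ne_zero hX.1 hx hx0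
    by_cases hu : u ∈ suppSet n
    · exact ⟨_, bar_smul_mem (sub_add_cancel i u) hx hp,
        smul_of hn hu (by rwa [sub_add_cancel]) hx hp⟩
    -- the remaining degrees `u` belong to `nℤ - 1`
    obtain ⟨h1, h2⟩ := dvd_of_sub_notMem_suppSet hiu hi (by rwa [sub_sub_cancel])
    have hn2 : 2 < n := by
      rcases hn.lt_or_eq with h | rfl
      · exact h
      · exact absurd (suppSet_two _) hu
    rcases lt_or_ge u 0 with hu0 | hu0
    · exact ⟨0, zero_mem _, by rw [pathDeg_eq_zero hu0 hp, zero_smul, map_zero]⟩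
    -- for `u = (n - 1) + c n`, a path of length `u` is the product of one of length `n - 1` and one
    -- whose length `c n` belongs to `U`
    obtain ⟨c, hc⟩ : (n : ℤ) ∣ u + 1 - n := by
      rw [show u + 1 - n = (i + m + 1) - (i - u + m) - n by ring]
      exact dvd_sub (dvd_sub h2 h1) dvd_rfl
    have hc0 : 0 ≤ (n : ℤ) * c := by
      by_contra hneg
      have : c ≤ -1 := by
        by_contra hc1
        exact hneg (mul_nonneg (by positivity) (by omega))
      have := mul_le_mul_of_nonneg_left this (show (0 : ℤ) ≤ n by positivity)
      omega
    obtain ⟨k, hk⟩ : ∃ k : ℤ, i = -m - k * n - 1 := by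
      obtain ⟨k, hk⟩ := h2
      exact ⟨-k, by linarith⟩
    have hp' := pathDeg_add_le K V (k := (n : ℤ) - 1) (l := n * c) (by omega) hc0
      (show (n : ℤ) - 1 + n * c = u by rw [← hc]; ring) hp
    clear hp
    induction hp' using Submodule.span_induction with
    | zero => exact ⟨0, zero_mem _, by rw [zero_smul, map_zero]⟩
    | add a b _ _ ha hb =>
      obtain ⟨w, hw, ha⟩ := ha
      obtain ⟨w', hw', hb⟩ := hb
      exact ⟨w + w', add_mem hw hw', by rw [add_smul, ha, hb, map_add]⟩
    | smul d a _ ha =>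
      obtain ⟨w, hw, ha⟩ := ha
      obtain ⟨w', hw', h⟩ := exists_algebraMap_smul_of hn hi hw d
      exact ⟨w', hw', by rw [Algebra.smul_def, mul_smul, ha, h]⟩
    | mem a ha =>
      obtain ⟨q, hq, r, hr, rfl⟩ := ha
      have hdeg : i - u + n * c = -m - (k + 1) * n := by
        rw [hk, ← hc]
        ring
      have hxr := bar_smul_mem hdeg hx hr
      rw [mul_smul, smul_of hn (Or.inl ⟨c, rfl⟩)
        (by rw [hdeg]; exact mem_suppDeg_of_dvd ⟨-(k + 1), by ring⟩) hx hr, hk]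
      exact exists_smul_of_eq hn2 (hX.2 k) hxr hq

end GrMod

end FromLo

/-! ### Every object of `L°(S, U)` is a truncation -/

section EssSurj

variable {K V L : Type u} [Field K] [Quiver.{u} V] [Fintype V] [Ring L] [Algebra K L]
  {n : ℕ} {π : PathAlg K V →ₐ[K] L} {m : ℤ} [∀ i j : V, Finite (i ⟶ j)]

namespace GrMod

variable {X : GrDualU n π}

open Cofree LinRep

/-- In the degrees of `-S` the components of a module and of its linear representation coincide. -/
def degEquiv (hn : 2 ≤ n) (hX : Lo n π m X) (s : suppDeg n m) :
    X.deg s.1 ≃+ (linRep m X).deg s.1 :=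
  AddEquiv.ofBijective (((Cofree.of m).comp (X.deg s.1).subtype).codRestrict (cofreeDeg m X s.1)
      fun x => of_mem_cofreeDeg x.2) ⟨by
    refine (injective_iff_map_eq_zero _).2 fun x hx => Subtype.ext ?_
    exact of_injOn hX.1 x.2 (congrArg Subtype.val hx), fun y => by
    obtain ⟨x, hx, h⟩ := exists_eq_of hn hX s.2 y.2
    exact ⟨⟨x, hx⟩, Subtype.ext h.symm⟩⟩

/-- The additive map from the truncation of the linear representation of a module to the module. -/
def ofTruncAdd (hn : 2 ≤ n) (hX : Lo n π m X) : (linRep m X).Trunc →+ X.carrier :=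
  DirectSum.toAddMonoid fun s => (X.deg s.1).subtype.comp (degEquiv hn hX s).symm.toAddMonoidHom

lemma ofTruncAdd_incl (hn : 2 ≤ n) (hX : Lo n π m X) (s : suppDeg n m) (x : X.deg s.1) :
    ofTruncAdd hn hX (incl s (degEquiv hn hX s x)) = x.1 :=
  (DirectSum.toAddMonoid_of (β := fun s : suppDeg n m => (linRep m X).deg s.1) _ s _).trans
    (congrArg Subtype.val ((degEquiv hn hX s).symm_apply_apply x))

lemma exists_eq_incl (hn : 2 ≤ n) (hX : Lo n π m X) (s : suppDeg n m) {z : (linRep m X).Trunc}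
    (hz : z ∈ (linRep m X).truncDeg s.1) : ∃ x, z = incl s (degEquiv hn hX s x) := by
  obtain ⟨x, hx⟩ := (degEquiv hn hX s).surjective (z s)
  exact ⟨x, (eq_incl hz).trans (congrArg (incl s) hx.symm)⟩

lemma ofTruncAdd_truncAct (hn : 2 ≤ n) (hX : Lo n π m X) (t : TruncAlg n (dualDeg n π))
    (z : (linRep m X).Trunc) : ofTruncAdd hn hX ((linRep m X).truncAct (TruncAlg.val _ _ t) z) =
      MulOpposite.op t • ofTruncAdd hn hX z := by
  induction t using TruncAlg.induction with
  | zero => simp only [map_zero, AddMonoidHom.zero_apply, MulOpposite.op_zero, zero_smul]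
  | add t t' h h' =>
    simp only [map_add, AddMonoidHom.add_apply, h, h', MulOpposite.op_add, add_smul]
  | hom u hu a ha =>
    rw [TruncAlg.val_proj_of_mem hu ha]
    obtain ⟨p, hp, rfl⟩ := ha
    induction z using trunc_induction with
    | zero => simp only [map_zero, smul_zero]
    | add x y hx hy => simp only [map_add, hx, hy, smul_add]
    | incl s y =>
      obtain ⟨x, rfl⟩ := (degEquiv hn hX s).surjective y
      rw [ofTruncAdd_incl]
      have hxp : MulOpposite.op (bar n π p) • x.1 ∈ X.deg (s.1 + u) := bar_smul_mem rfl x.2 hp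
      change _ = MulOpposite.op (bar n π p) • x.1
      by_cases h : s.1 + u ∈ suppDeg n m
      · rw [truncAct_toDual hp (s' := ⟨_, h⟩) rfl]
        have h1 : PathRep.move (s.1 + u) p (degEquiv hn hX s x) =
            degEquiv hn hX ⟨_, h⟩ ⟨_, hxp⟩ := Subtype.ext (by
          rw [PathRep.move_val rfl hp]
          exact smul_of hn hu h x.2 hp)
        refine (congrArg (fun w => ofTruncAdd hn hX (incl ⟨_, h⟩ w)) h1).trans ?_
        exact ofTruncAdd_incl hn hX ⟨_, h⟩ _
      · rw [truncAct_notMem (toDual_mem n π hp) h, map_zero]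
        by_contra h0
        exact h (mem_suppDeg_of_ne_zero hX.1 hxp (Ne.symm h0))

/-- The truncation of the linear representation of a module in `Lo` is that module. -/
def ofTrunc (hn : 2 ≤ n) (hX : Lo n π m X) : (linRep m X).trunc ⟶ X where
  toLin :=
    { toFun := ofTruncAdd hn hX
      map_add' := map_add _
      map_smul' := fun t z => ofTruncAdd_truncAct hn hX t.unop z }
  map_mem {i z} hz := by
    by_cases hi : i ∈ suppDeg n m
    · obtain ⟨x, h⟩ := exists_eq_incl hn hX ⟨i, hi⟩ hz
      have h1 : ofTruncAdd hn hX z = x.1 :=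
        (congrArg (ofTruncAdd hn hX) h).trans (ofTruncAdd_incl hn hX ⟨i, hi⟩ x)
      change ofTruncAdd hn hX z ∈ X.deg i
      rw [h1]
      exact x.2
    · rw [eq_zero_of_mem_truncDeg hi hz]
      change ofTruncAdd hn hX 0 ∈ X.deg i
      rw [map_zero]
      exact zero_mem _

lemma ofTrunc_bijective (hn : 2 ≤ n) (hX : Lo n π m X) :
    Function.Bijective (ofTrunc hn hX).toLin := by
  constructor
  · refine (injective_iff_map_eq_zero _).2 fun z hz => ?_
    refine mem_of_part_mem (M := (linRep m X).trunc) ⊥ fun i => ?_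
    have h1 : (ofTrunc hn hX).toLin ((linRep m X).trunc.part i z) = 0 := by
      rw [map_part, hz, part_zero]
    have hmem : (linRep m X).trunc.part i z ∈ (linRep m X).truncDeg i := part_mem _ i z
    by_cases hi : i ∈ suppDeg n m
    · obtain ⟨x, h⟩ := exists_eq_incl hn hX ⟨i, hi⟩ hmem
      have h2 : x = 0 := Subtype.ext ((ofTruncAdd_incl hn hX ⟨i, hi⟩ x).symm.trans
        ((congrArg (ofTruncAdd hn hX) h).symm.trans h1))
      rw [h2, map_zero] at h
      exact h.trans (map_zero (incl ⟨i, hi⟩))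
    · exact eq_zero_of_mem_truncDeg hi hmem
  · intro x
    refine mem_of_part_mem (M := X) (ofTrunc hn hX).toLin.toAddMonoidHom.range fun i => ?_
    by_cases h0 : X.part i x = 0
    · rw [h0]
      exact zero_mem _
    have hi := mem_suppDeg_of_ne_zero hX.1 (part_mem X i x) h0
    exact ⟨incl ⟨i, hi⟩ (degEquiv hn hX ⟨i, hi⟩ ⟨_, part_mem X i x⟩),
      ofTruncAdd_incl hn hX ⟨i, hi⟩ _⟩

end GrMod

instance (hn : 2 ≤ n) : (toLo π m hn).EssSurj where
  mem_essImage X := ⟨GrMod.linRep m X.obj, ⟨ObjectProperty.isoMk _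
    (GrMod.isoOfBijective (GrMod.ofTrunc hn X.property) (GrMod.ofTrunc_bijective hn X.property))⟩⟩

instance (hn : 2 ≤ n) : (toLo π m hn).IsEquivalence where

end EssSurj

end NKoszul

end

theorem mainTheorem3 {K V L : Type u} [Field K] [Fintype V] [Quiver.{u} V]
    [∀ i j : V, Finite (i ⟶ j)] [Ring L] [Algebra K L]
    (𝓛 : ℤ → Submodule K L) [GradedAlgebra 𝓛] (π : NKoszul.PathAlg K V →ₐ[K] L)
    (n : ℕ) (hn : 2 ≤ n) (m : ℤ)
    (hπ : NKoszul.IsGradedFactor 𝓛 π) (hrel : NKoszul.HasRelationsOfDegreeGE n π) :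
    Nonempty ((NKoszul.Lo n π m).FullSubcategory ≌ (NKoszul.Yo 𝓛 hn m).FullSubcategory) :=
  ⟨(NKoszul.toLo π m hn).asEquivalence.symm.trans
    (NKoszul.toYo m hn hπ hrel).asEquivalence⟩
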